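/- Let $G=(V,E)$ be a simple undirected graph, $V=\{0,\dots,n-1\}$, and let $\alpha_v\in[0,2\pi)$ for $v\in V$. The closed graph-like ZX-diagram $D=(G,\alpha)$ is the tensor network that has, for every vertex $v$, a Z-spider $|0\cdots0\rangle+e^{i\alpha_v}|1\cdots1\rangle$ with one leg for each edge at $v$ (the scalar $1+e^{i\alpha_v}$ if $v$ is isolated), where for every edge $\{u,v\}\in E$ the two corresponding legs are joined by a Hadamard gate $\frac1{\sqrt2}\begin{pmatrix}1&1\\1&-1\end{pmatrix}$. Contracting $D$ means computing the complex number that is the value of this network. A rank-decomposition $T$ of $G$ is a finite tree, with node set $V_T=\{0,\dots,m-1\}$, all of whose nodes have degree $1$ (leaves) or $3$, together with a bijection from $V$ to the leaves (hence $n\ge 2$). An edge $\{u,v\}$ of $T$ has cut-rank $\rho_{u,v}$, the rank over $\mathbb F_2$ of the adjacency matrix of $G$ between $X$ and $V\setminus X$, where $X\subseteq V$ is the set of vertices whose leaf lies in the component of $u$ in $T$ with the edge $\{u,v\}$ deleted. Let $$\mathrm{flops}(T):=\sum_{v\in V_T}2^{w_v},\qquad w_v:=\begin{cases}\min(\rho_{v,u_1}+\rho_{v,u_2},\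 \rho_{v,u_1}+\rho_{v,u_3},\ \rho_{v,u_2}+\rho_{v,u_3}) & \text{if } N_T(v)=\{u_1,u_2,u_3\},\\ 0 & \text{if } v \text{ is a leaf.}\end{cases}$$ Then there is an algorithm which, given any such $D$ and $T$, contracts $D$ in time $\tilde O(\mathrm{flops}(T))$, where $\tilde O$ hides factors polynomial in $n$. Precisely: there are one program $P$ and constants $c,k\in\mathbb N$ such that for all $n$, all closed graph-like ZX-diagrams $D=(G,\alpha)$ with $n$ spiders and all rank-decompositions $T$ of $G$, the program $P$, run on $n$, $m$, the adjacency matrices of $G$ and of $T$, the table of the bijection from $V$ to the leaves, and the phases $\alpha$, halts with the exact value of $D$ as its output after at most $c\,n^k\,\mathrm{flops}(T)$ steps. Here a program is a while-program for a random access machine with finitely many named unbounded arrays of natural numbers and of complex numbers. On natural numbers it has constants, addition, truncated subtraction, multiplication, division with remainder, comparisons, bitwise "and" and "xor", and left shift; every constant, operation and memory access yielding a natural number costs one step plus the bit length of that number. On complex numbers it has exact addition, subtraction and multiplication, the constants $0,1,1/\sqrt2$, loads, and reading $e^{i\alpha_v}$, each at one step; every assignment and every branching or loop test costs one further step. Array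 indices are computed by natural-number expressions, whose cost is included, and control flow depends on natural numbers only. -/

import Mathlib

open scoped BigOperators

noncomputable section

namespace ZXContraction

/-! ## Closed graph-like ZX-diagrams and their scalars -/

/-- A graph-like ZX-diagram without inputs and outputs, with `n` spiders: every spider is a Z-spider,
every edge is a Hadamard edge, and there are neither parallel edges nor self-loops. -/
structure Diagram (n : ℕ) where
  graph : SimpleGraph (Fin n)
  phase : Fin n → ℝ
  phase_mem : ∀ v, phase v ∈ Set.Ico 0 (2 * Real.pi)

/-- The entries of the Z-spider `|0…0⟩ + e^{iα} |1…1⟩` whose legs are indexed by `ι`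
(a spider without legs is the scalar `1 + e^{iα}`). -/
def zSpider {ι : Type*} (α : ℝ) (b : ι → Bool) : ℂ :=
  open Classical in
  (if ∀ i, b i = false then 1 else 0) +
    Complex.exp (α * Complex.I) * (if ∀ i, b i = true then 1 else 0)

/-- The entries of the Hadamard gate. -/
def hadamard (a b : Bool) : ℂ :=
  (1 / (Real.sqrt 2 : ℂ)) * (if a = true ∧ b = true then -1 else 1)

/-- The scalar of a diagram: the contraction of the tensor network in which the legs of the spider
at `v` are the darts (oriented edges) starting at `v`, and for every edge the two legs lying on it
are joined by a Hadamard gate. The darts `d` with `d.fst < d.snd` list every edge once. -/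
def Diagram.scalar {n : ℕ} (D : Diagram n) : ℂ :=
  open Classical in
  ∑ b : D.graph.Dart → Bool,
    (∏ v : Fin n, zSpider (D.phase v) (fun d : {d : D.graph.Dart // d.fst = v} => b d.1)) *
      ∏ d : {d : D.graph.Dart // d.fst < d.snd}, hadamard (b d.1) (b d.1.symm)

/-! ## Rank-decompositions -/

/-- The cut-rank of `X`: the rank over `𝔽₂` of the adjacency matrix between `X` and its
complement. -/
def cutRank {n : ℕ} (G : SimpleGraph (Fin n)) (X : Set (Fin n)) : ℕ :=
  open Classical in
  (Matrix.of (fun (x : X) (y : (Xᶜ : Set (Fin n))) =>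
    if G.Adj x.1 y.1 then (1 : ZMod 2) else 0)).rank

/-- A branch-decomposition with ground set `Fin n`: a finite tree all of whose nodes have degree
`1` (the leaves) or `3`, with a bijection from the ground set to the leaves. -/
structure BranchDecomposition (n : ℕ) where
  size : ℕ
  tree : SimpleGraph (Fin size)
  isTree : tree.IsTree
  degree_eq : ∀ t, (tree.neighborSet t).ncard = 1 ∨ (tree.neighborSet t).ncard = 3
  leaf : Fin n ≃ {t : Fin size // (tree.neighborSet t).ncard = 1}

namespace BranchDecomposition

variable {n : ℕ} (T : BranchDecomposition n)

/-- The ground set elements whose leaf lies in the component of `u` after deleting the edge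
`(u, v)`. -/
def side (u v : Fin T.size) : Set (Fin n) :=
  {x | (T.tree.deleteEdges {s(u, v)}).Reachable u (T.leaf x).1}

/-- The cut-rank `ρ_{u,v}` that the rank-decomposition of `G` assigns to the edge `(u, v)`. -/
def edgeRank (G : SimpleGraph (Fin n)) (u v : Fin T.size) : ℕ :=
  cutRank G (T.side u v)

/-- The exponent `w_t`: `0` at a leaf, and otherwise the smallest sum of the cut-ranks of two
different edges at `t`. -/
def weight (G : SimpleGraph (Fin n)) (t : Fin T.size) : ℕ :=
  open Classical in
  if (T.tree.neighborSet t).ncard = 1 then 0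
  else sInf {k | ∃ u₁ u₂, T.tree.Adj t u₁ ∧ T.tree.Adj t u₂ ∧ u₁ ≠ u₂ ∧
    k = T.edgeRank G t u₁ + T.edgeRank G t u₂}

/-- `flops(T) = ∑_t 2^{w_t}`. -/
def flops (G : SimpleGraph (Fin n)) : ℕ :=
  ∑ t : Fin T.size, 2 ^ T.weight G t

end BranchDecomposition

/-! ## The machine model

A random access machine with finitely many named arrays of natural numbers and finitely many named
arrays of complex numbers, programmed by a `while`-language. Operations on natural numbers are
charged by bit length (the logarithmic cost criterion), an exact arithmetic operation on complex
numbers costs one step, and the control flow cannot depend on complex numbers. -/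

/-- The memory: `nat a i` and `cpx a i` are the `i`-th cells of the `a`-th arrays of natural and of
complex numbers. The angles are a read-only part of the input. -/
structure State where
  nat : ℕ → ℕ → ℕ
  cpx : ℕ → ℕ → ℂ
  angle : ℕ → ℝ

/-- Binary operations on natural numbers. -/
inductive NatOp where
  | add | sub | mul | div | mod | lt | eq | and | xor | shiftLeft

/-- `sub` is truncated, `lt` and `eq` return `1` for true and `0` for false, and `and` and `xor` act
bitwise. -/
def NatOp.eval : NatOp → ℕ → ℕ → ℕ
  | add, x, y => x + y
  | sub, x, y => x - y
  | mul, x, y => x * y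
  | div, x, y => x / y
  | mod, x, y => x % y
  | lt, x, y => if x < y then 1 else 0
  | eq, x, y => if x = y then 1 else 0
  | and, x, y => x &&& y
  | xor, x, y => x ^^^ y
  | shiftLeft, x, y => x <<< y

/-- Expressions for natural numbers; `load a e` is the content of cell `e` of array `a`. -/
inductive NatExpr where
  | const (k : ℕ)
  | load (a : ℕ) (e : NatExpr)
  | op (o : NatOp) (e₁ e₂ : NatExpr)

def NatExpr.eval (σ : State) : NatExpr → ℕ
  | const k => k
  | load a e => σ.nat a (e.eval σ)
  | op o e₁ e₂ => o.eval (e₁.eval σ) (e₂.eval σ)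

/-- The cost of an evaluation: every constant, memory access and operation costs one step plus the
number of bits of the value it yields, in addition to the cost of its arguments. -/
def NatExpr.cost (σ : State) : NatExpr → ℕ
  | const k => 1 + Nat.size k
  | load a e => e.cost σ + 1 + Nat.size ((load a e).eval σ)
  | op o e₁ e₂ => e₁.cost σ + e₂.cost σ + 1 + Nat.size ((op o e₁ e₂).eval σ)

/-- Expressions for complex numbers. The only constants are `0`, `1` and `1/√2`, and the only access
to the angles `α` is through the numbers `e^{iα}`. -/
inductive CpxExpr where
  | zero
  | one
  | invSqrtTwo
  | expAngle (e : NatExpr)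
  | load (a : ℕ) (e : NatExpr)
  | add (e₁ e₂ : CpxExpr)
  | sub (e₁ e₂ : CpxExpr)
  | mul (e₁ e₂ : CpxExpr)

def CpxExpr.eval (σ : State) : CpxExpr → ℂ
  | zero => 0
  | one => 1
  | invSqrtTwo => 1 / (Real.sqrt 2 : ℂ)
  | expAngle e => Complex.exp (σ.angle (e.eval σ) * Complex.I)
  | load a e => σ.cpx a (e.eval σ)
  | add e₁ e₂ => e₁.eval σ + e₂.eval σ
  | sub e₁ e₂ => e₁.eval σ - e₂.eval σ
  | mul e₁ e₂ => e₁.eval σ * e₂.eval σ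

/-- Every complex operation or memory access costs one step, in addition to its arguments. -/
def CpxExpr.cost (σ : State) : CpxExpr → ℕ
  | zero => 1
  | one => 1
  | invSqrtTwo => 1
  | expAngle e => e.cost σ + 1
  | load _ e => e.cost σ + 1
  | add e₁ e₂ => e₁.cost σ + e₂.cost σ + 1
  | sub e₁ e₂ => e₁.cost σ + e₂.cost σ + 1
  | mul e₁ e₂ => e₁.cost σ + e₂.cost σ + 1

/-- Programs. `setNat a i e` and `setCpx a i e` store the value of `e` in cell `i` of array `a`. -/
inductive Program where
  | skip
  | setNat (a : ℕ) (i e : NatExpr)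
  | setCpx (a : ℕ) (i : NatExpr) (e : CpxExpr)
  | seq (p q : Program)
  | ite (e : NatExpr) (p q : Program)
  | while (e : NatExpr) (p : Program)

def State.setNat (σ : State) (a i x : ℕ) : State :=
  { σ with nat := Function.update σ.nat a (Function.update (σ.nat a) i x) }

def State.setCpx (σ : State) (a i : ℕ) (x : ℂ) : State :=
  { σ with cpx := Function.update σ.cpx a (Function.update (σ.cpx a) i x) }

/-- `Runs p σ t τ`: started in the state `σ`, the program `p` halts after `t` steps in the
state `τ`. A condition counts as true if its value is not `0`. -/
inductive Runs : Program → State → ℕ → State → Prop where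
  | skip (σ : State) : Runs .skip σ 1 σ
  | setNat (σ : State) (a : ℕ) (i e : NatExpr) :
      Runs (.setNat a i e) σ (i.cost σ + e.cost σ + 1) (σ.setNat a (i.eval σ) (e.eval σ))
  | setCpx (σ : State) (a : ℕ) (i : NatExpr) (e : CpxExpr) :
      Runs (.setCpx a i e) σ (i.cost σ + e.cost σ + 1) (σ.setCpx a (i.eval σ) (e.eval σ))
  | seq {p q : Program} {σ σ' σ'' : State} {t t' : ℕ}
      (hp : Runs p σ t σ') (hq : Runs q σ' t' σ'') : Runs (.seq p q) σ (t + t') σ''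
  | iteTrue {e : NatExpr} {p q : Program} {σ σ' : State} {t : ℕ} (he : e.eval σ ≠ 0)
      (hp : Runs p σ t σ') : Runs (.ite e p q) σ (e.cost σ + 1 + t) σ'
  | iteFalse {e : NatExpr} {p q : Program} {σ σ' : State} {t : ℕ} (he : e.eval σ = 0)
      (hq : Runs q σ t σ') : Runs (.ite e p q) σ (e.cost σ + 1 + t) σ'
  | whileFalse {e : NatExpr} {p : Program} {σ : State} (he : e.eval σ = 0) :
      Runs (.while e p) σ (e.cost σ + 1) σ
  | whileTrue {e : NatExpr} {p : Program} {σ σ' σ'' : State} {t t' : ℕ} (he : e.eval σ ≠ 0)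
      (hp : Runs p σ t σ') (hw : Runs (.while e p) σ' t' σ'') :
      Runs (.while e p) σ (e.cost σ + 1 + t + t') σ''

/-! ## Input and output -/

/-- The adjacency matrix of a graph on `Fin m`, stored row by row and followed by zeros. -/
def adjacencyTable {m : ℕ} (G : SimpleGraph (Fin m)) (i : ℕ) : ℕ :=
  open Classical in
  if ∃ u v : Fin m, i = u.1 * m + v.1 ∧ G.Adj u v then 1 else 0

/-- The initial state on a diagram and a decomposition. The arrays `0` to `3` of natural numbers
hold: the number of spiders and the number of tree nodes; the adjacency matrix of the graph; the
adjacency matrix of the tree; the leaf of each spider. The angles are the phases of the spiders, and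
everything else is zero. -/
def inputState {n : ℕ} (D : Diagram n) (T : BranchDecomposition n) : State where
  nat
    | 0 => fun i => if i = 0 then n else if i = 1 then T.size else 0
    | 1 => adjacencyTable D.graph
    | 2 => adjacencyTable T.tree
    | 3 => fun i => if h : i < n then (T.leaf ⟨i, h⟩).1.1 else 0
    | _ => fun _ => 0
  cpx := fun _ _ => 0
  angle := fun i => if h : i < n then D.phase ⟨i, h⟩ else 0

/-- The output is cell `0` of the complex array `0`. -/
def State.output (σ : State) : ℂ := σ.cpx 0 0

end ZXContraction

end

/-! Summing out the legs turns the scalar into one factor `1/√2` per edge times the sum, over all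
`x` in `𝔽₂^n`, of `amp x`: the product of the phases of the spiders with `x v = 1`, times the sign
`(-1)^q`, where `q` counts the edges inside `x` (`Diagram.scalar_eq`). The exponent `q` is a
quadratic form whose polar form is the pairing of `nbrSum x` with `y` (`quad_add`).

Hence an assignment of a set `X` of spiders acts on the outside only through its boundary `bd X x`,
the neighbour sum outside `X`. The boundaries form an `𝔽₂`-space of dimension `cutRank X`
(`two_pow_cutRank`), so a table `part X` with `2 ^ cutRank X` entries, the amplitudes grouped by
boundary, holds all that matters about `X`. Its Walsh–Hadamard transform `dual X` is indexed by
assignments `c` outside `X`, of which only the pairings with the boundaries matter.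

Let an inner node join sides `A` and `B` into `X = A ∪ B`. By `Enum.part_union`, the table of `X`
follows from those of `A` and `B` with `2 ^ (ρ A + ρ B)` elementary steps. By `Enum.dual_union`, the
transform of `X` follows from the table of `A` and the transform of `B` with `2 ^ (ρ A + ρ X)`
steps: `c` need only run through representatives of the boundaries of the complement of `X`, which
realise every frequency exactly once (`Enum.coord_surj`). If `ρ A ≤ ρ B`, the cheaper way costs `2 ^
(ρ A + min (ρ B) (ρ X))`, which is `2 ^ w` for the exponent `w` of that node. The fast transform
passes between table and transform with about `ρ X * 2 ^ ρ X` operations, and `ρ X ≤ ρ A + ρ B`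
(`cutRank_union_le`) keeps this within the same bound.

Every directed tree edge is treated in this way, smaller sides first. The edge pointing to the leaf
of spider `0` cuts off all other spiders, and two entries of its transform give the whole sum
(`sum_amp_eq`).

For the running time, `Ex` is a total-correctness triple whose time bound is `n ^ deg * f` with
`deg` read off the program text. All numbers stay below `2 ^ (10 * n)`, so bit costs are polynomial;
loops of exponential length are charged to `f`, the others to a power of `n` (`Ex.forLt`). The
exponent does not depend on the input, and so neither does the final bound. -/

noncomputable section

namespace ZXContraction

/-! ## A calculus for total correctness and polynomial running time -/

/-- The expression contains no shift. -/
def NatExpr.ok : NatExpr → Bool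
  | const _ => true
  | load _ e => e.ok
  | op .shiftLeft _ _ => false
  | op _ e₁ e₂ => e₁.ok && e₂.ok

def CpxExpr.ok : CpxExpr → Bool
  | zero | one | invSqrtTwo => true
  | expAngle e | load _ e => e.ok
  | add e₁ e₂ | sub e₁ e₂ | mul e₁ e₂ => e₁.ok && e₂.ok

/-- The exponents are generous: each node adds enough that, for `n ≥ 2`, constant factors and
summands of the cost are swallowed by the additional powers of `n`. The `4` of a load pays for a
value of up to `10 * n` bits. -/
def NatExpr.deg : NatExpr → ℕ
  | const k => Nat.size k + 1
  | load _ e => e.deg + 4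
  | op _ e₁ e₂ => e₁.deg + e₂.deg + 2

def CpxExpr.deg : CpxExpr → ℕ
  | zero | one | invSqrtTwo => 1
  | expAngle e | load _ e => e.deg + 1
  | add e₁ e₂ | sub e₁ e₂ | mul e₁ e₂ => e₁.deg + e₂.deg + 1

/-- The exponent of a polynomial bound on the running time. -/
def Program.deg : Program → ℕ
  | skip => 1
  | setNat _ i e => i.deg + e.deg + 1
  | setCpx _ i e => i.deg + e.deg + 1
  | seq p q => p.deg + q.deg
  | ite e p q => e.deg + p.deg + q.deg + 1
  | .while e p => e.deg + p.deg + 14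

/-- The names of the arrays of natural numbers that a program writes. -/
def Program.writesNat : Program → List ℕ
  | skip | setCpx _ _ _ => []
  | setNat a _ _ => [a]
  | seq p q | ite _ p q => p.writesNat ++ q.writesNat
  | .while _ p => p.writesNat

/-- The names of the arrays of complex numbers that a program writes. -/
def Program.writesCpx : Program → List ℕ
  | skip | setNat _ _ _ => []
  | setCpx a _ _ => [a]
  | seq p q | ite _ p q => p.writesCpx ++ q.writesCpx
  | .while _ p => p.writesCpx

/-- Every cell holds a number of at most `10 * n` bits. -/
def State.Small (n : ℕ) (σ : State) : Prop := ∀ a i, σ.nat a i < 2 ^ (10 * n)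

theorem NatExpr.one_le_deg (e : NatExpr) : 1 ≤ e.deg := by
  cases e <;> simp only [NatExpr.deg] <;> omega

theorem CpxExpr.one_le_deg (e : CpxExpr) : 1 ≤ e.deg := by
  cases e <;> simp only [CpxExpr.deg] <;> omega

theorem Program.one_le_deg (p : Program) : 1 ≤ p.deg := by
  induction p <;> simp only [Program.deg] <;> omega

theorem NatExpr.size_eval_le_cost (σ : State) (e : NatExpr) : Nat.size (e.eval σ) ≤ e.cost σ := by
  cases e <;> simp only [NatExpr.cost, NatExpr.eval] <;> omega

/-- Multiplication and addition add at most the lengths and one carry; the other operations do not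
exceed this. A left shift is excluded because its result can be exponentially longer than its
arguments. -/
theorem NatOp.size_eval_le (o : NatOp) (ho : o ≠ .shiftLeft) (x y : ℕ) :
    Nat.size (o.eval x y) ≤ Nat.size x + Nat.size y + 1 := by
  have hx : x < 2 ^ x.size := Nat.lt_size_self x
  have hy : y < 2 ^ y.size := Nat.lt_size_self y
  have mono : ∀ z, z ≤ x → Nat.size z ≤ Nat.size x + Nat.size y + 1 := fun z hz =>
    (Nat.size_le_size hz).trans (by omega)
  have hx1 : 2 ^ x.size ≤ 2 ^ (x.size + y.size) := Nat.pow_le_pow_right (by simp) (by omega)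
  have hy1 : 2 ^ y.size ≤ 2 ^ (x.size + y.size) := Nat.pow_le_pow_right (by simp) (by omega)
  cases o with
  | add =>
    rw [Nat.size_le, pow_succ]
    simp only [NatOp.eval]; omega
  | sub => exact mono _ (Nat.sub_le _ _)
  | mul =>
    rw [Nat.size_le, pow_succ, pow_add]
    simp only [NatOp.eval]
    have := Nat.mul_lt_mul'' hx hy
    omega
  | div => exact mono _ (Nat.div_le_self _ _)
  | mod => exact mono _ (Nat.mod_le _ _)
  | lt =>
    rw [Nat.size_le, pow_succ]
    have : 0 < 2 ^ (x.size + y.size) := by positivity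
    simp only [NatOp.eval]; split <;> omega
  | eq =>
    rw [Nat.size_le, pow_succ]
    have : 0 < 2 ^ (x.size + y.size) := by positivity
    simp only [NatOp.eval]; split <;> omega
  | and => exact mono _ Nat.and_le_left
  | xor =>
    rw [Nat.size_le, pow_succ]
    have := Nat.xor_lt_two_pow (lt_of_lt_of_le hx hx1) (lt_of_lt_of_le hy hy1)
    simp only [NatOp.eval]; omega
  | shiftLeft => exact absurd rfl ho

section Arithmetic

variable {n : ℕ}

theorem le_pow_deg (hn : 2 ≤ n) {d : ℕ} (hd : 1 ≤ d) : 2 ≤ n ^ d :=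
  hn.trans (Nat.le_self_pow (by omega) n)

theorem pow_add_pow_le (hn : 2 ≤ n) {a b : ℕ} (ha : 1 ≤ a) (hb : 1 ≤ b) :
    n ^ a + n ^ b ≤ n ^ (a + b) := by
  have h1 := le_pow_deg hn ha
  have h2 := le_pow_deg hn hb
  rw [pow_add]; nlinarith

theorem two_pow_mul_le (hn : 2 ≤ n) (a d : ℕ) : 2 ^ a * n ^ d ≤ n ^ (d + a) := by
  rw [pow_add, mul_comm]; gcongr

end Arithmetic

theorem NatExpr.cost_le {n : ℕ} (hn : 2 ≤ n) {σ : State} (hσ : σ.Small n) (e : NatExpr)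
    (he : e.ok = true) : e.cost σ ≤ n ^ e.deg := by
  induction e with
  | const k =>
    have h1 : Nat.size k + 1 < 2 ^ (Nat.size k + 1) := Nat.lt_two_pow_self
    have h2 : 2 ^ (Nat.size k + 1) ≤ n ^ (Nat.size k + 1) := Nat.pow_le_pow_left hn _
    simp only [NatExpr.cost, NatExpr.deg]; omega
  | load a e ih =>
    have h1 := ih (by simpa [NatExpr.ok] using he)
    have h2 : Nat.size (σ.nat a (e.eval σ)) ≤ 10 * n := Nat.size_le.2 (hσ _ _)
    have h3 : n ≤ n ^ e.deg := Nat.le_self_pow (by have := e.one_le_deg; omega) n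
    have h4 := two_pow_mul_le hn 4 e.deg
    simp only [NatExpr.cost, NatExpr.deg, NatExpr.eval]; omega
  | op o e₁ e₂ ih₁ ih₂ =>
    have ho : o ≠ .shiftLeft := by rintro rfl; simp [NatExpr.ok] at he
    have hok : e₁.ok = true ∧ e₂.ok = true := by
      cases o <;> simp_all [NatExpr.ok]
    have h1 := ih₁ hok.1
    have h2 := ih₂ hok.2
    have h3 := o.size_eval_le ho (e₁.eval σ) (e₂.eval σ)
    have h4 := e₁.size_eval_le_cost σ
    have h5 := e₂.size_eval_le_cost σ
    have h6 := pow_add_pow_le hn e₁.one_le_deg e₂.one_le_deg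
    have h7 := two_pow_mul_le hn 2 (e₁.deg + e₂.deg)
    have h8 := le_pow_deg hn (d := e₁.deg + e₂.deg) (by have := e₁.one_le_deg; omega)
    simp only [NatExpr.cost, NatExpr.deg, NatExpr.eval]; omega

theorem CpxExpr.cost_le {n : ℕ} (hn : 2 ≤ n) {σ : State} (hσ : σ.Small n) (e : CpxExpr)
    (he : e.ok = true) : e.cost σ ≤ n ^ e.deg := by
  have bin : ∀ (e₁ e₂ : CpxExpr), e₁.cost σ ≤ n ^ e₁.deg → e₂.cost σ ≤ n ^ e₂.deg →
      e₁.cost σ + e₂.cost σ + 1 ≤ n ^ (e₁.deg + e₂.deg + 1) := by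
    intro e₁ e₂ h1 h2
    have h6 := pow_add_pow_le hn e₁.one_le_deg e₂.one_le_deg
    have h7 := two_pow_mul_le hn 1 (e₁.deg + e₂.deg)
    have h8 := le_pow_deg hn (d := e₁.deg + e₂.deg) (by have := e₁.one_le_deg; omega)
    omega
  have un : ∀ e : NatExpr, e.ok = true → e.cost σ + 1 ≤ n ^ (e.deg + 1) := by
    intro e h
    have h1 := e.cost_le hn hσ h
    have h7 := two_pow_mul_le hn 1 e.deg
    have h8 := le_pow_deg hn e.one_le_deg
    omega
  induction e with
  | zero | one | invSqrtTwo => simp only [CpxExpr.cost, CpxExpr.deg, pow_one]; omega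
  | expAngle e => exact un e (by simpa [CpxExpr.ok] using he)
  | load a e => exact un e (by simpa [CpxExpr.ok] using he)
  | add e₁ e₂ ih₁ ih₂ | sub e₁ e₂ ih₁ ih₂ | mul e₁ e₂ ih₁ ih₂ =>
    simp only [CpxExpr.ok, Bool.and_eq_true] at he
    exact bin _ _ (ih₁ he.1) (ih₂ he.2)

/-- Started in `σ`, the program `p` halts within `n ^ p.deg * f` steps in a state satisfying `Q`,
provided that all numbers in `σ` are small, and then they remain small. -/
def Ex (n f : ℕ) (p : Program) (σ : State) (Q : State → Prop) : Prop :=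
  2 ≤ n → 1 ≤ f → σ.Small n →
    ∃ t τ, Runs p σ t τ ∧ t ≤ n ^ p.deg * f ∧ τ.Small n ∧ Q τ

/-- `τ` agrees with `σ` on the angles and on all arrays outside the two lists. -/
structure Frame (ln lc : List ℕ) (σ τ : State) : Prop where
  nat : ∀ a, a ∉ ln → τ.nat a = σ.nat a
  cpx : ∀ a, a ∉ lc → τ.cpx a = σ.cpx a
  angle : τ.angle = σ.angle

theorem Frame.refl (ln lc : List ℕ) (σ : State) : Frame ln lc σ σ :=
  ⟨fun _ _ => rfl, fun _ _ => rfl, rfl⟩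

theorem Frame.trans {ln lc : List ℕ} {σ τ υ : State} (h₁ : Frame ln lc σ τ)
    (h₂ : Frame ln lc τ υ) : Frame ln lc σ υ :=
  ⟨fun a ha => (h₂.nat a ha).trans (h₁.nat a ha), fun a ha => (h₂.cpx a ha).trans (h₁.cpx a ha),
    h₂.angle.trans h₁.angle⟩

theorem Frame.mono {ln lc ln' lc' : List ℕ} {σ τ : State} (h : Frame ln lc σ τ) (hn : ln ⊆ ln')
    (hc : lc ⊆ lc') : Frame ln' lc' σ τ :=
  ⟨fun a ha => h.nat a fun h' => ha (hn h'), fun a ha => h.cpx a fun h' => ha (hc h'), h.angle⟩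

theorem Runs.frame {p : Program} {σ τ : State} {t : ℕ} (h : Runs p σ t τ) :
    Frame p.writesNat p.writesCpx σ τ := by
  induction h with
  | skip σ => exact Frame.refl _ _ _
  | setNat σ a i e =>
    refine ⟨fun b hb => ?_, fun _ _ => rfl, rfl⟩
    simp only [Program.writesNat, List.mem_singleton] at hb
    simp [State.setNat, hb]
  | setCpx σ a i e =>
    refine ⟨fun _ _ => rfl, fun b hb => ?_, rfl⟩
    simp only [Program.writesCpx, List.mem_singleton] at hb
    simp [State.setCpx, hb]
  | seq _ _ h₁ h₂ =>
    exact (h₁.mono (List.subset_append_left _ _) (List.subset_append_left _ _)).trans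
      (h₂.mono (List.subset_append_right _ _) (List.subset_append_right _ _))
  | iteTrue _ _ h => exact h.mono (List.subset_append_left _ _) (List.subset_append_left _ _)
  | iteFalse _ _ h => exact h.mono (List.subset_append_right _ _) (List.subset_append_right _ _)
  | whileFalse _ => exact Frame.refl _ _ _
  | whileTrue _ _ _ h₁ h₂ => exact h₁.trans h₂

namespace Ex

variable {n f : ℕ} {p q : Program} {σ : State} {Q R : State → Prop}

/-- The frame comes for free from the run. Since the written arrays are computed from the program
text, later proofs dispose of unchanged arrays by `decide`. -/
theorem mono (h : Ex n f p σ Q) (hQ : ∀ τ, Frame p.writesNat p.writesCpx σ τ → Q τ → R τ) :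
    Ex n f p σ R := by
  intro hn hf hσ
  obtain ⟨t, τ, h1, h2, h3, h4⟩ := h hn hf hσ
  exact ⟨t, τ, h1, h2, h3, hQ τ h1.frame h4⟩

theorem assume (h : 2 ≤ n → 1 ≤ f → σ.Small n → Ex n f p σ Q) : Ex n f p σ Q :=
  fun hn hf hσ => h hn hf hσ hn hf hσ

theorem skip (h : Q σ) : Ex n f .skip σ Q := by
  intro hn hf hσ
  refine ⟨1, σ, .skip σ, ?_, hσ, h⟩
  have := le_pow_deg hn (d := 1) le_rfl
  simp only [Program.deg]; nlinarith

theorem setNat {a : ℕ} {i e : NatExpr} (hi : i.ok = true) (he : e.ok = true)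
    (hs : e.eval σ < 2 ^ (10 * n)) (h : Q (σ.setNat a (i.eval σ) (e.eval σ))) :
    Ex n f (.setNat a i e) σ Q := by
  intro hn hf hσ
  refine ⟨_, _, .setNat σ a i e, ?_, ?_, h⟩
  · have h1 := i.cost_le hn hσ hi
    have h2 := e.cost_le hn hσ he
    have h6 := pow_add_pow_le hn i.one_le_deg e.one_le_deg
    have h7 := two_pow_mul_le hn 1 (i.deg + e.deg)
    have h8 := le_pow_deg hn (d := i.deg + e.deg) (by have := e.one_le_deg; omega)
    simp only [Program.deg]
    refine le_trans ?_ (Nat.le_mul_of_pos_right _ hf)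
    omega
  · intro b j
    simp only [State.setNat]
    by_cases hb : b = a
    · subst hb
      by_cases hj : j = i.eval σ
      · subst hj; simpa using hs
      · simpa [hj] using hσ b j
    · simpa [hb] using hσ b j

theorem set {a : ℕ} {i e : NatExpr} (iv ev : ℕ) (hiv : i.eval σ = iv) (hev : e.eval σ = ev)
    (hs : ev < 2 ^ (10 * n)) (h : Q (σ.setNat a iv ev)) (hi : i.ok = true := by rfl)
    (he : e.ok = true := by rfl) : Ex n f (.setNat a i e) σ Q := by
  subst hiv hev
  exact setNat hi he hs h

theorem setCpx {a : ℕ} {i : NatExpr} {e : CpxExpr} (hi : i.ok = true) (he : e.ok = true)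
    (h : Q (σ.setCpx a (i.eval σ) (e.eval σ))) : Ex n f (.setCpx a i e) σ Q := by
  intro hn hf hσ
  refine ⟨_, _, .setCpx σ a i e, ?_, fun b j => hσ b j, h⟩
  have h1 := i.cost_le hn hσ hi
  have h2 := e.cost_le hn hσ he
  have h6 := pow_add_pow_le hn i.one_le_deg e.one_le_deg
  have h7 := two_pow_mul_le hn 1 (i.deg + e.deg)
  have h8 := le_pow_deg hn (d := i.deg + e.deg) (by have := e.one_le_deg; omega)
  simp only [Program.deg]
  refine le_trans ?_ (Nat.le_mul_of_pos_right _ hf)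
  omega

theorem setC {a : ℕ} {i : NatExpr} {e : CpxExpr} (iv : ℕ) (ev : ℂ) (hiv : i.eval σ = iv)
    (hev : e.eval σ = ev) (h : Q (σ.setCpx a iv ev)) (hi : i.ok = true := by rfl)
    (he : e.ok = true := by rfl) : Ex n f (.setCpx a i e) σ Q := by
  subst hiv hev
  exact setCpx hi he h

theorem seq (h : Ex n f p σ fun τ => Ex n f q τ Q) : Ex n f (.seq p q) σ Q := by
  intro hn hf hσ
  obtain ⟨t, τ, h1, h2, h3, h4⟩ := h hn hf hσ
  obtain ⟨t', τ', h1', h2', h3', h4'⟩ := h4 hn hf h3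
  refine ⟨_, _, .seq h1 h1', ?_, h3', h4'⟩
  have := pow_add_pow_le hn p.one_le_deg q.one_le_deg
  simp only [Program.deg]
  nlinarith

theorem ite {e : NatExpr} (he : e.ok = true) (h₁ : e.eval σ ≠ 0 → Ex n f p σ Q)
    (h₂ : e.eval σ = 0 → Ex n f q σ Q) : Ex n f (.ite e p q) σ Q := by
  intro hn hf hσ
  have h1 := e.cost_le hn hσ he
  have key : ∀ d₁ d₂ t : ℕ, 1 ≤ d₁ → t ≤ n ^ d₁ * f →
      e.cost σ + 1 + t ≤ n ^ (e.deg + d₁ + d₂ + 1) * f := by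
    intro d₁ d₂ t hd ht
    have h6 := pow_add_pow_le hn e.one_le_deg hd
    have h7 := two_pow_mul_le hn 1 (e.deg + d₁)
    have h8 := le_pow_deg hn (d := e.deg + d₁) (by omega)
    have h9 : n ^ (e.deg + d₁ + 1) ≤ n ^ (e.deg + d₁ + d₂ + 1) :=
      Nat.pow_le_pow_right (by omega) (by omega)
    nlinarith
  by_cases hc : e.eval σ = 0
  · obtain ⟨t, τ, a1, a2, a3, a4⟩ := h₂ hc hn hf hσ
    refine ⟨_, _, .iteFalse hc a1, ?_, a3, a4⟩
    have := key q.deg p.deg t q.one_le_deg a2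
    simpa only [Program.deg, add_right_comm] using this
  · obtain ⟨t, τ, a1, a2, a3, a4⟩ := h₁ hc hn hf hσ
    exact ⟨_, _, .iteTrue hc a1, key p.deg q.deg t p.one_le_deg a2, a3, a4⟩

theorem cond {e : NatExpr} (c : ℕ) (hc : e.eval σ = c) (h₁ : c ≠ 0 → Ex n f p σ Q)
    (h₂ : c = 0 → Ex n f q σ Q) (he : e.ok = true := by rfl) : Ex n f (.ite e p q) σ Q := by
  subst hc
  exact ite he h₁ h₂

end Ex

@[simp] theorem State.setNat_nat (σ : State) (a i x b j : ℕ) :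
    (σ.setNat a i x).nat b j = if b = a ∧ j = i then x else σ.nat b j := by
  simp only [State.setNat, Function.update_apply]
  by_cases hb : b = a
  · subst hb; simp [Function.update_apply]
  · simp [hb]

theorem State.setNat_nat_ne (σ : State) {a b : ℕ} (i x : ℕ) (h : b ≠ a) :
    (σ.setNat a i x).nat b = σ.nat b := by
  simp [State.setNat, h]

@[simp] theorem State.setNat_cpx (σ : State) (a i x : ℕ) : (σ.setNat a i x).cpx = σ.cpx := rfl

@[simp] theorem State.setNat_angle (σ : State) (a i x : ℕ) :
    (σ.setNat a i x).angle = σ.angle := rfl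

@[simp] theorem State.setCpx_nat (σ : State) (a i : ℕ) (x : ℂ) :
    (σ.setCpx a i x).nat = σ.nat := rfl

@[simp] theorem State.setCpx_angle (σ : State) (a i : ℕ) (x : ℂ) :
    (σ.setCpx a i x).angle = σ.angle := rfl

@[simp] theorem State.setCpx_cpx (σ : State) (a i : ℕ) (x : ℂ) (b j : ℕ) :
    (σ.setCpx a i x).cpx b j = if b = a ∧ j = i then x else σ.cpx b j := by
  simp only [State.setCpx, Function.update_apply]
  by_cases hb : b = a
  · subst hb; simp [Function.update_apply]
  · simp [hb]

theorem State.setCpx_cpx_ne (σ : State) {a b : ℕ} (i : ℕ) (x : ℂ) (h : b ≠ a) :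
    (σ.setCpx a i x).cpx b = σ.cpx b := by
  simp [State.setCpx, h]

/-! ### Notation for programs -/

/-- The content of the variable `a`, that is, of cell `0` of the array `a`. -/
abbrev NatExpr.var (a : ℕ) : NatExpr := .load a (.const 0)

instance : Add NatExpr := ⟨.op .add⟩
instance : Sub NatExpr := ⟨.op .sub⟩
instance : Mul NatExpr := ⟨.op .mul⟩
instance : Div NatExpr := ⟨.op .div⟩
instance : Mod NatExpr := ⟨.op .mod⟩
instance : AndOp NatExpr := ⟨.op .and⟩
instance : XorOp NatExpr := ⟨.op .xor⟩
instance (k : ℕ) : OfNat NatExpr k := ⟨.const k⟩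

namespace NatExpr

variable (σ : State) (e₁ e₂ : NatExpr)

@[simp] theorem eval_zero : (0 : NatExpr).eval σ = 0 := rfl
@[simp] theorem eval_one : (1 : NatExpr).eval σ = 1 := rfl
@[simp] theorem eval_two : (2 : NatExpr).eval σ = 2 := rfl
@[simp] theorem eval_const (k : ℕ) : (const k).eval σ = k := rfl
@[simp] theorem eval_load (a : ℕ) (e : NatExpr) : (load a e).eval σ = σ.nat a (e.eval σ) := rfl
@[simp] theorem eval_add : (e₁ + e₂).eval σ = e₁.eval σ + e₂.eval σ := rfl
@[simp] theorem eval_sub : (e₁ - e₂).eval σ = e₁.eval σ - e₂.eval σ := rfl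
@[simp] theorem eval_mul : (e₁ * e₂).eval σ = e₁.eval σ * e₂.eval σ := rfl
@[simp] theorem eval_div : (e₁ / e₂).eval σ = e₁.eval σ / e₂.eval σ := rfl
@[simp] theorem eval_mod : (e₁ % e₂).eval σ = e₁.eval σ % e₂.eval σ := rfl
@[simp] theorem eval_and : (e₁ &&& e₂).eval σ = e₁.eval σ &&& e₂.eval σ := rfl
@[simp] theorem eval_xor : (e₁ ^^^ e₂).eval σ = e₁.eval σ ^^^ e₂.eval σ := rfl
@[simp] theorem eval_lt :
    (op .lt e₁ e₂).eval σ = if e₁.eval σ < e₂.eval σ then 1 else 0 := rfl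
@[simp] theorem eval_eq :
    (op .eq e₁ e₂).eval σ = if e₁.eval σ = e₂.eval σ then 1 else 0 := rfl

end NatExpr

attribute [simp] CpxExpr.eval

infixr:60 " ;; " => Program.seq

/-- `for i < b do p`, where the counter is the variable `i`. -/
def Program.forLt (i : ℕ) (b : NatExpr) (p : Program) : Program :=
  .setNat i (.const 0) (.const 0) ;;
    .while (.op .lt (.var i) b) (p ;; .setNat i (.const 0) (.op .add (.var i) (.const 1)))

/-- The separate factor `f₁` for the body allows both kinds of loops: polynomially many expensive
iterations (`f₁ = f`), or up to about `n * f` cheap ones (`f₁ = 1`). The invariant is required after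
the counter has been advanced, and the bound of the loop must keep its value `N` under it. -/
theorem Ex.forLt {n f f₁ i N : ℕ} {b : NatExpr} {p : Program} {σ : State} (Inv : ℕ → State → Prop)
    {Q : State → Prop} (hf₁ : 1 ≤ f₁) (hN : N * f₁ ≤ n ^ 12 * f) (hNs : N < 2 ^ (10 * n))
    (hbe : ∀ k τ, Inv k τ → Frame (i :: p.writesNat) p.writesCpx σ τ → b.eval τ = N)
    (h0 : Inv 0 (σ.setNat i 0 0))
    (hstep : ∀ k τ, k < N → Inv k τ → τ.nat i 0 = k →
      Frame (i :: p.writesNat) p.writesCpx σ τ →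
      Ex n f₁ p τ fun τ' => Inv (k + 1) (τ'.setNat i 0 (k + 1)))
    (hQ : ∀ τ, Inv N τ → Frame (i :: p.writesNat) p.writesCpx σ τ → Q τ)
    (hb : b.ok = true := by rfl) (hi : i ∉ p.writesNat := by decide) :
    Ex n f (.forLt i b p) σ Q := by
  intro hn hf hσ
  set c : NatExpr := .op .lt (.var i) b with hc
  have hcok : c.ok = true := by simp [hc, NatExpr.ok, hb]
  set inc : Program := .setNat i (.const 0) (.op .add (.var i) (.const 1)) with hinc
  have body : ∀ k τ, k < N → Inv k τ → τ.nat i 0 = k →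
      Frame (i :: p.writesNat) p.writesCpx σ τ → τ.Small n →
      ∃ t τ', Runs (p ;; inc) τ t τ' ∧ t ≤ n ^ (p ;; inc).deg * f₁ ∧ τ'.Small n ∧
        Inv (k + 1) τ' ∧ τ'.nat i 0 = k + 1 := by
    intro k τ hk hI hik hfr hs
    have : Ex n f₁ (p ;; inc) τ fun τ' => Inv (k + 1) τ' ∧ τ'.nat i 0 = k + 1 := by
      refine Ex.seq ((hstep k τ hk hI hik hfr).mono fun τ' hfr' h => ?_)
      have hv : τ'.nat i 0 = k := by rw [hfr'.nat i hi, hik]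
      refine Ex.setNat rfl rfl ?_ ?_
      · simp only [NatExpr.eval, NatOp.eval, hv]; omega
      · simp only [NatExpr.eval, NatOp.eval, hv]
        exact ⟨h, by simp⟩
    exact this hn hf₁ hs
  have loop : ∀ j k τ, k + j = N → Inv k τ → τ.nat i 0 = k →
      Frame (i :: p.writesNat) p.writesCpx σ τ → τ.Small n →
      ∃ t τ', Runs (.while c (p ;; inc)) τ t τ' ∧
        t ≤ j * (n ^ c.deg + 1 + n ^ (p ;; inc).deg * f₁) + (n ^ c.deg + 1) ∧ τ'.Small n ∧
        Inv N τ' ∧ Frame (i :: p.writesNat) p.writesCpx σ τ' := by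
    intro j
    induction j with
    | zero =>
      intro k τ hk hI hik hfr hs
      have he : c.eval τ = 0 := by
        simp only [hc, NatExpr.var, NatExpr.eval, NatOp.eval, hbe k τ hI hfr, hik]
        simp; omega
      have := c.cost_le hn hs hcok
      obtain rfl : k = N := by omega
      exact ⟨_, _, .whileFalse he, by omega, hs, hI, hfr⟩
    | succ j ih =>
      intro k τ hk hI hik hfr hs
      have he : c.eval τ ≠ 0 := by
        simp only [hc, NatExpr.var, NatExpr.eval, NatOp.eval, hbe k τ hI hfr, hik]
        simp; omega
      have hcc := c.cost_le hn hs hcok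
      obtain ⟨t, τ', r1, r2, r3, r4, r5⟩ := body k τ (by omega) hI hik hfr hs
      have hfr' : Frame (i :: p.writesNat) p.writesCpx σ τ' := by
        refine hfr.trans (r1.frame.mono ?_ ?_)
        · intro x hx
          simp [Program.writesNat, hinc] at hx ⊢
          tauto
        · intro x hx
          simpa [Program.writesCpx, hinc] using hx
      obtain ⟨t', τ'', s1, s2, s3, s4, s5⟩ := ih (k + 1) τ' (by omega) r4 r5 hfr' r3
      refine ⟨_, _, .whileTrue he r1 s1, ?_, s3, s4, s5⟩
      rw [Nat.succ_mul]; omega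
  have start : Frame (i :: p.writesNat) p.writesCpx σ (σ.setNat i 0 0) := by
    refine ⟨fun a ha => ?_, fun _ _ => rfl, rfl⟩
    simp only [List.mem_cons, not_or] at ha
    exact State.setNat_nat_ne _ _ _ ha.1
  suffices h : Ex n f (.while c (p ;; inc)) (σ.setNat i 0 0) Q from
    (Ex.seq (Ex.setNat rfl rfl (by simp) h)) hn hf hσ
  intro hn hf hs
  obtain ⟨t, τ, s1, s2, s3, s4, s5⟩ := loop N 0 (σ.setNat i 0 0) (by omega) h0 (by simp) start hs
  refine ⟨t, τ, s1, s2.trans ?_, s3, hQ τ s4 s5⟩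
  simp only [Program.deg]
  -- The `14` in the degree of a loop is spent as follows: `12` for the number of iterations, `1`
  -- for adding the costs of test and body, and `1` for the final failing test, which at most
  -- doubles the total.
  have e1 : 1 ≤ inc.deg := inc.one_le_deg
  have e2 := pow_add_pow_le hn c.one_le_deg (b := p.deg + inc.deg) (by omega)
  have e3 := two_pow_mul_le hn 1 (c.deg + (p.deg + inc.deg))
  have e4 := le_pow_deg hn (d := c.deg + (p.deg + inc.deg)) (by omega)
  set A := n ^ c.deg
  set B := n ^ (p.deg + inc.deg)
  set Cc := n ^ (c.deg + (p.deg + inc.deg) + 1)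
  have e5 : A + 1 + B ≤ Cc := by omega
  have e6 : N * (A + 1 + B * f₁) ≤ n ^ 12 * f * Cc := by
    calc N * (A + 1 + B * f₁) ≤ N * ((A + 1 + B) * f₁) := by gcongr; nlinarith
      _ = (N * f₁) * (A + 1 + B) := by ring
      _ ≤ _ := by gcongr
  have e7 : A + 1 ≤ n ^ 12 * f * Cc := by
    have : 1 ≤ n ^ 12 * f := Nat.one_le_iff_ne_zero.2 (by positivity)
    nlinarith
  calc _ ≤ 2 * (n ^ 12 * f * Cc) := by omega
    _ ≤ n * (n ^ 12 * f * Cc) := by gcongr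
    _ = n ^ (c.deg + (p.deg + inc.deg) + 14) * f := by simp only [Cc]; ring

/-! ## Phase sums over cuts -/

/-- The character `(-1)^a`. -/
def sgn (a : ZMod 2) : ℂ := if a = 0 then 1 else -1

theorem zmod_two_cases (a : ZMod 2) : a = 0 ∨ a = 1 := by
  revert a; decide

@[simp] theorem sgn_zero : sgn 0 = 1 := by simp [sgn]

@[simp] theorem sgn_one : sgn 1 = -1 := by simp [sgn]

theorem sgn_add (a b : ZMod 2) : sgn (a + b) = sgn a * sgn b := by
  rcases zmod_two_cases a with rfl | rfl <;> rcases zmod_two_cases b with rfl | rfl <;>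
    simp [show (1 + 1 : ZMod 2) = 0 from rfl]

theorem vec_add_self {n : ℕ} (x : Fin n → ZMod 2) : x + x = 0 :=
  funext fun v => CharTwo.add_self_eq_zero (x v)

section Graph

variable {n : ℕ} (G : SimpleGraph (Fin n)) (α : Fin n → ℝ)

/-- The sum over the neighbours. -/
def nbrSum (x : Fin n → ZMod 2) : Fin n → ZMod 2 := fun v =>
  open Classical in ∑ u, if G.Adj u v then x u else 0

/-- The dot product. -/
def dot (x y : Fin n → ZMod 2) : ZMod 2 := ∑ v, x v * y v

/-- The vectors supported in `X`. -/
def supp (X : Set (Fin n)) : Finset (Fin n → ZMod 2) :=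
  open Classical in Finset.univ.filter fun x => ∀ v, v ∉ X → x v = 0

/-- The restriction to the complement of `X`. -/
def off (X : Set (Fin n)) (x : Fin n → ZMod 2) : Fin n → ZMod 2 := fun v =>
  open Classical in if v ∈ X then 0 else x v

variable {X Y Z : Set (Fin n)} {x y z : Fin n → ZMod 2}

theorem mem_supp : x ∈ supp X ↔ ∀ v, v ∉ X → x v = 0 := by
  classical simp [supp]

theorem zero_mem_supp : (0 : Fin n → ZMod 2) ∈ supp X := mem_supp.2 fun _ _ => rfl

theorem add_mem_supp (hx : x ∈ supp X) (hy : y ∈ supp X) : x + y ∈ supp X := by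
  rw [mem_supp] at *
  intro v hv; simp [hx v hv, hy v hv]

theorem supp_mono (h : X ⊆ Y) (hx : x ∈ supp X) : x ∈ supp Y := by
  rw [mem_supp] at *
  exact fun v hv => hx v fun h' => hv (h h')

theorem off_mem_supp : off X x ∈ supp Xᶜ := by
  rw [mem_supp]; intro v hv; simp only [Set.mem_compl_iff, not_not] at hv; simp [off, hv]

theorem off_add : off X (x + y) = off X x + off X y := by
  classical
  funext v; by_cases hv : v ∈ X <;> simp [off, hv]

theorem off_zero : off X (0 : Fin n → ZMod 2) = 0 := by
  funext v; simp [off]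

theorem off_off (h : Y ⊆ X) : off X (off Y x) = off X x := by
  funext v
  by_cases hv : v ∈ X
  · simp [off, hv]
  · have : v ∉ Y := fun h' => hv (h h')
    simp [off, hv, this]

theorem dot_comm (x y : Fin n → ZMod 2) : dot x y = dot y x := by
  simp [dot, mul_comm]

theorem dot_add_left (x y z : Fin n → ZMod 2) : dot (x + y) z = dot x z + dot y z := by
  simp [dot, add_mul, Finset.sum_add_distrib]

theorem dot_add_right (x y z : Fin n → ZMod 2) : dot x (y + z) = dot x y + dot x z := by
  simp [dot, mul_add, Finset.sum_add_distrib]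

@[simp] theorem dot_zero_left (x : Fin n → ZMod 2) : dot 0 x = 0 := by simp [dot]

@[simp] theorem dot_zero_right (x : Fin n → ZMod 2) : dot x 0 = 0 := by simp [dot]

theorem dot_off (hy : y ∈ supp Xᶜ) : dot (off X x) y = dot x y := by
  rw [mem_supp] at hy
  refine Finset.sum_congr rfl fun v _ => ?_
  by_cases hv : v ∈ X
  · simp [hy v (by simpa using hv)]
  · simp [off, hv]

theorem dot_single (x : Fin n → ZMod 2) (v : Fin n) : dot x (Pi.single v 1) = x v := by
  simp [dot, Pi.single_apply]

theorem nbrSum_add : nbrSum G (x + y) = nbrSum G x + nbrSum G y := by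
  classical
  funext v
  simp only [nbrSum, Pi.add_apply, ← Finset.sum_add_distrib]
  exact Finset.sum_congr rfl fun u _ => by split_ifs <;> simp

theorem nbrSum_zero : nbrSum G (0 : Fin n → ZMod 2) = 0 := by
  funext v; simp [nbrSum]

theorem dot_nbrSum (x y : Fin n → ZMod 2) :
    open Classical in dot (nbrSum G x) y = ∑ u, ∑ v, if G.Adj u v then x u * y v else 0 := by
  classical
  simp only [dot, nbrSum, Finset.sum_mul, ite_mul, zero_mul]
  exact Finset.sum_comm

theorem dot_nbrSum_comm (x y : Fin n → ZMod 2) :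
    dot (nbrSum G x) y = dot x (nbrSum G y) := by
  classical
  rw [dot_comm x, dot_nbrSum, dot_nbrSum, Finset.sum_comm]
  refine Finset.sum_congr rfl fun v _ => Finset.sum_congr rfl fun u _ => ?_
  simp only [G.adj_comm u v, mul_comm]

/-- The boundary of `x`: its neighbour sum outside of `X`. -/
def bd (X : Set (Fin n)) (x : Fin n → ZMod 2) : Fin n → ZMod 2 := off X (nbrSum G x)

theorem bd_add : bd G X (x + y) = bd G X x + bd G X y := by
  simp [bd, nbrSum_add, off_add]

theorem bd_zero : bd G X (0 : Fin n → ZMod 2) = 0 := by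
  simp [bd, nbrSum_zero, off_zero]

theorem dot_bd (hy : y ∈ supp Xᶜ) : dot (bd G X x) y = dot (nbrSum G x) y := dot_off hy

/-- The adjacency matrix is symmetric. This lets a sign be computed from the boundary on either side
of a cut, together with any representative on the other. -/
theorem dot_bd_comm (hx : x ∈ supp X) (hy : y ∈ supp Xᶜ) :
    dot (bd G X x) y = dot (bd G Xᶜ y) x := by
  rw [dot_bd G hy, dot_bd G (by simpa using hx), dot_nbrSum_comm, dot_comm]

/-- The number of edges, modulo two, in the set given by `x`. -/
def quad (x : Fin n → ZMod 2) : ZMod 2 :=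
  open Classical in ∑ u, ∑ v, if G.Adj u v ∧ u < v then x u * x v else 0

/-- The contribution of an assignment of the spiders to the scalar, without normalization. -/
def amp (x : Fin n → ZMod 2) : ℂ :=
  (∏ v, if x v = 0 then 1 else Complex.exp (α v * Complex.I)) * sgn (quad G x)

/-- Polarization: after expanding, the mixed terms contain every edge `u < v` once with `x u * y v +
x v * y u`, which is the double sum over ordered adjacent pairs folded along the diagonal. -/
theorem quad_add (x y : Fin n → ZMod 2) :
    quad G (x + y) = quad G x + quad G y + dot (nbrSum G x) y := by
  classical
  rw [dot_nbrSum]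
  have h : (∑ u, ∑ v, if G.Adj u v then x u * y v else 0) =
      ∑ u, ∑ v, (if G.Adj u v ∧ u < v then x u * y v + x v * y u else 0) := by
    have h1 : ∀ u v, (if G.Adj u v then x u * y v else 0) =
        (if G.Adj u v ∧ u < v then x u * y v else 0) +
          (if G.Adj v u ∧ v < u then x u * y v else 0) := by
      intro u v
      by_cases huv : G.Adj u v
      · have hne := huv.ne
        rcases lt_or_gt_of_ne hne with h | h
        · simp [huv, huv.symm, h, h.not_gt]
        · simp [huv, huv.symm, h, h.not_gt]
      · have : ¬ G.Adj v u := fun h => huv h.symm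
        simp [huv, this]
    have h2 : ∀ u v, (if G.Adj u v ∧ u < v then x u * y v + x v * y u else 0) =
        (if G.Adj u v ∧ u < v then x u * y v else 0) +
          (if G.Adj u v ∧ u < v then x v * y u else 0) := by
      intro u v; split_ifs <;> simp
    simp only [h1, h2, Finset.sum_add_distrib]
    congr 1
    rw [Finset.sum_comm]
  rw [h]
  simp only [quad, ← Finset.sum_add_distrib]
  refine Finset.sum_congr rfl fun u _ => Finset.sum_congr rfl fun v _ => ?_
  split_ifs
  · simp; ring
  · simp

/-- Disjoint supports make the phases multiplicative, and the polar form of `quad` supplies the sign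
of the edges between the two sets. -/
theorem amp_add (hx : x ∈ supp X) (hy : y ∈ supp Y) (hXY : Disjoint X Y) :
    amp G α (x + y) = amp G α x * amp G α y * sgn (dot (nbrSum G x) y) := by
  rw [mem_supp] at hx hy
  have h : ∀ v, (if (x + y) v = 0 then (1 : ℂ) else Complex.exp (α v * Complex.I)) =
      (if x v = 0 then 1 else Complex.exp (α v * Complex.I)) *
        (if y v = 0 then 1 else Complex.exp (α v * Complex.I)) := by
    intro v
    by_cases hv : v ∈ X
    · simp [hy v (hXY.notMem_of_mem_left hv)]
    · simp [hx v hv]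
  rw [amp, amp, amp, quad_add, sgn_add, sgn_add, Finset.prod_congr rfl fun v _ => h v,
    Finset.prod_mul_distrib]
  ring

theorem amp_zero : amp G α 0 = 1 := by
  simp [amp, quad]

theorem amp_single (v : Fin n) :
    amp G α (Pi.single v 1) = Complex.exp (α v * Complex.I) := by
  classical
  have h : quad G (Pi.single v 1) = 0 := by
    refine Finset.sum_eq_zero fun u _ => Finset.sum_eq_zero fun w _ => ?_
    split_ifs with h
    · by_cases hu : u = v
      · subst hu
        have : w ≠ u := h.1.ne'
        simp [this]
      · simp [hu]
    · rfl
  rw [amp, h, sgn_zero, mul_one, Finset.prod_eq_single v]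
  · simp
  · intro u _ hu; simp [hu]
  · simp

theorem supp_singleton (v : Fin n) : supp {v} = {0, Pi.single v 1} := by
  classical
  ext x
  simp only [mem_supp, Set.mem_singleton_iff, Finset.mem_insert, Finset.mem_singleton]
  constructor
  · intro h
    rcases zmod_two_cases (x v) with h0 | h0
    · left; funext u
      by_cases hu : u = v
      · rw [hu, h0]; rfl
      · exact h u hu
    · right; funext u
      by_cases hu : u = v
      · rw [hu, h0]; simp
      · simp [h u hu, hu]
  · rintro (rfl | rfl) u hu
    · rfl
    · simp [hu]

theorem sum_supp_singleton (v : Fin n) (h : (Fin n → ZMod 2) → ℂ) :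
    ∑ x ∈ supp {v}, h x = h 0 + h (Pi.single v 1) := by
  rw [supp_singleton, Finset.sum_pair]
  intro h0
  have := congrFun h0 v
  simp at this

theorem sum_supp_union (hXY : Disjoint X Y) (h : (Fin n → ZMod 2) → ℂ) :
    ∑ x ∈ supp (X ∪ Y), h x = ∑ a ∈ supp X, ∑ b ∈ supp Y, h (a + b) := by
  classical
  rw [← Finset.sum_product']
  symm
  refine Finset.sum_nbij' (fun p => p.1 + p.2) (fun x => (off Xᶜ x, off X x)) ?_ ?_ ?_ ?_ ?_
  · rintro ⟨a, b⟩ h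
    rw [Finset.mem_product] at h
    exact add_mem_supp (supp_mono Set.subset_union_left h.1)
      (supp_mono Set.subset_union_right h.2)
  · intro x hx
    rw [mem_supp] at hx
    rw [Finset.mem_product]
    refine ⟨by simpa using off_mem_supp (X := Xᶜ) (x := x), ?_⟩
    rw [mem_supp]
    intro v hv
    by_cases hvX : v ∈ X
    · simp [off, hvX]
    · simp only [off, hvX, if_false]
      exact hx v (by simp [hvX, hv])
  · rintro ⟨a, b⟩ h
    rw [Finset.mem_product, mem_supp, mem_supp] at h
    obtain ⟨ha, hb⟩ : (∀ v ∉ X, a v = 0) ∧ ∀ v ∉ Y, b v = 0 := h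
    ext v
    · by_cases hv : v ∈ X
      · simp [off, hv, hb v (hXY.notMem_of_mem_left hv)]
      · simp [off, hv, ha v hv]
    · by_cases hv : v ∈ X
      · simp [off, hv, hb v (hXY.notMem_of_mem_left hv)]
      · simp [off, hv, ha v hv]
  · intro x _
    funext v
    by_cases hv : v ∈ X <;> simp [off, hv]
  · intro p _; rfl

/-- The partial sum over the assignments of `X` with boundary `y`. -/
def part (X : Set (Fin n)) (y : Fin n → ZMod 2) : ℂ :=
  ∑ x ∈ supp X, if bd G X x = y then amp G α x else 0

/-- The partial sum over the assignments of `X` when the spiders outside are assigned `c`. -/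
def dual (X : Set (Fin n)) (c : Fin n → ZMod 2) : ℂ :=
  ∑ x ∈ supp X, amp G α x * sgn (dot (nbrSum G x) c)

/-- The list `y` enumerates, without repetitions, the boundaries of the vectors supported in `S`,
and linearly in the binary digits of the index; `x` lists representatives. -/
structure Enum (S X : Set (Fin n)) (r : ℕ) (y x : ℕ → Fin n → ZMod 2) : Prop where
  mem : ∀ j < 2 ^ r, x j ∈ supp S
  eq : ∀ j < 2 ^ r, y j = bd G X (x j)
  inj : ∀ j < 2 ^ r, ∀ k < 2 ^ r, y j = y k → j = k
  surj : ∀ z ∈ supp S, ∃ j < 2 ^ r, y j = bd G X z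
  lin : ∀ j < 2 ^ r, y j = ∑ i ∈ Finset.range r, if j.testBit i then y (2 ^ i) else 0

namespace Enum

variable {G} {S A B : Set (Fin n)} {r rA rB rX : ℕ} {y x : ℕ → Fin n → ZMod 2}
  {yA xA yB xB : ℕ → Fin n → ZMod 2}

/-- Each assignment has exactly one boundary in the list, so the sum can be grouped by boundaries
whenever the second factor depends on nothing else. -/
theorem sum_eq (h : Enum G X X r y x) (F : (Fin n → ZMod 2) → ℂ) (K : (Fin n → ZMod 2) → ℂ) :
    ∑ z ∈ supp X, F z * K (bd G X z) =
      ∑ j ∈ Finset.range (2 ^ r), (∑ z ∈ supp X, if bd G X z = y j then F z else 0) * K (y j) := by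
  simp only [Finset.sum_mul]
  rw [Finset.sum_comm]
  refine Finset.sum_congr rfl fun z hz => ?_
  obtain ⟨j, hj, hjz⟩ := h.surj z hz
  rw [Finset.sum_eq_single j]
  · simp [hjz]
  · intro k hk hkj
    rw [if_neg, zero_mul]
    intro hk'
    exact hkj (h.inj k (Finset.mem_range.1 hk) j hj (by rw [← hk', hjz]))
  · simp [hj]

/-- Outside `X` the neighbour sum and the boundary pair alike with `c`, so the sign is constant on
each group: `dual` is the Fourier transform of `part`. -/
theorem dual_eq (h : Enum G X X r y x) {c : Fin n → ZMod 2} (hc : c ∈ supp Xᶜ) :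
    dual G α X c = ∑ j ∈ Finset.range (2 ^ r), part G α X (y j) * sgn (dot (y j) c) := by
  rw [dual]
  have := h.sum_eq (amp G α) (fun y => sgn (dot y c))
  simp only [part, ← this]
  exact Finset.sum_congr rfl fun z _ => by rw [dot_bd G hc]

/-- The sign between `a` and `b` depends on `a` only through its boundary and, by symmetry, on `b`
only through its boundary. Hence `b` may be replaced by the listed representative `xB j`, and the
double sum can be grouped on both sides. Each pair of indices contributes to a single `y`. -/
theorem part_union (hA : Enum G A A rA yA xA) (hB : Enum G B B rB yB xB) (hAB : Disjoint A B)
    (y : Fin n → ZMod 2) :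
    part G α (A ∪ B) y = ∑ j ∈ Finset.range (2 ^ rB), ∑ i ∈ Finset.range (2 ^ rA),
      if off (A ∪ B) (yA i + yB j) = y then
        part G α A (yA i) * part G α B (yB j) * sgn (dot (yA i) (xB j)) else 0 := by
  have hBA : B ⊆ Aᶜ := hAB.symm.subset_compl_right
  have hAB' : A ⊆ Bᶜ := hAB.subset_compl_right
  rw [part, sum_supp_union hAB]
  have hbd : ∀ a b, bd G (A ∪ B) (a + b) = off (A ∪ B) (bd G A a + bd G B b) := by
    intro a b
    rw [bd_add, off_add, bd, bd, bd, bd, off_off Set.subset_union_left,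
      off_off Set.subset_union_right]
  have h1 : ∀ a ∈ supp A, (∑ b ∈ supp B, if bd G (A ∪ B) (a + b) = y then amp G α (a + b) else 0) =
      amp G α a * ∑ j ∈ Finset.range (2 ^ rB), part G α B (yB j) *
        (if off (A ∪ B) (bd G A a + yB j) = y then sgn (dot (bd G A a) (xB j)) else 0) := by
    intro a ha
    have := hB.sum_eq (amp G α) (fun z => if off (A ∪ B) (bd G A a + z) = y then
      sgn (dot z a) else 0)
    rw [Finset.mul_sum]
    have h2 : ∀ b ∈ supp B, (if bd G (A ∪ B) (a + b) = y then amp G α (a + b) else 0) =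
        amp G α a * (amp G α b * (if off (A ∪ B) (bd G A a + bd G B b) = y then
          sgn (dot (bd G B b) a) else 0)) := by
      intro b hb
      rw [hbd, amp_add G α ha hb hAB]
      split_ifs
      · rw [← dot_bd G (supp_mono hBA hb), dot_bd_comm G ha (supp_mono hBA hb),
          dot_bd G (by simpa using ha), ← dot_bd G (X := B) (supp_mono hAB' ha), mul_assoc]
      · simp
    rw [Finset.sum_congr rfl h2, ← Finset.mul_sum, this, Finset.mul_sum]
    refine Finset.sum_congr rfl fun j hj => ?_
    rw [part, hB.eq j (Finset.mem_range.1 hj)]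
    -- The sign has been moved to the boundary of `b` for the grouping over `B`; it is now moved
    -- back to the boundary of `a`, with the representative `xB j` in place of `b`, in preparation
    -- for the grouping over `A`.
    have hm := hB.mem j (Finset.mem_range.1 hj)
    rw [dot_bd G (X := B) (supp_mono hAB' ha), dot_bd_comm G ha (supp_mono hBA hm),
      dot_bd G (by simpa using ha)]
  rw [Finset.sum_congr rfl h1]
  have := hA.sum_eq (amp G α) (fun z => ∑ j ∈ Finset.range (2 ^ rB), part G α B (yB j) *
        (if off (A ∪ B) (z + yB j) = y then sgn (dot z (xB j)) else 0))
  rw [this, Finset.sum_comm]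
  refine Finset.sum_congr rfl fun i _ => ?_
  rw [Finset.mul_sum]
  refine Finset.sum_congr rfl fun j _ => ?_
  have hA' : part G α A (yA i) = ∑ z ∈ supp A, if bd G A z = yA i then amp G α z else 0 := rfl
  rw [hA']
  split_ifs <;> ring

/-- For fixed `a`, the sign towards `b` and the sign of `b` towards `c` are characters of the
neighbour sum of `b`, and together they form the one at `a + c`: the inner sum is a `dual` sum of
`B`. As only the boundary of `a` enters, the representative `xA i` may stand for `a`. -/
theorem dual_union (hA : Enum G A A rA yA xA) (hAB : Disjoint A B)
    {c : Fin n → ZMod 2} (hc : c ∈ supp (A ∪ B)ᶜ) :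
    dual G α (A ∪ B) c = ∑ i ∈ Finset.range (2 ^ rA),
      part G α A (yA i) * dual G α B (xA i + c) * sgn (dot (yA i) c) := by
  have hBA : B ⊆ Aᶜ := hAB.symm.subset_compl_right
  have hcA : c ∈ supp Aᶜ := supp_mono (Set.compl_subset_compl.2 Set.subset_union_left) hc
  rw [dual, sum_supp_union hAB]
  have h1 : ∀ a ∈ supp A, (∑ b ∈ supp B, amp G α (a + b) * sgn (dot (nbrSum G (a + b)) c)) =
      amp G α a * ((∑ b ∈ supp B, amp G α b * sgn (dot (bd G A a) b + dot (nbrSum G b) c)) *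
        sgn (dot (bd G A a) c)) := by
    intro a ha
    rw [Finset.sum_mul, Finset.mul_sum]
    refine Finset.sum_congr rfl fun b hb => ?_
    rw [amp_add G α ha hb hAB, nbrSum_add, dot_add_left, sgn_add, sgn_add,
      dot_bd G (supp_mono hBA hb), dot_bd G hcA]
    ring
  rw [Finset.sum_congr rfl h1]
  have := hA.sum_eq (amp G α) (fun z =>
    (∑ b ∈ supp B, amp G α b * sgn (dot z b + dot (nbrSum G b) c)) * sgn (dot z c))
  rw [this]
  refine Finset.sum_congr rfl fun i hi => ?_
  rw [part, dual, mul_assoc]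
  congr 2
  refine Finset.sum_congr rfl fun b hb => ?_
  rw [dot_add_right, hA.eq i (Finset.mem_range.1 hi), dot_bd G (supp_mono hBA hb),
    dot_nbrSum_comm, dot_comm]

end Enum

theorem part_singleton (v : Fin n) (y : Fin n → ZMod 2) :
    part G α {v} y = (if 0 = y then 1 else 0) +
      (if bd G {v} (Pi.single v 1) = y then Complex.exp (α v * Complex.I) else 0) := by
  rw [part, sum_supp_singleton, bd_zero, amp_zero, amp_single]

/-- The two values of spider `v` are split off; to the other spiders its value is just the outside
assignment `0` or `Pi.single v 1`. -/
theorem sum_amp_eq (v : Fin n) :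
    ∑ x, amp G α x = dual G α {v}ᶜ 0 +
      Complex.exp (α v * Complex.I) * dual G α {v}ᶜ (Pi.single v 1) := by
  have h0 : ∑ x, amp G α x = ∑ x ∈ supp ({v} ∪ {v}ᶜ), amp G α x := by
    refine Finset.sum_congr ?_ fun _ _ => rfl
    ext x; simp [mem_supp]
  have hd : Disjoint ({v} : Set (Fin n)) {v}ᶜ := disjoint_compl_right
  rw [h0, sum_supp_union hd, sum_supp_singleton, dual, dual, Finset.mul_sum]
  congr 1
  · refine Finset.sum_congr rfl fun b _ => ?_
    simp
  · refine Finset.sum_congr rfl fun b hb => ?_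
    have hv : (Pi.single v 1 : Fin n → ZMod 2) ∈ supp {v} := by
      rw [supp_singleton]; simp
    rw [amp_add G α hv hb hd, amp_single, dot_nbrSum_comm, dot_comm, mul_assoc]

end Graph

/-! ### Binary digits, characters and the fast Walsh–Hadamard transform -/

section Bits

/-- The dot product of the lowest `r` binary digits. -/
def bitDot (r j t : ℕ) : ZMod 2 :=
  ∑ i ∈ Finset.range r, if j.testBit i ∧ t.testBit i then 1 else 0

theorem bitDot_succ (r j t : ℕ) :
    bitDot (r + 1) j t = bitDot r j t + if j.testBit r ∧ t.testBit r then 1 else 0 := by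
  rw [bitDot, Finset.sum_range_succ, bitDot]

theorem bitDot_congr {r j j' t t' : ℕ} (hj : j % 2 ^ r = j' % 2 ^ r) (ht : t % 2 ^ r = t' % 2 ^ r) :
    bitDot r j t = bitDot r j' t' := by
  refine Finset.sum_congr rfl fun i hi => ?_
  rw [Finset.mem_range] at hi
  have h1 : j.testBit i = j'.testBit i := by
    have := congrArg (fun x => Nat.testBit x i) hj
    simpa [Nat.testBit_mod_two_pow, hi] using this
  have h2 : t.testBit i = t'.testBit i := by
    have := congrArg (fun x => Nat.testBit x i) ht
    simpa [Nat.testBit_mod_two_pow, hi] using this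
  rw [h1, h2]

theorem bitDot_comm (r j t : ℕ) : bitDot r j t = bitDot r t j := by
  simp [bitDot, and_comm]

theorem bitDot_xor (r j k t : ℕ) : bitDot r (j ^^^ k) t = bitDot r j t + bitDot r k t := by
  rw [bitDot, bitDot, bitDot, ← Finset.sum_add_distrib]
  refine Finset.sum_congr rfl fun i _ => ?_
  rw [Nat.testBit_xor]
  cases j.testBit i <;> cases k.testBit i <;> cases t.testBit i <;> simp
  rfl

theorem testBit_add_two_pow_self {j i : ℕ} (h : j < 2 ^ i) : (j + 2 ^ i).testBit i = true := by
  rw [add_comm, Nat.testBit_two_pow_add_eq, Nat.testBit_lt_two_pow h]; rfl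

theorem sum_sgn_bitDot (r u : ℕ) :
    ∑ t ∈ Finset.range (2 ^ r), sgn (bitDot r u t) =
      ∏ i ∈ Finset.range r, (1 + sgn (if u.testBit i then 1 else 0)) := by
  induction r with
  | zero => simp [bitDot]
  | succ r ih =>
    rw [Finset.prod_range_succ, ← ih, pow_succ, mul_two, Finset.sum_range_add, mul_add, mul_one,
      Finset.sum_mul]
    congr 1
    · refine Finset.sum_congr rfl fun t ht => ?_
      rw [Finset.mem_range] at ht
      rw [bitDot_succ, Nat.testBit_lt_two_pow ht]; simp
    · refine Finset.sum_congr rfl fun t ht => ?_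
      rw [Finset.mem_range] at ht
      rw [bitDot_succ, add_comm (2 ^ r) t, testBit_add_two_pow_self ht, sgn_add,
        bitDot_congr (j' := u) (t' := t) rfl (by simp)]
      simp

/-- Orthogonality of characters: the product is the character of `s ^^^ j`, whose sum factors over
the digits, and a digit in which `s` and `j` differ gives the factor `1 - 1`. -/
theorem sum_sgn_mul_sgn {r j s : ℕ} (hj : j < 2 ^ r) (hs : s < 2 ^ r) :
    ∑ t ∈ Finset.range (2 ^ r), sgn (bitDot r s t) * sgn (bitDot r t j) =
      if s = j then 2 ^ r else 0 := by
  have h : ∀ t, sgn (bitDot r s t) * sgn (bitDot r t j) = sgn (bitDot r (s ^^^ j) t) := by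
    intro t; rw [bitDot_xor, sgn_add, bitDot_comm r t j]
  simp only [h, sum_sgn_bitDot]
  split_ifs with hsj
  · subst hsj
    simp [one_add_one_eq_two]
  · have : ∃ i, (s ^^^ j).testBit i = true := by
      by_contra hne
      push Not at hne
      refine hsj (Nat.eq_of_testBit_eq fun i => ?_)
      have := hne i
      rw [Nat.testBit_xor] at this
      cases h1 : s.testBit i <;> cases h2 : j.testBit i <;> simp_all
    obtain ⟨i, hi⟩ := this
    have hir : i < r := by
      by_contra hir
      have := Nat.testBit_lt_two_pow (lt_of_lt_of_le (Nat.xor_lt_two_pow hs hj)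
        (Nat.pow_le_pow_right (by simp) (not_lt.1 hir)))
      simp [this] at hi
    refine Finset.prod_eq_zero (Finset.mem_range.2 hir) ?_
    simp [hi]

/-- The layers of the fast Walsh–Hadamard transform. -/
def walsh (a : ℕ → ℂ) : ℕ → ℕ → ℂ
  | 0, j => a j
  | i + 1, j => if j.testBit i then walsh a i (j - 2 ^ i) - walsh a i j
      else walsh a i j + walsh a i (j + 2 ^ i)

/-- After `i` layers the lowest `i` digits have been transformed: the higher digits of `j` select a
block of length `2 ^ i` and the lower ones are the frequency. A block of length `2 ^ (i + 1)`
consists of two such blocks, and digit `i` of `j` decides the sign of the upper one. -/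
theorem walsh_eq_aux (a : ℕ → ℂ) (i j : ℕ) :
    walsh a i j = ∑ s ∈ Finset.range (2 ^ i), a (j / 2 ^ i * 2 ^ i + s) * sgn (bitDot i s j) := by
  induction i generalizing j with
  | zero => simp [walsh, bitDot]
  | succ i ih =>
    have hpos : 0 < 2 ^ i := by positivity
    have hdm := Nat.div_add_mod j (2 ^ i)
    have hmod := Nat.mod_lt j hpos
    have hdiv : j / 2 ^ (i + 1) = j / 2 ^ i / 2 := by rw [pow_succ, Nat.div_div_eq_div_mul]
    have hbit : j.testBit i = decide (j / 2 ^ i % 2 = 1) := Nat.testBit_eq_decide_div_mod_eq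
    have hd2 := Nat.div_add_mod (j / 2 ^ i) 2
    have split : ∀ F : ℕ → ℂ, ∑ s ∈ Finset.range (2 ^ (i + 1)), F s =
        ∑ s ∈ Finset.range (2 ^ i), F s + ∑ s ∈ Finset.range (2 ^ i), F (2 ^ i + s) := by
      intro F; rw [pow_succ, mul_two, Finset.sum_range_add]
    have low : ∀ s, s < 2 ^ i → sgn (bitDot (i + 1) s j) = sgn (bitDot i s j) := by
      intro s hs
      rw [bitDot_succ, Nat.testBit_lt_two_pow hs]; simp
    have high : ∀ s, s < 2 ^ i → sgn (bitDot (i + 1) (2 ^ i + s) j) =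
        sgn (bitDot i s j) * (if j.testBit i then -1 else 1) := by
      intro s hs
      rw [bitDot_succ, add_comm (2 ^ i) s, testBit_add_two_pow_self hs, sgn_add,
        bitDot_congr (j' := s) (t' := j) (by simp) rfl]
      cases j.testBit i <;> simp
    rw [walsh, split]
    -- Digit `i` of `j` tells whether its block of length `2 ^ i` is the upper or the lower half of
    -- the surrounding block of length `2 ^ (i + 1)`; the partner index lies in the other half.
    by_cases hb : j / 2 ^ i % 2 = 1
    · have hbt : j.testBit i = true := by simp [hbit, hb]
      have hq : j / 2 ^ i = 2 * (j / 2 ^ (i + 1)) + 1 := by omega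
      have hge : 2 ^ i ≤ j := by
        by_contra hlt
        rw [Nat.div_eq_of_lt (not_le.1 hlt)] at hb
        simp at hb
      have hsub : (j - 2 ^ i) / 2 ^ i = 2 * (j / 2 ^ (i + 1)) := by
        have : j = (j - 2 ^ i) + 2 ^ i := by omega
        have h2 : j / 2 ^ i = (j - 2 ^ i) / 2 ^ i + 1 := by
          conv_lhs => rw [this]
          rw [Nat.add_div_right _ hpos]
        omega
      rw [if_pos hbt, ih, ih, sub_eq_add_neg, hsub, ← Finset.sum_neg_distrib]
      congr 1
      · refine Finset.sum_congr rfl fun s hs => ?_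
        rw [Finset.mem_range] at hs
        rw [low s hs, bitDot_congr (j' := s) (t' := j) rfl
          (by conv_rhs => rw [show j = (j - 2 ^ i) + 2 ^ i by omega, Nat.add_mod_right])]
        congr 2; ring
      · refine Finset.sum_congr rfl fun s hs => ?_
        rw [Finset.mem_range] at hs
        rw [high s hs, hbt, hq]
        simp only [if_true]
        rw [show (2 * (j / 2 ^ (i + 1)) + 1) * 2 ^ i + s =
          j / 2 ^ (i + 1) * 2 ^ (i + 1) + (2 ^ i + s) by ring]
        ring
    · have hbt : j.testBit i = false := by simp [hbit, hb]
      have hq : j / 2 ^ i = 2 * (j / 2 ^ (i + 1)) := by omega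
      have hadd : (j + 2 ^ i) / 2 ^ i = 2 * (j / 2 ^ (i + 1)) + 1 := by
        rw [Nat.add_div_right _ hpos]; omega
      rw [if_neg (by simp [hbt]), ih, ih, hadd, hq]
      congr 1
      · refine Finset.sum_congr rfl fun s hs => ?_
        rw [Finset.mem_range] at hs
        rw [low s hs]
        congr 2; ring
      · refine Finset.sum_congr rfl fun s hs => ?_
        rw [Finset.mem_range] at hs
        rw [high s hs, hbt, bitDot_congr (j' := s) (t' := j) rfl (by simp)]
        rw [show (2 * (j / 2 ^ (i + 1)) + 1) * 2 ^ i + s =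
          j / 2 ^ (i + 1) * 2 ^ (i + 1) + (2 ^ i + s) by ring]
        simp

theorem walsh_eq (a : ℕ → ℂ) {r j : ℕ} (hj : j < 2 ^ r) :
    walsh a r j = ∑ s ∈ Finset.range (2 ^ r), a s * sgn (bitDot r s j) := by
  rw [walsh_eq_aux]
  simp [Nat.div_eq_of_lt hj]

/-- By orthogonality the transform is its own inverse up to the factor `2 ^ r`, so the same routine
serves in both directions. -/
theorem walsh_walsh (a b : ℕ → ℂ) {r j : ℕ} (hj : j < 2 ^ r)
    (hb : ∀ t < 2 ^ r, b t = ∑ s ∈ Finset.range (2 ^ r), a s * sgn (bitDot r s t)) :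
    walsh b r j = 2 ^ r * a j := by
  rw [walsh_eq b hj]
  have h : ∀ t ∈ Finset.range (2 ^ r), b t * sgn (bitDot r t j) =
      ∑ s ∈ Finset.range (2 ^ r), a s * (sgn (bitDot r s t) * sgn (bitDot r t j)) := by
    intro t ht
    rw [hb t (Finset.mem_range.1 ht), Finset.sum_mul]
    exact Finset.sum_congr rfl fun _ _ => by ring
  rw [Finset.sum_congr rfl h, Finset.sum_comm]
  have h2 : ∀ s ∈ Finset.range (2 ^ r),
      ∑ t ∈ Finset.range (2 ^ r), a s * (sgn (bitDot r s t) * sgn (bitDot r t j)) =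
        if s = j then 2 ^ r * a j else 0 := by
    intro s hs
    rw [← Finset.mul_sum, sum_sgn_mul_sgn hj (Finset.mem_range.1 hs)]
    split_ifs with h
    · rw [h, mul_comm]
    · simp
  rw [Finset.sum_congr rfl h2]
  simp [hj]

/-- This matches a loop with one counter, from which two indices are read off by division with
remainder, to a double sum. -/
theorem sum_range_mul_eq (R S : ℕ) (F : ℕ → ℕ → ℂ) :
    ∑ k ∈ Finset.range (R * S), F (k % R) (k / R) =
      ∑ j ∈ Finset.range S, ∑ i ∈ Finset.range R, F i j := by
  rcases Nat.eq_zero_or_pos R with rfl | hR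
  · simp
  induction S with
  | zero => simp
  | succ S ih =>
    rw [Nat.mul_succ, Finset.sum_range_add, ih, Finset.sum_range_succ]
    congr 1
    refine Finset.sum_congr rfl fun i hi => ?_
    rw [Finset.mem_range] at hi
    rw [Nat.mul_add_mod, Nat.mod_eq_of_lt hi, Nat.mul_add_div hR, Nat.div_eq_of_lt hi, add_zero]

end Bits

/-! ### Coordinates on boundaries, growing lists of boundaries, and cut-ranks -/

section Graph

variable {n : ℕ} {G : SimpleGraph (Fin n)} {S X A B : Set (Fin n)} {r r' : ℕ}
  {y x y' x' : ℕ → Fin n → ZMod 2}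

/-- The number whose binary digits are the dot products of `c` with the basis of the list `y`. -/
def coord (r : ℕ) (y : ℕ → Fin n → ZMod 2) (c : Fin n → ZMod 2) : ℕ :=
  ∑ i ∈ Finset.range r, (dot (y (2 ^ i)) c).val * 2 ^ i

theorem coord_succ (r : ℕ) (y : ℕ → Fin n → ZMod 2) (c : Fin n → ZMod 2) :
    coord (r + 1) y c = coord r y c + (dot (y (2 ^ r)) c).val * 2 ^ r := by
  rw [coord, Finset.sum_range_succ, coord]

theorem coord_lt (r : ℕ) (y : ℕ → Fin n → ZMod 2) (c : Fin n → ZMod 2) :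
    coord r y c < 2 ^ r := by
  induction r with
  | zero => simp [coord]
  | succ r ih =>
    rw [coord_succ, pow_succ]
    have : (dot (y (2 ^ r)) c).val < 2 := ZMod.val_lt _
    nlinarith

theorem testBit_coord {i : ℕ} (hi : i < r) (y : ℕ → Fin n → ZMod 2) (c : Fin n → ZMod 2) :
    (coord r y c).testBit i = decide (dot (y (2 ^ i)) c = 1) := by
  induction r with
  | zero => omega
  | succ r ih =>
    rw [coord_succ]
    have hlt := coord_lt r y c
    rcases Nat.lt_succ_iff_lt_or_eq.1 hi with h | rfl
    · rw [← ih h]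
      rcases zmod_two_cases (dot (y (2 ^ r)) c) with h0 | h0
      · simp [h0]
      · rw [h0, ZMod.val_one, one_mul, add_comm, Nat.testBit_two_pow_add_gt h]
    · rcases zmod_two_cases (dot (y (2 ^ i)) c) with h0 | h0
      · simp [h0, Nat.testBit_lt_two_pow hlt]
      · rw [h0, ZMod.val_one, one_mul, testBit_add_two_pow_self hlt]; simp

theorem coord_zero (r : ℕ) (y : ℕ → Fin n → ZMod 2) : coord r y 0 = 0 := by
  simp [coord]

namespace Enum

/-- Because the list is linear in the digits of its index, every pairing with `c` is determined by
the pairings with the basis entries `y (2 ^ i)`. This identifies the Fourier transform over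
boundaries with a Walsh transform over indices, at the frequency `coord r y c`. -/
theorem dot_eq (h : Enum G S X r y x) {j : ℕ} (hj : j < 2 ^ r) (c : Fin n → ZMod 2) :
    dot (y j) c = bitDot r j (coord r y c) := by
  have hsum : ∀ (s : Finset ℕ) (F : ℕ → Fin n → ZMod 2),
      dot (∑ i ∈ s, F i) c = ∑ i ∈ s, dot (F i) c := by
    intro s F
    induction s using Finset.induction_on with
    | empty => simp
    | insert a s ha ih => rw [Finset.sum_insert ha, Finset.sum_insert ha, dot_add_left, ih]
  rw [h.lin j hj, hsum, bitDot]
  refine Finset.sum_congr rfl fun i hi => ?_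
  rw [testBit_coord (Finset.mem_range.1 hi)]
  rcases zmod_two_cases (dot (y (2 ^ i)) c) with h0 | h0 <;> cases j.testBit i <;> simp [h0]

theorem base (hy : y 0 = 0) (hx : x 0 = 0) : Enum G ∅ X 0 y x where
  mem j hj := by
    obtain rfl : j = 0 := by simpa using hj
    rw [hx]; exact zero_mem_supp
  eq j hj := by
    obtain rfl : j = 0 := by simpa using hj
    rw [hx, hy, bd_zero]
  inj j hj k hk _ := by
    have : j = 0 := by simpa using hj
    have : k = 0 := by simpa using hk
    omega
  surj z hz := by
    refine ⟨0, by simp, ?_⟩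
    have : z = 0 := by funext v; exact mem_supp.1 hz v (by simp)
    rw [this, bd_zero, hy]
  lin j hj := by
    obtain rfl : j = 0 := by simpa using hj
    simp [hy]

theorem supp_insert {v : Fin n} {z : Fin n → ZMod 2} (hz : z ∈ supp (insert v S)) :
    z ∈ supp S ∨ z + Pi.single v 1 ∈ supp S := by
  rw [mem_supp] at hz
  rw [mem_supp, mem_supp]
  rcases zmod_two_cases (z v) with h0 | h0
  · left
    intro u hu
    by_cases huv : u = v
    · rw [huv, h0]
    · exact hz u (by simp [huv, hu])
  · right
    intro u hu
    by_cases huv : u = v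
    · subst huv
      simp only [Pi.add_apply, h0, Pi.single_eq_same]; rfl
    · simp [huv, hz u (by simp [huv, hu])]

theorem single_mem_supp {v : Fin n} (hv : v ∈ S) : (Pi.single v 1 : Fin n → ZMod 2) ∈ supp S := by
  rw [mem_supp]
  intro u hu
  have : u ≠ v := fun h => hu (h ▸ hv)
  simp [this]

/-- If some `x j` has the boundary of `v`, exchanging `v` for `x j` in a vector does not change its
boundary, so nothing new arises. -/
theorem insert_old (h : Enum G S X r y x) {v : Fin n}
    (hv : ∃ j < 2 ^ r, y j = bd G X (Pi.single v 1)) : Enum G (insert v S) X r y x where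
  mem j hj := supp_mono (Set.subset_insert _ _) (h.mem j hj)
  eq := h.eq
  inj := h.inj
  surj z hz := by
    rcases supp_insert hz with hz | hz
    · exact h.surj z hz
    · obtain ⟨j, hj, hjv⟩ := hv
      have hm := add_mem_supp (h.mem j hj) hz
      obtain ⟨k, hk, hkz⟩ := h.surj _ hm
      refine ⟨k, hk, ?_⟩
      rw [hkz, bd_add, bd_add, ← h.eq j hj, hjv, add_left_comm, vec_add_self, add_zero]
  lin := h.lin

/-- The listed boundaries form a subspace, and a boundary outside it adds a disjoint coset.
Appending the translate of the list puts the new basis vector at index `2 ^ r`, which preserves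
linearity in the digits. -/
theorem insert_new (h : Enum G S X r y x) {v : Fin n}
    (hv : ∀ j < 2 ^ r, y j ≠ bd G X (Pi.single v 1))
    (hy : ∀ j < 2 ^ r, y' j = y j) (hx : ∀ j < 2 ^ r, x' j = x j)
    (hy' : ∀ j < 2 ^ r, y' (j + 2 ^ r) = y j + bd G X (Pi.single v 1))
    (hx' : ∀ j < 2 ^ r, x' (j + 2 ^ r) = x j + Pi.single v 1) :
    Enum G (insert v S) X (r + 1) y' x' := by
  have hcases : ∀ j < 2 ^ (r + 1), j < 2 ^ r ∨ ∃ k < 2 ^ r, j = k + 2 ^ r := by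
    intro j hj
    rw [pow_succ] at hj
    rcases lt_or_ge j (2 ^ r) with h | h
    · exact Or.inl h
    · exact Or.inr ⟨j - 2 ^ r, by omega, by omega⟩
  -- An equality would express the new boundary as `y j + y k`, which is already listed because the
  -- list is closed under addition.
  have hne : ∀ j < 2 ^ r, ∀ k < 2 ^ r, y j ≠ y k + bd G X (Pi.single v 1) := by
    intro j hj k hk hjk
    obtain ⟨l, hl, hly⟩ := h.surj _ (add_mem_supp (h.mem j hj) (h.mem k hk))
    refine hv l hl ?_
    rw [hly, bd_add, ← h.eq j hj, ← h.eq k hk, hjk, add_right_comm, vec_add_self,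
      zero_add]
  refine ⟨?_, ?_, ?_, ?_, ?_⟩
  · intro j hj
    rcases hcases j hj with hj | ⟨k, hk, rfl⟩
    · rw [hx j hj]; exact supp_mono (Set.subset_insert _ _) (h.mem j hj)
    · rw [hx' k hk]
      exact add_mem_supp (supp_mono (Set.subset_insert _ _) (h.mem k hk))
        (single_mem_supp (Set.mem_insert _ _))
  · intro j hj
    rcases hcases j hj with hj | ⟨k, hk, rfl⟩
    · rw [hx j hj, hy j hj, h.eq j hj]
    · rw [hx' k hk, hy' k hk, h.eq k hk, bd_add]
  · intro j hj k hk hjk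
    rcases hcases j hj with hj | ⟨j, hj', rfl⟩ <;> rcases hcases k hk with hk | ⟨k, hk', rfl⟩
    · rw [hy j hj, hy k hk] at hjk; exact h.inj j hj k hk hjk
    · rw [hy j hj, hy' k hk'] at hjk; exact absurd hjk (hne j hj k hk')
    · rw [hy' j hj', hy k hk] at hjk; exact absurd hjk.symm (hne k hk j hj')
    · rw [hy' j hj', hy' k hk'] at hjk
      rw [h.inj j hj' k hk' (add_right_cancel hjk)]
  · intro z hz
    have hpow : 2 ^ (r + 1) = 2 ^ r + 2 ^ r := by ring
    rcases supp_insert hz with hz | hz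
    · obtain ⟨j, hj, hjz⟩ := h.surj z hz
      exact ⟨j, by omega, by rw [hy j hj, hjz]⟩
    · obtain ⟨j, hj, hjz⟩ := h.surj _ hz
      refine ⟨j + 2 ^ r, by omega, ?_⟩
      rw [hy' j hj, hjz, bd_add, add_assoc, vec_add_self, add_zero]
  · have h0 : y 0 = 0 := by rw [h.lin 0 (by positivity)]; simp
    have hb : y' (2 ^ r) = bd G X (Pi.single v 1) := by
      have := hy' 0 (by positivity)
      rwa [zero_add, h0, zero_add] at this
    have hold : ∀ j k, (k % 2 ^ r = j % 2 ^ r) → ∑ i ∈ Finset.range r,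
        (if k.testBit i then y' (2 ^ i) else 0) =
        ∑ i ∈ Finset.range r, (if j.testBit i then y (2 ^ i) else 0) := by
      intro j k hjk
      refine Finset.sum_congr rfl fun i hi => ?_
      rw [Finset.mem_range] at hi
      have h1 : k.testBit i = j.testBit i := by
        have := congrArg (fun x => Nat.testBit x i) hjk
        simpa [Nat.testBit_mod_two_pow, hi] using this
      rw [h1, hy _ (Nat.pow_lt_pow_right (by simp) hi)]
    intro j hj
    rw [Finset.sum_range_succ]
    rcases hcases j hj with hj | ⟨k, hk, rfl⟩
    · rw [hold j j rfl, Nat.testBit_lt_two_pow hj, hy j hj, h.lin j hj]; simp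
    · rw [hold k _ (by simp), testBit_add_two_pow_self hk, hy' k hk, h.lin k hk, hb]; simp

theorem card_image (h : Enum G S X r y x) :
    open Classical in ((supp S).image (bd G X)).card = 2 ^ r := by
  classical
  have : (supp S).image (bd G X) = (Finset.range (2 ^ r)).image y := by
    ext z
    simp only [Finset.mem_image, Finset.mem_range]
    constructor
    · rintro ⟨w, hw, rfl⟩
      exact h.surj w hw
    · rintro ⟨j, hj, rfl⟩
      exact ⟨x j, h.mem j hj, (h.eq j hj).symm⟩
  rw [this, Finset.card_image_of_injOn, Finset.card_range]
  intro j hj k hk hjk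
  exact h.inj j (by simpa using hj) k (by simpa using hk) hjk

end Enum

/-- Up to the zero entries on `X`, the boundaries are the range of the transposed cut matrix, an
`𝔽₂`-space whose dimension is the rank. -/
theorem two_pow_cutRank (G : SimpleGraph (Fin n)) (X : Set (Fin n)) :
    open Classical in 2 ^ cutRank G X = ((supp X).image (bd G X)).card := by
  classical
  set M : Matrix X (Xᶜ : Set (Fin n)) (ZMod 2) := Matrix.of (fun x y =>
    if G.Adj x.1 y.1 then (1 : ZMod 2) else 0) with hM
  have hrank : cutRank G X = Module.finrank (ZMod 2) (LinearMap.range M.transpose.mulVecLin) := by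
    rw [cutRank, ← Matrix.rank_transpose, Matrix.rank]
  -- Extension by zero: it is injective and identifies the range of the matrix map with the set of
  -- boundaries.
  let ι : ((Xᶜ : Set (Fin n)) → ZMod 2) → Fin n → ZMod 2 :=
    fun z v => if h : v ∈ Xᶜ then z ⟨v, h⟩ else 0
  have hι : Function.Injective ι := by
    intro z w hzw
    funext v
    have := congrFun hzw v.1
    simpa only [ι, v.2, dif_pos] using this
  have himg : ι '' (LinearMap.range M.transpose.mulVecLin : Set _) =
      ((supp X).image (bd G X) : Finset (Fin n → ZMod 2)) := by
    have key : ∀ x : Fin n → ZMod 2, x ∈ supp X →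
        ι (M.transpose.mulVec fun u : X => x u) = bd G X x := by
      intro x hx
      rw [mem_supp] at hx
      funext v
      by_cases hv : v ∈ X
      · simp [ι, bd, off, hv]
      · have : v ∈ Xᶜ := hv
        simp only [ι, this, dif_pos, bd, off, hv, if_false, Matrix.mulVec, dotProduct,
          Matrix.transpose_apply, hM, Matrix.of_apply, nbrSum, ite_mul, one_mul, zero_mul]
        rw [← Finset.sum_subtype (Finset.univ.filter (· ∈ X)) (by simp)
          (fun u => if G.Adj u v then x u else 0), Finset.sum_filter]
        refine Finset.sum_congr rfl fun u _ => ?_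
        by_cases hu : u ∈ X
        · simp [hu]
        · simp [hu, hx u hu]
    ext z
    simp only [Set.mem_image, SetLike.mem_coe, LinearMap.mem_range, Matrix.mulVecLin_apply,
      Finset.coe_image, exists_exists_eq_and]
    constructor
    · rintro ⟨w, rfl⟩
      refine ⟨fun v => if h : v ∈ X then w ⟨v, h⟩ else 0, ?_, ?_⟩
      · rw [mem_supp]; intro v hv; simp [hv]
      · rw [← key _ (by rw [mem_supp]; intro v hv; simp [hv])]
        congr 2
        funext u
        simp
    · rintro ⟨x, hx, rfl⟩
      exact ⟨_, key x hx⟩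
  have h1 : Nat.card (LinearMap.range M.transpose.mulVecLin) = 2 ^ cutRank G X := by
    rw [hrank, Module.natCard_eq_pow_finrank (K := ZMod 2), Nat.card_zmod]
  rw [← h1, ← Set.ncard_coe_finset, ← himg, Set.ncard_image_of_injective _ hι]
  rfl

/-- Exchanging the two sides of a cut transposes its symmetric adjacency pattern, which does not
affect the rank. -/
theorem cutRank_compl (G : SimpleGraph (Fin n)) (X : Set (Fin n)) :
    cutRank G Xᶜ = cutRank G X := by
  classical
  -- The column set is generalized to a variable `Y`, since `Xᶜᶜ` cannot be rewritten to `X` inside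
  -- the index type of the matrix.
  have h : ∀ Y : Set (Fin n), Y = X → (Matrix.of (fun (x : (Xᶜ : Set (Fin n))) (y : Y) =>
      if G.Adj x.1 y.1 then (1 : ZMod 2) else 0)).rank = cutRank G X := by
    rintro Y rfl
    rw [cutRank, ← Matrix.rank_transpose]
    congr 1
    ext u v
    simp [G.adj_comm]
  rw [cutRank]
  convert h _ (compl_compl X)

namespace Enum

theorem rank_eq (h : Enum G X X r y x) : r = cutRank G X := by
  have h1 := h.card_image
  rw [← two_pow_cutRank] at h1
  exact (Nat.pow_right_injective le_rfl h1).symm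

theorem rank_le (h : Enum G S X r y x) (hSX : S ⊆ X) : 2 ^ r ≤ 2 ^ cutRank G X := by
  classical
  rw [← h.card_image, two_pow_cutRank]
  exact Finset.card_le_card (Finset.image_subset_image fun z hz => supp_mono hSX hz)

/-- Equal coordinates mean equal pairings with all boundaries of `X`. By symmetry the boundaries of
`x' j` and `x' k` then pair equally with every unit vector in `X`, so they coincide. -/
theorem coord_inj (h : Enum G X X r y x) (h' : Enum G Xᶜ Xᶜ r' y' x') {j k : ℕ}
    (hj : j < 2 ^ r') (hk : k < 2 ^ r') (hjk : coord r y (x' j) = coord r y (x' k)) : j = k := by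
  have h1 : ∀ z ∈ supp X, dot (bd G X z) (x' j) = dot (bd G X z) (x' k) := by
    intro z hz
    obtain ⟨l, hl, hlz⟩ := h.surj z hz
    rw [← hlz, h.dot_eq hl, h.dot_eq hl, hjk]
  refine h'.inj j hj k hk ?_
  rw [h'.eq j hj, h'.eq k hk]
  funext v
  by_cases hv : v ∈ X
  · have hs := single_mem_supp (S := X) hv
    have := h1 _ hs
    rwa [dot_bd_comm G hs (h'.mem j hj), dot_bd_comm G hs (h'.mem k hk), dot_single,
      dot_single] at this
  · simp [bd, off, hv]

/-- Counting: both lists have `2 ^ r` entries, so the injection is onto. A loop over the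
representatives for the complement therefore visits each frequency of the transform once. -/
theorem coord_surj (h : Enum G X X r y x) (h' : Enum G Xᶜ Xᶜ r y' x') {t : ℕ}
    (ht : t < 2 ^ r) : ∃ j < 2 ^ r, coord r y (x' j) = t := by
  have hinj : Set.InjOn (fun j => coord r y (x' j)) (Finset.range (2 ^ r)) := by
    intro j hj k hk hjk
    exact h.coord_inj h' (by simpa using hj) (by simpa using hk) hjk
  have := Finset.surj_on_of_inj_on_of_card_le (s := Finset.range (2 ^ r))
    (t := Finset.range (2 ^ r)) (fun j _ => coord r y (x' j))
    (fun j _ => Finset.mem_range.2 (coord_lt _ _ _))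
    (fun j k hj hk hjk => hinj hj hk hjk) le_rfl t (Finset.mem_range.2 ht)
  obtain ⟨j, hj, hjt⟩ := this
  exact ⟨j, Finset.mem_range.1 hj, hjt.symm⟩

end Enum

/-- The boundary of a union is a function of the boundaries of its parts. This bounds the size of
the new table by the permitted number of steps. -/
theorem cutRank_union_le (G : SimpleGraph (Fin n)) (A B : Set (Fin n)) :
    cutRank G (A ∪ B) ≤ cutRank G A + cutRank G B := by
  classical
  have h : ((supp (A ∪ B)).image (bd G (A ∪ B))).card ≤
      (((supp A).image (bd G A)) ×ˢ ((supp B).image (bd G B))).card := by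
    refine Finset.card_le_card_of_surjOn (fun p => off (A ∪ B) (p.1 + p.2)) ?_
    intro z hz
    simp only [Finset.coe_image, Set.mem_image, Finset.mem_coe] at hz
    obtain ⟨w, hw, rfl⟩ := hz
    refine ⟨(bd G A (off Aᶜ w), bd G B (off A w)), ?_, ?_⟩
    · simp only [Finset.coe_product, Finset.coe_image, Set.mem_prod]
      refine ⟨⟨_, by simpa using off_mem_supp (X := Aᶜ) (x := w), rfl⟩, ⟨_, ?_, rfl⟩⟩
      rw [mem_supp] at hw
      rw [Finset.mem_coe, mem_supp]
      intro v hv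
      by_cases hvA : v ∈ A
      · simp [off, hvA]
      · simp only [off, hvA, if_false]
        exact hw v (by simp [hvA, hv])
    · have hw' : w = off Aᶜ w + off A w := by
        funext v
        by_cases hv : v ∈ A <;> simp [off, hv]
      conv_rhs => rw [hw']
      simp only [bd_add, off_add]
      rw [bd, bd, bd, bd, off_off Set.subset_union_left, off_off Set.subset_union_right]
  rw [Finset.card_product, ← two_pow_cutRank, ← two_pow_cutRank, ← two_pow_cutRank,
    ← pow_add] at h
  exact (Nat.pow_le_pow_iff_right (by simp)).1 h

theorem two_pow_cutRank_singleton_le (G : SimpleGraph (Fin n)) (v : Fin n) :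
    2 ^ cutRank G {v} ≤ 2 := by
  classical
  rw [two_pow_cutRank, supp_singleton]
  exact Finset.card_image_le.trans (Finset.card_le_two)

end Graph

/-! ## The scalar of a diagram as a sum over assignments of the spiders -/

theorem zSpider_eq {ι : Type*} [Fintype ι] (α : ℝ) (b : ι → Bool) :
    zSpider α b = ∑ x : Bool, (if x then Complex.exp (α * Complex.I) else 1) *
      ∏ i, if b i = x then 1 else 0 := by
  classical
  simp only [zSpider, Fintype.sum_bool, Finset.prod_ite_zero, Finset.prod_const_one]
  simp only [Finset.mem_univ, true_implies, if_true, Bool.false_eq_true, if_false, one_mul]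
  rw [add_comm]
  congr!

variable {n : ℕ}

/-- Each spider is a sum over one bit that all of its legs must equal. Distributing the product over
the spiders gives a sum over one bit per spider, and for each choice exactly one assignment of the
legs survives. -/
theorem Diagram.scalar_eq_sum_bool (D : Diagram n) :
    open Classical in
    D.scalar = ∑ x : Fin n → Bool, (∏ v, if x v then Complex.exp (D.phase v * Complex.I) else 1) *
      ∏ d : {d : D.graph.Dart // d.fst < d.snd}, hadamard (x d.1.fst) (x d.1.snd) := by
  classical
  have h1 : ∀ b : D.graph.Dart → Bool,
      (∏ v : Fin n, zSpider (D.phase v) (fun d : {d : D.graph.Dart // d.fst = v} => b d.1)) =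
      ∑ x : Fin n → Bool, (∏ v, if x v then Complex.exp (D.phase v * Complex.I) else 1) *
        if b = fun d => x d.fst then 1 else 0 := by
    intro b
    simp only [zSpider_eq]
    rw [Finset.prod_univ_sum]
    simp only [Fintype.piFinset_univ]
    refine Finset.sum_congr rfl fun x _ => ?_
    rw [Finset.prod_mul_distrib]
    congr 1
    simp only [Finset.prod_ite_zero, Finset.prod_const_one, Finset.mem_univ, true_implies]
    refine if_congr ?_ rfl rfl
    constructor
    · intro h; funext d; exact h d.fst ⟨d, rfl⟩
    · rintro rfl v ⟨d, rfl⟩; rfl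
  rw [Diagram.scalar]
  simp only [h1, Finset.sum_mul]
  rw [Finset.sum_comm]
  refine Finset.sum_congr rfl fun x _ => ?_
  rw [Finset.sum_eq_single fun d : D.graph.Dart => x d.fst]
  · simp
  · intro b _ hb; simp [hb]
  · simp

theorem Diagram.prod_dart (D : Diagram n) (F : Fin n → Fin n → ℂ) :
    open Classical in
    ∏ d : {d : D.graph.Dart // d.fst < d.snd}, F d.1.fst d.1.snd =
      ∏ u, ∏ v, if D.graph.Adj u v ∧ u < v then F u v else 1 := by
  classical
  rw [← Finset.prod_product', ← Finset.prod_filter (fun p : Fin n × Fin n =>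
    D.graph.Adj p.1 p.2 ∧ p.1 < p.2) (fun p => F p.1 p.2)]
  refine Finset.prod_bij (fun d _ => (d.1.fst, d.1.snd)) ?_ ?_ ?_ ?_
  · intro d _; simp only [Finset.univ_product_univ, Finset.mem_filter, Finset.mem_univ, true_and]
    exact ⟨d.1.adj, d.2⟩
  · rintro ⟨⟨⟨a, b⟩, h⟩, h'⟩ _ ⟨⟨⟨c, d⟩, h2⟩, h2'⟩ _ heq
    simp only [Prod.mk.injEq] at heq
    obtain ⟨rfl, rfl⟩ := heq
    rfl
  · rintro ⟨u, v⟩ h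
    simp only [Finset.univ_product_univ, Finset.mem_filter, Finset.mem_univ, true_and] at h
    exact ⟨⟨⟨(u, v), h.1⟩, h.2⟩, Finset.mem_univ _, rfl⟩
  · intro d _; rfl

theorem sgn_sum {ι : Type*} (s : Finset ι) (F : ι → ZMod 2) :
    sgn (∑ i ∈ s, F i) = ∏ i ∈ s, sgn (F i) := by
  classical
  induction s using Finset.induction_on with
  | empty => simp
  | insert a s ha ih => rw [Finset.sum_insert ha, Finset.prod_insert ha, sgn_add, ih]

/-- A Hadamard gate contributes `1/√2` and a sign that is negative precisely when both end points
are `1`; the signs multiply to the character of `quad`. -/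
theorem Diagram.scalar_eq (D : Diagram n) :
    open Classical in
    D.scalar = (∏ u, ∏ v, if D.graph.Adj u v ∧ u < v then (1 / (Real.sqrt 2 : ℂ)) else 1) *
      ∑ x, amp D.graph D.phase x := by
  classical
  rw [D.scalar_eq_sum_bool, Finset.mul_sum]
  let e : Bool ≃ ZMod 2 :=
    { toFun := fun b => if b then 1 else 0
      invFun := fun a => decide (a = 1)
      left_inv := by decide
      right_inv := by decide }
  refine Fintype.sum_equiv (Equiv.arrowCongr (Equiv.refl _) e) _ _ fun x => ?_
  have hx : ∀ v, (Equiv.arrowCongr (Equiv.refl (Fin n)) e) x v = if x v then 1 else 0 :=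
    fun v => rfl
  rw [D.prod_dart fun u v => hadamard (x u) (x v), amp, quad, sgn_sum]
  simp only [sgn_sum]
  rw [mul_left_comm]
  congr 1
  · refine Finset.prod_congr rfl fun v _ => ?_
    rw [hx]; cases x v <;> simp
  · rw [← Finset.prod_mul_distrib]
    refine Finset.prod_congr rfl fun u _ => ?_
    rw [← Finset.prod_mul_distrib]
    refine Finset.prod_congr rfl fun v _ => ?_
    rw [hx, hx, hadamard]
    split_ifs <;> simp_all

/-! ## Sides of the edges of a tree -/

section Tree

variable {V : Type*} {T : SimpleGraph V}

/-- The nodes in the component of `u` after deleting the edge `(u, v)`. -/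
def nodeSide (T : SimpleGraph V) (u v : V) : Set V :=
  {t | (T.deleteEdges {s(u, v)}).Reachable u t}

theorem self_mem_nodeSide (T : SimpleGraph V) (u v : V) : u ∈ nodeSide T u v :=
  SimpleGraph.Reachable.refl _

theorem notMem_nodeSide (hT : T.IsAcyclic) {u v : V} (h : T.Adj u v) : v ∉ nodeSide T u v := by
  have := SimpleGraph.isAcyclic_iff_forall_adj_isBridge.1 hT h
  rw [SimpleGraph.isBridge_iff] at this
  exact this

/-- Going along a walk to `u`, each edge other than the deleted one stays in its component, and the
deleted edge has one end in each of the two sides. -/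
theorem nodeSide_union (hT : T.Connected) (u v t : V) :
    t ∈ nodeSide T u v ∨ t ∈ nodeSide T v u := by
  obtain ⟨p⟩ := hT.preconnected t u
  induction p with
  | nil => exact Or.inl (self_mem_nodeSide _ _ _)
  | @cons a b c hab p ih =>
    by_cases he : s(a, b) = s(c, v)
    · rcases Sym2.eq_iff.1 he with ⟨rfl, rfl⟩ | ⟨rfl, rfl⟩
      · exact Or.inl (self_mem_nodeSide _ _ _)
      · exact Or.inr (self_mem_nodeSide _ _ _)
    · have h1 : (T.deleteEdges {s(c, v)}).Adj b a := by
        rw [SimpleGraph.deleteEdges_adj]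
        refine ⟨hab.symm, ?_⟩
        rw [show s(b, a) = s(a, b) from Sym2.eq_swap]; exact he
      have h2 : (T.deleteEdges {s(v, c)}).Adj b a := by rwa [Sym2.eq_swap]
      rcases ih with ih | ih
      · exact Or.inl (ih.trans h1.reachable)
      · exact Or.inr (ih.trans h2.reachable)

theorem nodeSide_disjoint (hT : T.IsAcyclic) {u v : V} (h : T.Adj u v) :
    Disjoint (nodeSide T u v) (nodeSide T v u) := by
  rw [Set.disjoint_left]
  intro t h1 h2
  refine notMem_nodeSide hT h ?_
  refine h1.trans (SimpleGraph.Reachable.symm ?_)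
  have : t ∈ {t | (T.deleteEdges {s(v, u)}).Reachable v t} := h2
  rwa [Sym2.eq_swap] at this

theorem nodeSide_compl (hT : T.IsTree) {u v : V} (h : T.Adj u v) :
    nodeSide T v u = (nodeSide T u v)ᶜ := by
  ext t
  constructor
  · intro h1 h2
    exact (nodeSide_disjoint hT.isAcyclic h).ne_of_mem h2 h1 rfl
  · intro h1
    exact (nodeSide_union hT.connected u v t).resolve_left h1

/-- Reachability inside a side does not use any edge at the other end point. -/
theorem nodeSide_subset (hT : T.IsAcyclic) {u v w : V} (huv : T.Adj u v) (hwu : T.Adj w u)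
    (hwv : w ≠ v) : nodeSide T w u ⊆ nodeSide T u v := by
  intro t ht
  have h0 : (T.deleteEdges {s(u, v)}).Reachable u w := by
    refine SimpleGraph.Adj.reachable ?_
    rw [SimpleGraph.deleteEdges_adj]
    refine ⟨hwu.symm, ?_⟩
    simp only [Set.mem_singleton_iff]
    intro h
    rcases Sym2.eq_iff.1 h with ⟨_, h⟩ | ⟨h, _⟩
    · exact hwv h
    · exact huv.ne h
  have key : ∀ (a b : V) (p : (T.deleteEdges {s(w, u)}).Walk a b), a ∈ nodeSide T w u →
      (T.deleteEdges {s(u, v)}).Reachable u a → (T.deleteEdges {s(u, v)}).Reachable u b := by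
    intro a b p
    induction p with
    | nil => exact fun _ h => h
    | @cons a b c hab p ih =>
      intro ha hua
      have hb : b ∈ nodeSide T w u := SimpleGraph.Reachable.trans ha hab.reachable
      refine ih hb (hua.trans (SimpleGraph.Adj.reachable ?_))
      rw [SimpleGraph.deleteEdges_adj]
      refine ⟨(SimpleGraph.deleteEdges_adj.1 hab).1, ?_⟩
      simp only [Set.mem_singleton_iff]
      intro h
      rcases Sym2.eq_iff.1 h with ⟨h, _⟩ | ⟨_, h⟩
      · exact notMem_nodeSide hT hwu (h ▸ ha)
      · exact notMem_nodeSide hT hwu (h ▸ hb)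
  obtain ⟨p⟩ : (T.deleteEdges {s(w, u)}).Reachable w t := ht
  exact key w t p (self_mem_nodeSide _ _ _) h0

/-- This recursion for the sides of a tree is what the dynamic programme follows. -/
theorem nodeSide_eq (hT : T.IsTree) {u v : V} (huv : T.Adj u v) :
    nodeSide T u v = {u} ∪ ⋃ w ∈ {w | T.Adj w u ∧ w ≠ v}, nodeSide T w u := by
  ext t
  simp only [Set.mem_union, Set.mem_singleton_iff, Set.mem_iUnion, Set.mem_ofPred_eq, exists_prop]
  constructor
  · intro ht
    by_cases htu : t = u
    · exact Or.inl htu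
    right
    obtain ⟨p⟩ := hT.connected.preconnected u t
    obtain ⟨w, hw, htw⟩ : ∃ w, T.Adj w u ∧ t ∈ nodeSide T w u := by
      -- The neighbour `w` found is the node from which the walk first reaches `u`; up to that point
      -- the walk avoids `u` and hence the deleted edge.
      have key : ∀ (a b : V) (p : T.Walk a b), b = u → a ≠ u →
          ∃ w, T.Adj w u ∧ a ∈ nodeSide T w u := by
        intro a b p
        induction p with
        | nil => exact fun h h' => absurd h h'
        | @cons a b c hab p ih =>
          rintro rfl ha
          by_cases hb : b = c
          · subst hb; exact ⟨a, hab, self_mem_nodeSide _ _ _⟩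
          · obtain ⟨w, hw, hbw⟩ := ih rfl hb
            refine ⟨w, hw, SimpleGraph.Reachable.trans hbw (SimpleGraph.Adj.reachable ?_)⟩
            rw [SimpleGraph.deleteEdges_adj]
            refine ⟨hab.symm, ?_⟩
            simp only [Set.mem_singleton_iff]
            intro h
            rcases Sym2.eq_iff.1 h with ⟨_, h⟩ | ⟨h, _⟩
            · exact ha h
            · exact hb h
      exact key t u p.reverse rfl htu
    refine ⟨w, ⟨hw, ?_⟩, htw⟩
    rintro rfl
    exact (nodeSide_disjoint hT.isAcyclic huv).ne_of_mem ht htw rfl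
  · rintro (rfl | ⟨w, ⟨hw, hwv⟩, ht⟩)
    · exact self_mem_nodeSide _ _ _
    · exact nodeSide_subset hT.isAcyclic huv hw hwv ht

theorem nodeSide_disjoint_of_ne (hT : T.IsTree) {u w w' : V} (hw : T.Adj w u) (hw' : T.Adj w' u)
    (hne : w ≠ w') : Disjoint (nodeSide T w u) (nodeSide T w' u) := by
  have h1 := nodeSide_subset hT.isAcyclic hw.symm hw' hne.symm
  exact ((nodeSide_disjoint hT.isAcyclic hw).mono_right h1)

/-- The strict decrease gives the order in which the tree edges can be processed. -/
theorem ncard_nodeSide_lt [Finite V] (hT : T.IsTree) {u v w : V} (huv : T.Adj u v)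
    (hwu : T.Adj w u) (hwv : w ≠ v) : (nodeSide T w u).ncard < (nodeSide T u v).ncard := by
  refine Set.ncard_lt_ncard ⟨nodeSide_subset hT.isAcyclic huv hwu hwv, fun h => ?_⟩ (Set.toFinite _)
  exact notMem_nodeSide hT.isAcyclic hwu (h (self_mem_nodeSide T u v))

end Tree

namespace BranchDecomposition

variable {n : ℕ} (T : BranchDecomposition n)

theorem side_eq (u v : Fin T.size) : T.side u v = {x | (T.leaf x).1 ∈ nodeSide T.tree u v} := rfl

variable {T}

theorem side_compl {u v : Fin T.size} (h : T.tree.Adj u v) : T.side v u = (T.side u v)ᶜ := by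
  simp only [side_eq, nodeSide_compl T.isTree h]; rfl

/-- The two other neighbours of an inner node. -/
theorem exists_neighbors {u v : Fin T.size} (h : T.tree.Adj u v)
    (hu : (T.tree.neighborSet u).ncard ≠ 1) :
    ∃ w₁ w₂, w₁ ≠ v ∧ w₂ ≠ v ∧ w₁ ≠ w₂ ∧ T.tree.neighborSet u = {v, w₁, w₂} := by
  have h3 := (T.degree_eq u).resolve_left hu
  obtain ⟨a, b, c, hab, hac, hbc, habc⟩ := Set.ncard_eq_three.1 h3
  have hv : v ∈ T.tree.neighborSet u := h
  rw [habc] at hv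
  simp only [Set.mem_insert_iff, Set.mem_singleton_iff] at hv
  rcases hv with rfl | rfl | rfl
  · exact ⟨b, c, hab.symm, hac.symm, hbc, habc⟩
  · exact ⟨a, c, hab, hbc.symm, hac, by rw [habc]; ext; simp; tauto⟩
  · exact ⟨a, b, hac, hbc, hab, by rw [habc]; ext; simp; tauto⟩

/-- A node with three given different neighbours has no further ones. -/
theorem neighborSet_eq {u v w₁ w₂ : Fin T.size} (hv : T.tree.Adj u v) (h₁ : T.tree.Adj u w₁)
    (h₂ : T.tree.Adj u w₂) (h1v : w₁ ≠ v) (h2v : w₂ ≠ v) (h12 : w₁ ≠ w₂) :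
    (T.tree.neighborSet u).ncard = 3 ∧ T.tree.neighborSet u = {v, w₁, w₂} := by
  have hsub : ({v, w₁, w₂} : Set (Fin T.size)) ⊆ T.tree.neighborSet u := by
    rintro x (rfl | rfl | rfl) <;> assumption
  have h3 : ({v, w₁, w₂} : Set (Fin T.size)).ncard = 3 :=
    Set.ncard_eq_three.2 ⟨v, w₁, w₂, h1v.symm, h2v.symm, h12, rfl⟩
  have hle := Set.ncard_le_ncard hsub (Set.toFinite _)
  have hn : (T.tree.neighborSet u).ncard = 3 := by
    rcases T.degree_eq u with h | h <;> omega
  exact ⟨hn, (Set.eq_of_subset_of_ncard_le hsub (by omega) (Set.toFinite _)).symm⟩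

theorem side_union {u v w₁ w₂ : Fin T.size} (hv : T.tree.Adj u v) (h₁ : T.tree.Adj u w₁)
    (h₂ : T.tree.Adj u w₂) (h1v : w₁ ≠ v) (h2v : w₂ ≠ v) (h12 : w₁ ≠ w₂) :
    T.side u v = T.side w₁ u ∪ T.side w₂ u := by
  obtain ⟨h3, hN⟩ := neighborSet_eq hv h₁ h₂ h1v h2v h12
  ext x
  have hx : (T.leaf x).1 ≠ u := by
    intro h
    have := (T.leaf x).2
    rw [h] at this; omega
  have hw : ∀ w, T.tree.Adj w u ∧ w ≠ v ↔ w = w₁ ∨ w = w₂ := by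
    intro w
    have : w ∈ T.tree.neighborSet u ↔ w ∈ ({v, w₁, w₂} : Set (Fin T.size)) := by rw [hN]
    simp only [SimpleGraph.mem_neighborSet, Set.mem_insert_iff, Set.mem_singleton_iff] at this
    rw [T.tree.adj_comm, this]
    constructor
    · tauto
    · rintro (rfl | rfl) <;> tauto
  simp only [side_eq, nodeSide_eq T.isTree hv, Set.mem_ofPred_eq, Set.mem_union,
    Set.mem_singleton_iff, hx, false_or, Set.mem_iUnion, hw, exists_prop]
  constructor
  · rintro ⟨w, rfl | rfl, h⟩ <;> tauto
  · rintro (h | h)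
    · exact ⟨_, Or.inl rfl, h⟩
    · exact ⟨_, Or.inr rfl, h⟩

theorem side_disjoint {u w₁ w₂ : Fin T.size} (h₁ : T.tree.Adj u w₁)
    (h₂ : T.tree.Adj u w₂) (h12 : w₁ ≠ w₂) : Disjoint (T.side w₁ u) (T.side w₂ u) := by
  have := nodeSide_disjoint_of_ne T.isTree h₁.symm h₂.symm h12
  rw [Set.disjoint_left] at this ⊢
  exact fun x hx hx' => this hx hx'

theorem side_leaf (x : Fin n) {v : Fin T.size} (h : T.tree.Adj (T.leaf x).1 v) :
    T.side (T.leaf x).1 v = {x} := by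
  obtain ⟨w, hw⟩ := Set.ncard_eq_one.1 (T.leaf x).2
  have hv : v ∈ T.tree.neighborSet (T.leaf x).1 := h
  rw [hw] at hv
  obtain rfl : v = w := hv
  ext y
  have hno : ∀ w, ¬ (T.tree.Adj w (T.leaf x).1 ∧ w ≠ v) := by
    rintro w ⟨h1, h2⟩
    have : w ∈ T.tree.neighborSet (T.leaf x).1 := h1.symm
    rw [hw] at this
    exact h2 this
  simp only [side_eq, nodeSide_eq T.isTree h, Set.mem_ofPred_eq, Set.mem_union,
    Set.mem_singleton_iff, Set.mem_iUnion, hno, exists_prop, false_and, exists_false, or_false]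
  constructor
  · intro h; exact T.leaf.injective (Subtype.ext h)
  · rintro rfl; rfl

/-- Counting degrees: adding `2` to the degree of each of the `n` leaves gives `3` at every node,
while the degrees sum to `2 * (T.size - 1)`. In particular the size of the tree is linear in `n`. -/
theorem size_eq (T : BranchDecomposition n) : T.size + 2 = 2 * n := by
  classical
  have h1 := T.isTree.card_edgeFinset
  have h2 := T.tree.sum_degrees_eq_twice_card_edges
  have h3 : ∀ t, T.tree.degree t = (T.tree.neighborSet t).ncard := by
    intro t
    rw [← SimpleGraph.card_neighborSet_eq_degree, Set.ncard_eq_toFinset_card', Set.toFinset_card]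
  have h4 : Fintype.card {t : Fin T.size // (T.tree.neighborSet t).ncard = 1} = n := by
    rw [← Fintype.card_congr T.leaf, Fintype.card_fin]
  have h5 : ∑ t, (T.tree.degree t + if (T.tree.neighborSet t).ncard = 1 then 2 else 0) =
      ∑ _t : Fin T.size, 3 := by
    refine Finset.sum_congr rfl fun t _ => ?_
    rw [h3]
    rcases T.degree_eq t with h | h <;> simp [h]
  rw [Finset.sum_add_distrib, h2, ← Finset.sum_filter, Finset.sum_const, ← Fintype.card_subtype,
    h4] at h5
  simp only [smul_eq_mul, Finset.sum_const, Finset.card_univ, Fintype.card_fin] at h5 h1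
  omega

theorem size_pos (T : BranchDecomposition n) : 0 < T.size := by
  obtain ⟨t⟩ := T.isTree.connected.nonempty
  exact t.pos

theorem two_le (T : BranchDecomposition n) : 2 ≤ n := by
  have := T.size_eq
  have := T.size_pos
  omega

variable (G : SimpleGraph (Fin n))

theorem flops_pos (T : BranchDecomposition n) : 1 ≤ T.flops G :=
  Nat.one_le_iff_ne_zero.2 (Finset.sum_pos (fun _ _ => by positivity)
    ⟨⟨0, T.size_pos⟩, Finset.mem_univ _⟩).ne'

/-- Two of the three cut-ranks at an inner node, if their sum is minimal, bound the cost. -/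
theorem two_pow_le_flops {u v w₁ w₂ : Fin T.size} (hv : T.tree.Adj u v) (h₁ : T.tree.Adj u w₁)
    (h₂ : T.tree.Adj u w₂) (h1v : w₁ ≠ v) (h2v : w₂ ≠ v) (h12 : w₁ ≠ w₂) {k : ℕ}
    (ha : k ≤ cutRank G (T.side w₁ u) + cutRank G (T.side w₂ u))
    (hb : k ≤ cutRank G (T.side w₁ u) + cutRank G (T.side u v))
    (hc : k ≤ cutRank G (T.side w₂ u) + cutRank G (T.side u v)) : 2 ^ k ≤ T.flops G := by
  obtain ⟨h3, hN⟩ := neighborSet_eq hv h₁ h₂ h1v h2v h12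
  have hw : k ≤ T.weight G u := by
    rw [weight, if_neg (by omega)]
    have hmem := Nat.sInf_mem (s := {k | ∃ u₁ u₂, T.tree.Adj u u₁ ∧ T.tree.Adj u u₂ ∧ u₁ ≠ u₂ ∧
      k = T.edgeRank G u u₁ + T.edgeRank G u u₂}) ⟨_, w₁, w₂, h₁, h₂, h12, rfl⟩
    obtain ⟨a, b, hua, hub, hab, hk⟩ := hmem
    rw [hk]
    have hr1 : T.edgeRank G u w₁ = cutRank G (T.side w₁ u) := by
      rw [edgeRank, side_compl h₁.symm, cutRank_compl]
    have hr2 : T.edgeRank G u w₂ = cutRank G (T.side w₂ u) := by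
      rw [edgeRank, side_compl h₂.symm, cutRank_compl]
    have hr3 : T.edgeRank G u v = cutRank G (T.side u v) := rfl
    have ha' : a ∈ T.tree.neighborSet u := hua
    have hb' : b ∈ T.tree.neighborSet u := hub
    rw [hN] at ha' hb'
    simp only [Set.mem_insert_iff, Set.mem_singleton_iff] at ha' hb'
    rcases ha' with rfl | rfl | rfl <;> rcases hb' with rfl | rfl | rfl <;>
      first
      | exact absurd rfl hab
      | omega
  calc 2 ^ k ≤ 2 ^ T.weight G u := Nat.pow_le_pow_right (by simp) hw
    _ ≤ _ := Finset.single_le_sum (f := fun t => 2 ^ T.weight G t) (fun _ _ => Nat.zero_le _)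
      (Finset.mem_univ u)

end BranchDecomposition

/-! ## Sets of spiders as binary numbers -/

section Mask

variable {n : ℕ}

/-- The binary number with the digits given by the membership in `X`. -/
def maskOf (X : Set (Fin n)) : ℕ := open Classical in Nat.ofBits fun v => decide (v ∈ X)

/-- The vector of the lowest `n` binary digits. -/
def vec (n p : ℕ) : Fin n → ZMod 2 := fun v => if p.testBit v then 1 else 0

variable {X Y : Set (Fin n)}

theorem maskOf_lt (X : Set (Fin n)) : maskOf X < 2 ^ n := Nat.ofBits_lt_two_pow _

theorem testBit_maskOf (X : Set (Fin n)) (v : Fin n) :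
    (maskOf X).testBit v = true ↔ v ∈ X := by
  classical
  rw [maskOf, Nat.testBit_ofBits_lt _ _ v.2]; simp

theorem mask_ext {p q : ℕ} (hp : p < 2 ^ n) (hq : q < 2 ^ n)
    (h : ∀ v : Fin n, p.testBit v = q.testBit v) : p = q := by
  refine Nat.eq_of_testBit_eq fun i => ?_
  by_cases hi : i < n
  · exact h ⟨i, hi⟩
  · rw [Nat.testBit_lt_two_pow (hp.trans_le (Nat.pow_le_pow_right (by simp) (not_lt.1 hi))),
      Nat.testBit_lt_two_pow (hq.trans_le (Nat.pow_le_pow_right (by simp) (not_lt.1 hi)))]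

theorem vec_inj {p q : ℕ} (hp : p < 2 ^ n) (hq : q < 2 ^ n) (h : vec n p = vec n q) : p = q := by
  refine mask_ext hp hq fun v => ?_
  have := congrFun h v
  simp only [vec] at this
  cases h1 : p.testBit v <;> cases h2 : q.testBit v <;> simp_all

theorem eq_maskOf {p : ℕ} (hp : p < 2 ^ n) (h : ∀ v : Fin n, p.testBit v = true ↔ v ∈ X) :
    p = maskOf X := by
  refine mask_ext hp (maskOf_lt X) fun v => ?_
  rw [Bool.eq_iff_iff, h, testBit_maskOf]

theorem maskOf_union (h : Disjoint X Y) : maskOf (X ∪ Y) = maskOf X ^^^ maskOf Y := by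
  symm
  refine eq_maskOf (Nat.xor_lt_two_pow (maskOf_lt X) (maskOf_lt Y)) fun v => ?_
  have h1 := testBit_maskOf X v
  have h2 := testBit_maskOf Y v
  have h3 : v ∈ X → v ∉ Y := fun h' => h.notMem_of_mem_left h'
  rw [Nat.testBit_xor, Set.mem_union]
  cases hx : (maskOf X).testBit v <;> cases hy : (maskOf Y).testBit v <;> simp_all

theorem maskOf_singleton (v : Fin n) : maskOf {v} = 2 ^ v.1 := by
  symm
  refine eq_maskOf (Nat.pow_lt_pow_right (by simp) v.2) fun u => ?_
  rw [Nat.testBit_two_pow]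
  simp [Fin.ext_iff, eq_comm]

/-- Subtraction from the all-ones number produces no borrows, so it complements every digit; this is
how programs form complements. -/
theorem maskOf_compl (X : Set (Fin n)) : 2 ^ n - 1 - maskOf X = maskOf Xᶜ := by
  have hX := maskOf_lt X
  have hpos : 0 < 2 ^ n := by positivity
  refine eq_maskOf (by omega) fun v => ?_
  rw [show 2 ^ n - 1 - maskOf X = 2 ^ n - (maskOf X + 1) by omega,
    Nat.testBit_two_pow_sub_succ hX]
  have := testBit_maskOf X v
  simp [← this]

theorem vec_zero : vec n 0 = 0 := by funext v; simp [vec]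

theorem vec_xor (p q : ℕ) : vec n (p ^^^ q) = vec n p + vec n q := by
  funext v
  simp only [vec, Nat.testBit_xor, Pi.add_apply]
  cases p.testBit v <;> cases q.testBit v <;> simp
  rfl

theorem vec_two_pow (v : Fin n) : vec n (2 ^ v.1) = Pi.single v 1 := by
  funext u
  simp only [vec, Nat.testBit_two_pow, Pi.single_apply]
  simp [Fin.ext_iff, eq_comm]

theorem vec_and_maskOf_compl (p : ℕ) (X : Set (Fin n)) :
    vec n (p &&& maskOf Xᶜ) = off X (vec n p) := by
  funext v
  have := testBit_maskOf Xᶜ v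
  by_cases hv : v ∈ X <;> simp_all [vec, off]

theorem vec_maskOf_neighborSet (G : SimpleGraph (Fin n)) (v : Fin n) :
    vec n (maskOf (G.neighborSet v)) = nbrSum G (Pi.single v 1) := by
  classical
  funext u
  simp only [vec, testBit_maskOf, SimpleGraph.mem_neighborSet, nbrSum, Pi.single_apply]
  rw [Finset.sum_eq_single v]
  · simp
  · intro w _ hw; simp [hw]
  · simp

theorem dot_vec (p q : ℕ) :
    dot (vec n p) (vec n q) = ∑ i ∈ Finset.range n, if (p &&& q).testBit i then 1 else 0 := by
  rw [dot, ← Fin.sum_univ_eq_sum_range (fun i => if (p &&& q).testBit i then (1 : ZMod 2) else 0)]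
  refine Finset.sum_congr rfl fun v _ => ?_
  simp only [vec, Nat.testBit_and]
  cases p.testBit v <;> cases q.testBit v <;> simp

theorem small_of_lt {x : ℕ} (h : x < 2 ^ n) : x < 2 ^ (10 * n) :=
  h.trans_le (Nat.pow_le_pow_right (by simp) (by omega))

end Mask

/-! ## The memory layout -/

/-- The slots are interleaved: entry `j` of slot `e < M` has address `j * M + e`. Thus every slot
may grow without limit and different slots never overlap. -/
theorem addr_inj {M e e' j j' : ℕ} (he : e < M) (he' : e' < M) :
    j * M + e = j' * M + e' ↔ j = j' ∧ e = e' := by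
  constructor
  · intro h
    have h1 := congrArg (· % M) h
    have h2 := congrArg (· / M) h
    have hM : 0 < M := by omega
    simp only [Nat.mul_add_mod', Nat.mod_eq_of_lt he, Nat.mod_eq_of_lt he'] at h1
    simp only [mul_comm j, mul_comm j', Nat.mul_add_div hM, Nat.div_eq_of_lt he,
      Nat.div_eq_of_lt he'] at h2
    exact ⟨by omega, h1⟩
  · rintro ⟨rfl, rfl⟩; rfl

section Layout

variable {n : ℕ} (D : Diagram n) (T : BranchDecomposition n)

/-- The number of slots: two for every pair of tree nodes. -/
def BranchDecomposition.slots : ℕ := T.size * T.size * 2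

/-- The arrays `0` to `5` of natural numbers hold the input, the powers of two and the rows of the
adjacency matrix as binary numbers. -/
structure Env (σ : State) : Prop where
  n_eq : σ.nat 0 0 = n
  m_eq : σ.nat 0 1 = T.size
  adjG : σ.nat 1 = adjacencyTable D.graph
  adjT : σ.nat 2 = adjacencyTable T.tree
  leaf : ∀ x : Fin n, σ.nat 3 x = (T.leaf x).1
  pow : ∀ i ≤ n, σ.nat 4 i = 2 ^ i
  row : ∀ v : Fin n, σ.nat 5 v = maskOf (D.graph.neighborSet v)
  angle : ∀ v : Fin n, σ.angle v = D.phase v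

variable {D T} {σ τ υ : State}

theorem Env.congr (h : Env D T σ) (hn : ∀ a < 6, τ.nat a = σ.nat a) (ha : τ.angle = σ.angle) :
    Env D T τ where
  n_eq := by rw [hn 0 (by norm_num), h.n_eq]
  m_eq := by rw [hn 0 (by norm_num), h.m_eq]
  adjG := by rw [hn 1 (by norm_num), h.adjG]
  adjT := by rw [hn 2 (by norm_num), h.adjT]
  leaf x := by rw [hn 3 (by norm_num), h.leaf]
  pow i hi := by rw [hn 4 (by norm_num), h.pow i hi]
  row v := by rw [hn 5 (by norm_num), h.row]
  angle v := by rw [ha, h.angle]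

theorem Env.frame {ln lc : List ℕ} (h : Env D T σ) (hf : Frame ln lc σ τ)
    (hl : ∀ a < 6, a ∉ ln) : Env D T τ :=
  h.congr (fun a ha => hf.nat a (hl a ha)) hf.angle

theorem Env.setNat (h : Env D T σ) {a : ℕ} (ha : 6 ≤ a) (i x : ℕ) : Env D T (σ.setNat a i x) :=
  h.congr (fun b hb => State.setNat_nat_ne _ _ _ (by omega)) rfl

theorem Env.setCpx (h : Env D T σ) (a i : ℕ) (x : ℂ) : Env D T (σ.setCpx a i x) :=
  h.congr (fun _ _ => rfl) rfl

/-- The slot `e` holds the list of the boundaries, outside of `X`, of the vectors supported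
in `S`. -/
structure Slot (G : SimpleGraph (Fin n)) (M : ℕ) (σ : State) (e : ℕ) (S X : Set (Fin n)) :
    Prop where
  enum : Enum G S X (σ.nat 7 e) (fun j => vec n (σ.nat 9 (j * M + e)))
    (fun j => vec n (σ.nat 10 (j * M + e)))
  y_lt : ∀ j < 2 ^ σ.nat 7 e, σ.nat 9 (j * M + e) < 2 ^ n
  x_lt : ∀ j < 2 ^ σ.nat 7 e, σ.nat 10 (j * M + e) < 2 ^ n
  idx : ∀ j < 2 ^ σ.nat 7 e, σ.nat 11 (σ.nat 9 (j * M + e) * M + e) = j + 1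
  idx_ne : ∀ y, σ.nat 11 (y * M + e) ≠ 0 → ∃ j < 2 ^ σ.nat 7 e, σ.nat 9 (j * M + e) = y

/-- The lists of the slot `e` are the same in both states. -/
structure SameList (M e : ℕ) (σ τ : State) : Prop where
  rk : τ.nat 7 e = σ.nat 7 e
  y : ∀ j, τ.nat 9 (j * M + e) = σ.nat 9 (j * M + e)
  x : ∀ j, τ.nat 10 (j * M + e) = σ.nat 10 (j * M + e)
  idx : ∀ j, τ.nat 11 (j * M + e) = σ.nat 11 (j * M + e)

theorem SameList.trans {M e : ℕ} (h₁ : SameList M e σ τ) (h₂ : SameList M e τ υ) :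
    SameList M e σ υ :=
  ⟨h₂.rk.trans h₁.rk, fun j => (h₂.y j).trans (h₁.y j), fun j => (h₂.x j).trans (h₁.x j),
    fun j => (h₂.idx j).trans (h₁.idx j)⟩

theorem SameList.of_frame {M e : ℕ} {ln lc : List ℕ} (h : Frame ln lc σ τ)
    (hl : ∀ a ∈ [7, 9, 10, 11], a ∉ ln) : SameList M e σ τ :=
  ⟨by rw [h.nat 7 (hl 7 (by simp))], fun _ => by rw [h.nat 9 (hl 9 (by simp))],
    fun _ => by rw [h.nat 10 (hl 10 (by simp))], fun _ => by rw [h.nat 11 (hl 11 (by simp))]⟩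

theorem SameList.of_eq {M e : ℕ} (h : ∀ a ∈ [7, 9, 10, 11], τ.nat a = σ.nat a) :
    SameList M e σ τ :=
  ⟨by rw [h 7 (by simp)], fun _ => by rw [h 9 (by simp)],
    fun _ => by rw [h 10 (by simp)], fun _ => by rw [h 11 (by simp)]⟩

theorem SameList.setNat (M e : ℕ) (σ : State) {a : ℕ} (i x : ℕ) (ha : a ∉ [7, 9, 10, 11]) :
    SameList M e σ (σ.setNat a i x) :=
  SameList.of_eq fun _ hb => State.setNat_nat_ne _ _ _ fun h => ha (h ▸ hb)

theorem Slot.congr {G : SimpleGraph (Fin n)} {M e : ℕ} {S X : Set (Fin n)} (h : Slot G M σ e S X)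
    (hs : SameList M e σ τ) : Slot G M τ e S X where
  enum := by simpa only [hs.rk, hs.y, hs.x] using h.enum
  y_lt := by simpa only [hs.rk, hs.y] using h.y_lt
  x_lt := by simpa only [hs.rk, hs.x] using h.x_lt
  idx := by simpa only [hs.rk, hs.y, hs.idx] using h.idx
  idx_ne := by simpa only [hs.rk, hs.y, hs.idx] using h.idx_ne

/-- The `2 ^ r` listed boundaries are different numbers of `n` digits. -/
theorem Slot.rk_le {G : SimpleGraph (Fin n)} {M e : ℕ} {S X : Set (Fin n)} (h : Slot G M σ e S X) :
    σ.nat 7 e ≤ n := by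
  have h1 : (Finset.range (2 ^ σ.nat 7 e)).card ≤ (Finset.range (2 ^ n)).card := by
    refine Finset.card_le_card_of_injOn (fun j => σ.nat 9 (j * M + e)) ?_ ?_
    · intro j hj
      simpa using h.y_lt j (by simpa using hj)
    · intro j hj k hk hjk
      refine h.enum.inj j (by simpa using hj) k (by simpa using hk) ?_
      simp only at hjk ⊢
      rw [hjk]
  simp only [Finset.card_range] at h1
  exact (Nat.pow_le_pow_iff_right (by simp)).1 h1

end Layout

/-! ## Subroutines on sets of spiders -/

open NatExpr (var)

/-- The number of spiders. -/
abbrev nn : NatExpr := .load 0 (.const 0)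

/-- The number of tree nodes. -/
abbrev mm : NatExpr := .load 0 (.const 1)

/-- The address of entry `j` of slot `e`. -/
abbrev adr (e j : NatExpr) : NatExpr := j * (mm * mm * 2) + e

/-- Variable 21 becomes the parity of the number of digits `1` of variable 20. -/
def parity : Program :=
  .setNat 21 0 0 ;; .forLt 22 nn (.setNat 21 0 ((var 21 + var 20 / .load 4 (var 22)) % 2))

/-- Variable 24 becomes the coordinates of the vector in variable 23 in the slot in variable `s`. -/
def coords (s : ℕ) : Program :=
  .setNat 24 0 0 ;;
  .forLt 25 (.load 7 (var s))
    (.setNat 20 0 (.load 9 (adr (var s) (.load 4 (var 25))) &&& var 23) ;;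
      parity ;;
      .setNat 24 0 (var 24 + var 21 * .load 4 (var 25)))

/-- Appends to the list in the slot in variable 26 its translate by the row of spider 28. -/
def double : Program :=
  .forLt 30 (.load 4 (.load 7 (var 26)))
    (.setNat 9 (adr (var 26) (var 30 + .load 4 (.load 7 (var 26))))
        (.load 9 (adr (var 26) (var 30)) ^^^ var 29) ;;
      .setNat 10 (adr (var 26) (var 30 + .load 4 (.load 7 (var 26))))
        (.load 10 (adr (var 26) (var 30)) ^^^ .load 4 (var 28)) ;;
      .setNat 11 (adr (var 26) (.load 9 (adr (var 26) (var 30)) ^^^ var 29))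
        (var 30 + .load 4 (.load 7 (var 26)) + 1)) ;;
  .setNat 7 (var 26) (.load 7 (var 26) + 1)

/-- Lists the boundaries for the set in variable 27 in the slot in variable 26. -/
def build : Program :=
  .setNat 7 (var 26) 0 ;; .setNat 9 (adr (var 26) 0) 0 ;; .setNat 10 (adr (var 26) 0) 0 ;;
  .setNat 11 (adr (var 26) 0) 1 ;;
  .forLt 28 nn
    (.ite (var 27 / .load 4 (var 28) % 2)
      (.setNat 29 0 (.load 5 (var 28) &&& (.load 4 nn - 1 - var 27)) ;;
        .ite (.load 11 (adr (var 26) (var 29))) .skip double)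
      .skip)

section Specs

variable {n f : ℕ} {D : Diagram n} {T : BranchDecomposition n} {σ : State}

theorem loop_bound {N k f : ℕ} (hn : 2 ≤ n) (hk : k ≤ 12) (h : N ≤ n ^ k) : N * f ≤ n ^ 12 * f :=
  Nat.mul_le_mul_right _ (h.trans (Nat.pow_le_pow_right (by omega) hk))

theorem lt_small {N k : ℕ} (hk : k ≤ 10) (h : N < 2 ^ (k * n)) : N < 2 ^ (10 * n) :=
  h.trans_le (Nat.pow_le_pow_right (by simp) (Nat.mul_le_mul_right _ hk))

theorem two_lt_small (hn : 2 ≤ n) {x : ℕ} (hx : x < 2) : x < 2 ^ (10 * n) :=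
  hx.trans_le (Nat.le_self_pow (by omega) 2)

theorem parity_spec (hσ : Env D T σ) {a c : ℕ} (hp : σ.nat 20 0 = a &&& c) :
    Ex n f parity σ fun τ => τ.nat 21 0 = (dot (vec n a) (vec n c)).val := by
  refine Ex.assume fun hn hf _ => ?_
  refine Ex.seq (Ex.set 0 0 rfl rfl (by simp) ?_)
  refine Ex.forLt (f₁ := f) (N := n) (fun k τ => τ.nat 21 0 =
    (∑ i ∈ Finset.range k, if (a &&& c).testBit i then (1 : ZMod 2) else 0).val) hf
    (loop_bound hn (k := 1) (by norm_num) (by simp)) (small_of_lt Nat.lt_two_pow_self)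
    ?_ (by simp) ?_ ?_
  · intro k τ _ hfr
    simp [hfr.nat 0 (by decide), hσ.n_eq]
  · intro k τ hk hI hik hfr
    have h4 : τ.nat 4 k = 2 ^ k := by
      rw [hfr.nat 4 (by decide)]; simpa [State.setNat_nat_ne] using hσ.pow k hk.le
    have h20 : τ.nat 20 0 = a &&& c := by rw [hfr.nat 20 (by decide)]; simpa using hp
    refine Ex.set 0 ((τ.nat 21 0 + (a &&& c) / 2 ^ k) % 2) rfl (by simp [h20, hik, h4])
      (two_lt_small hn (Nat.mod_lt _ (by norm_num))) ?_
    simp only [State.setNat_nat, hI, Finset.sum_range_succ, ZMod.val_add,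
      Nat.testBit_eq_decide_div_mod_eq]
    have hm := Nat.mod_two_eq_zero_or_one ((a &&& c) / 2 ^ k)
    rw [Nat.add_mod]
    rcases hm with h | h <;> simp [h, ZMod.val_one]
  · intro τ hI _
    rw [hI, dot_vec]

/-- Digit `k` of the coordinate is the parity of the common digits of `c` and the basis vector at
index `2 ^ k`. The restriction on `s` only ensures that the program does not overwrite the variable
naming the slot. -/
theorem coords_spec (hσ : Env D T σ) {s e r c : ℕ} (hs : s = 26 ∨ s = 36) (he : σ.nat s 0 = e)
    (hr : σ.nat 7 e = r) (hrn : r ≤ n) (hc : σ.nat 23 0 = c) (hcn : c < 2 ^ n) :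
    Ex n f (coords s) σ fun τ => τ.nat 24 0 =
      coord r (fun j => vec n (σ.nat 9 (j * T.slots + e))) (vec n c) := by
  refine Ex.assume fun hn hf _ => ?_
  have hs0 : s ∉ [25, 20, 21, 22, 21, 22, 24] := by rcases hs with rfl | rfl <;> decide
  have hs24 : s ≠ 24 := by rcases hs with rfl | rfl <;> decide
  refine Ex.seq (Ex.set 0 0 rfl rfl (by simp) ?_)
  refine Ex.forLt (f₁ := f) (N := r) (fun k τ => τ.nat 24 0 =
      coord k (fun j => vec n (σ.nat 9 (j * T.slots + e))) (vec n c)) hf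
    (loop_bound hn (k := 1) (by norm_num) (by simpa using hrn))
    (small_of_lt (hrn.trans_lt Nat.lt_two_pow_self))
    ?_ (by simp [coord]) ?_ ?_ (hi := (by decide : 25 ∉ [20, 21, 22, 21, 22, 24]))
  · intro k τ _ hfr
    replace hfr : Frame [25, 20, 21, 22, 21, 22, 24] [] _ τ := hfr
    simp [hfr.nat 7 (by decide), hfr.nat s hs0, hr, hs24, he]
  · intro k τ hk hI hik hfr
    replace hfr : Frame [25, 20, 21, 22, 21, 22, 24] [] _ τ := hfr
    have hτ : Env D T τ := (hσ.setNat (by norm_num) _ _).frame hfr (by decide)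
    have h23 : τ.nat 23 0 = c := by rw [hfr.nat 23 (by decide)]; simpa using hc
    have h9 : τ.nat 9 = σ.nat 9 := by
      rw [hfr.nat 9 (by decide)]; exact State.setNat_nat_ne _ _ _ (by decide)
    have hse : τ.nat s 0 = e := by rw [hfr.nat s hs0, State.setNat_nat_ne _ _ _ hs24, he]
    refine Ex.seq (Ex.set 0 (σ.nat 9 (2 ^ k * T.slots + e) &&& c) rfl ?_ ?_ ?_)
    · simp [hse, h23, h9, hik, hτ.pow k (by omega), hτ.m_eq, BranchDecomposition.slots]
    · exact small_of_lt (Nat.and_le_right.trans_lt hcn)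
    have hτ1 := hτ.setNat (a := 20) (by norm_num) 0 (σ.nat 9 (2 ^ k * T.slots + e) &&& c)
    refine Ex.seq ((parity_spec hτ1 (by simp; rfl)).mono fun υ hfr' hυ => ?_)
    have hυe : Env D T υ := hτ1.frame hfr' (by decide)
    have h24 : υ.nat 24 0 = τ.nat 24 0 := by rw [hfr'.nat 24 (by decide)]; simp
    have h25 : υ.nat 25 0 = k := by rw [hfr'.nat 25 (by decide)]; simpa using hik
    have hnew : υ.nat 24 0 + υ.nat 21 0 * 2 ^ k =
        coord (k + 1) (fun j => vec n (σ.nat 9 (j * T.slots + e))) (vec n c) := by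
      rw [h24, hI, hυ, coord_succ]
    refine Ex.set 0 _ rfl (by simp [h25, hυe.pow k (by omega)]; exact hnew) ?_ (by simp)
    exact small_of_lt ((coord_lt _ _ _).trans_le (Nat.pow_le_pow_right (by simp) (by omega)))
  · intro τ hI _
    exact hI

theorem four_mul_le_small (hn : 2 ≤ n) : 4 * 2 ^ n ≤ 2 ^ (10 * n) := by
  rw [show 4 * 2 ^ n = 2 ^ (n + 2) by ring]
  exact Nat.pow_le_pow_right (by simp) (by omega)

/-- This carries out `Enum.insert_new` in memory. Array 11 inverts the list, with indices shifted by
one so that `0` means absent; `hnew` thus says that the boundary of `v` is not yet listed. The `2 ^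
r` cheap iterations are paid by `n * f`. -/
theorem double_spec (hσ : Env D T σ) {M : ℕ} (hM : T.slots = M) {e y : ℕ} {v : Fin n} {S X : Set (Fin n)} (hSX : S ⊆ X)
    (hrank : 2 ^ cutRank D.graph X ≤ n * f) (heM : e < M) (he : σ.nat 26 0 = e)
    (hv : σ.nat 28 0 = v) (hy : σ.nat 29 0 = y) (hyn : y < 2 ^ n)
    (hyv : vec n y = bd D.graph X (Pi.single v 1)) (hslot : Slot D.graph M σ e S X)
    (hnew : σ.nat 11 (y * M + e) = 0) :
    Ex n f double σ fun τ => Slot D.graph M τ e (insert v S) X ∧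
      ∀ e' < M, e' ≠ e → SameList M e' σ τ := by
  refine Ex.assume fun hn hf _ => ?_
  obtain ⟨r, hr⟩ : ∃ r, σ.nat 7 e = r := ⟨_, rfl⟩
  have hrn : r ≤ n := hr ▸ hslot.rk_le
  have hRn : 2 ^ r ≤ 2 ^ n := Nat.pow_le_pow_right (by simp) hrn
  have h4 := four_mul_le_small hn
  have hRf : 2 ^ r ≤ n * f := by
    have := hslot.enum.rank_le hSX
    rw [hr] at this
    exact this.trans hrank
  have hM' : T.size * T.size * 2 = M := hM
  have hM0 : M ≠ 0 := by omega
  have hylt : ∀ j < 2 ^ r, σ.nat 9 (j * M + e) < 2 ^ n := by simpa [hr] using hslot.y_lt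
  have hxlt : ∀ j < 2 ^ r, σ.nat 10 (j * M + e) < 2 ^ n := by simpa [hr] using hslot.x_lt
  have hyinj : ∀ j < 2 ^ r, ∀ k < 2 ^ r,
      σ.nat 9 (j * M + e) ^^^ y = σ.nat 9 (k * M + e) ^^^ y → j = k := by
    intro j hj k hk hjk
    have := hslot.enum.inj j (by rwa [hr]) k (by rwa [hr])
    exact this (by rw [Nat.xor_left_inj.1 hjk])
  have hyne : ∀ j < 2 ^ r, σ.nat 9 (j * M + e) ≠ y := by
    intro j hj h
    have := hslot.idx j (by rwa [hr])
    rw [h, hnew] at this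
    omega
  -- For each of the arrays 9, 10 and 11 the invariant records the entries written so far and that
  -- all other entries are untouched.
  refine Ex.seq (Ex.forLt (f₁ := 1) (N := 2 ^ r) (fun k τ =>
    ((∀ j < k, τ.nat 9 ((j + 2 ^ r) * M + e) = σ.nat 9 (j * M + e) ^^^ y) ∧
      ∀ a, (∀ j < k, a ≠ (j + 2 ^ r) * M + e) → τ.nat 9 a = σ.nat 9 a) ∧
    ((∀ j < k, τ.nat 10 ((j + 2 ^ r) * M + e) = σ.nat 10 (j * M + e) ^^^ 2 ^ v.1) ∧
      ∀ a, (∀ j < k, a ≠ (j + 2 ^ r) * M + e) → τ.nat 10 a = σ.nat 10 a) ∧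
    ((∀ j < k, τ.nat 11 ((σ.nat 9 (j * M + e) ^^^ y) * M + e) = j + 2 ^ r + 1) ∧
      ∀ a, (∀ j < k, a ≠ (σ.nat 9 (j * M + e) ^^^ y) * M + e) → τ.nat 11 a = σ.nat 11 a))
    le_rfl ?_ ?_ ?_ ?_ ?_ ?_)
  · rw [mul_one]
    exact hRf.trans (Nat.mul_le_mul_right _ (Nat.le_self_pow (by norm_num) n))
  · have : 0 < 2 ^ n := by positivity
    omega
  · intro k τ _ hfr
    simp [hfr.nat 4 (by decide), hfr.nat 7 (by decide), hfr.nat 26 (by decide), he, hr,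
      hσ.pow r hrn]
  · simp
  · rintro k τ hk ⟨⟨a1, a2⟩, ⟨b1, b2⟩, c1, c2⟩ hik hfr
    have hτ : Env D T τ := hσ.frame hfr (by decide)
    have t26 : τ.nat 26 0 = e := by rw [hfr.nat 26 (by decide), he]
    have t7 : τ.nat 7 e = r := by rw [hfr.nat 7 (by decide), hr]
    have t28 : τ.nat 28 0 = v := by rw [hfr.nat 28 (by decide), hv]
    have t29 : τ.nat 29 0 = y := by rw [hfr.nat 29 (by decide), hy]
    have t4 := hτ.pow r hrn
    have t4v := hτ.pow v v.2.le
    have hne : ∀ j < k, k * M + e ≠ (j + 2 ^ r) * M + e := by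
      intro j _ h
      have := ((addr_inj heM heM).1 h).1
      omega
    have t9 : τ.nat 9 (k * M + e) = σ.nat 9 (k * M + e) := a2 _ hne
    have t10 : τ.nat 10 (k * M + e) = σ.nat 10 (k * M + e) := b2 _ hne
    have hkR : ∀ j, (k * M + e = (j + 2 ^ r) * M + e) ↔ k = j + 2 ^ r := by
      intro j; rw [addr_inj heM heM]; simp
    refine Ex.seq (Ex.set ((k + 2 ^ r) * M + e) (σ.nat 9 (k * M + e) ^^^ y) ?_ ?_ ?_ ?_)
    · simp [hik, t26, t7, t4, hτ.m_eq, hM']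
    · simp [hik, t26, t29, hτ.m_eq, hM', t9]
    · exact small_of_lt (Nat.xor_lt_two_pow (hylt k hk) hyn)
    refine Ex.seq (Ex.set ((k + 2 ^ r) * M + e) (σ.nat 10 (k * M + e) ^^^ 2 ^ v.1) ?_ ?_ ?_ ?_)
    · simp [hik, t26, t7, t4, hτ.m_eq, hM']
    · simp [hik, t26, t28, hτ.m_eq, hM', t10, t4v]
    · exact small_of_lt (Nat.xor_lt_two_pow (hxlt k hk)
        (Nat.pow_lt_pow_right (by simp) v.2))
    refine Ex.set ((σ.nat 9 (k * M + e) ^^^ y) * M + e) (k + 2 ^ r + 1) ?_ ?_ ?_ ?_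
    · simp [hik, t26, t29, hτ.m_eq, hM', t9]
      omega
    · simp [hik, t26, t7, t4]
    · omega
    refine ⟨⟨?_, ?_⟩, ⟨?_, ?_⟩, ?_, ?_⟩
    · intro j hj
      rcases Nat.lt_succ_iff_lt_or_eq.1 hj with hj | rfl
      · simp [hM0, hj.ne, a1 j hj]
      · simp
    · intro a ha
      have := ha k (by omega)
      simp only [State.setNat_nat]
      simp [this]
      exact a2 a fun j hj => ha j (by omega)
    · intro j hj
      rcases Nat.lt_succ_iff_lt_or_eq.1 hj with hj | rfl
      · simp [hM0, hj.ne, b1 j hj]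
      · simp
    · intro a ha
      have := ha k (by omega)
      simp [this]
      exact b2 a fun j hj => ha j (by omega)
    · intro j hj
      rcases Nat.lt_succ_iff_lt_or_eq.1 hj with hj | rfl
      · have : σ.nat 9 (j * M + e) ^^^ y ≠ σ.nat 9 (k * M + e) ^^^ y := fun h =>
          hj.ne (hyinj j (by omega) k hk h)
        simp only [State.setNat_nat, addr_inj heM heM, this]
        simp [c1 j hj]
      · simp
    · intro a ha
      have := ha k (by omega)
      simp [this]
      exact c2 a fun j hj => ha j (by omega)
  · rintro τ ⟨⟨a1, a2⟩, ⟨b1, b2⟩, c1, c2⟩ hfr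
    have t26 : τ.nat 26 0 = e := by rw [hfr.nat 26 (by decide), he]
    have t7 : τ.nat 7 = σ.nat 7 := hfr.nat 7 (by decide)
    refine Ex.set e (r + 1) (by simp [t26]) (by simp [t26, t7, hr]) ?_ ⟨?_, ?_⟩
    · have : r < 2 ^ n := hrn.trans_lt Nat.lt_two_pow_self
      omega
    · have hlow : ∀ j < 2 ^ r, ∀ k < 2 ^ r, j * M + e ≠ (k + 2 ^ r) * M + e := by
        intro j hj k _ h
        have := ((addr_inj heM heM).1 h).1
        omega
      have hpow : 2 ^ (r + 1) = 2 ^ r + 2 ^ r := by ring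
      have hcases : ∀ j < 2 ^ (r + 1), j < 2 ^ r ∨ ∃ k < 2 ^ r, j = k + 2 ^ r := by
        intro j hj
        rcases lt_or_ge j (2 ^ r) with h | h
        · exact Or.inl h
        · exact Or.inr ⟨j - 2 ^ r, by omega, by omega⟩
      have ylow : ∀ j < 2 ^ r, τ.nat 9 (j * M + e) = σ.nat 9 (j * M + e) := fun j hj =>
        a2 _ (hlow j hj)
      have xlow : ∀ j < 2 ^ r, τ.nat 10 (j * M + e) = σ.nat 10 (j * M + e) := fun j hj =>
        b2 _ (hlow j hj)
      have hc2 : ∀ z, (∀ j < 2 ^ r, z ≠ σ.nat 9 (j * M + e) ^^^ y) →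
          τ.nat 11 (z * M + e) = σ.nat 11 (z * M + e) := by
        intro z hz
        refine c2 _ fun j hj h => hz j hj ((addr_inj heM heM).1 h).1
      have henum := hslot.enum
      rw [hr] at henum
      have hvnew : ∀ j < 2 ^ r, vec n (σ.nat 9 (j * M + e)) ≠ bd D.graph X (Pi.single v 1) := by
        intro j hj h
        rw [← hyv] at h
        exact hyne j hj (vec_inj (hylt j hj) hyn h)
      refine ⟨?_, ?_, ?_, ?_, ?_⟩
      · simp only [State.setNat_nat, and_self, if_true, show (9 : ℕ) ≠ 7 by decide,
          show (10 : ℕ) ≠ 7 by decide, false_and, if_false]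
        refine henum.insert_new hvnew ?_ ?_ ?_ ?_
        · intro j hj; simp only [ylow j hj]
        · intro j hj; simp only [xlow j hj]
        · intro j hj; simp only [a1 j hj, vec_xor, hyv]
        · intro j hj; simp only [b1 j hj, vec_xor, vec_two_pow]
      · intro j hj
        simp at hj ⊢
        rcases hcases j hj with hj | ⟨k, hk, rfl⟩
        · rw [ylow j hj]; exact hylt j hj
        · rw [a1 k hk]; exact Nat.xor_lt_two_pow (hylt k hk) hyn
      · intro j hj
        simp at hj ⊢
        rcases hcases j hj with hj | ⟨k, hk, rfl⟩
        · rw [xlow j hj]; exact hxlt j hj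
        · rw [b1 k hk]
          exact Nat.xor_lt_two_pow (hxlt k hk) (Nat.pow_lt_pow_right (by simp) v.2)
      · intro j hj
        simp at hj ⊢
        rcases hcases j hj with hj | ⟨k, hk, rfl⟩
        · rw [ylow j hj, hc2, hslot.idx j (by rwa [hr])]
          -- An old index entry is not overwritten: otherwise an old boundary would lie in the new
          -- coset, and the boundary of `v` would have been listed already.
          intro k hk h
          obtain ⟨l, hl, hly⟩ := henum.surj _ (add_mem_supp (henum.mem j hj) (henum.mem k hk))
          refine hvnew l hl ?_
          rw [hly, bd_add, ← henum.eq j hj, ← henum.eq k hk, h, vec_xor, hyv, add_right_comm,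
            vec_add_self, zero_add]
        · rw [a1 k hk, c1 k hk]
      · intro z hz
        simp at hz ⊢
        by_cases h : ∃ j < 2 ^ r, z = σ.nat 9 (j * M + e) ^^^ y
        · obtain ⟨j, hj, rfl⟩ := h
          exact ⟨j + 2 ^ r, by omega, a1 j hj⟩
        · push Not at h
          rw [hc2 z h] at hz
          obtain ⟨j, hj, hjz⟩ := hslot.idx_ne z hz
          rw [hr] at hj
          exact ⟨j, by omega, by rw [ylow j hj, hjz]⟩
    · intro e' he' hne
      have hno : ∀ j k, j * M + e' ≠ k * M + e := fun j k h => hne ((addr_inj he' heM).1 h).2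
      refine ⟨?_, ?_, ?_, ?_⟩
      · simp [hne, t7]
      · intro j
        simp
        exact a2 _ fun k _ => hno _ _
      · intro j
        simp
        exact b2 _ fun k _ => hno _ _
      · intro j
        simp
        exact c2 _ fun k _ => hno _ _

/-- Elimination with a lookup table: the spiders of `X` are inserted in increasing order, and array
11 decides at once whether the boundary of the next one is already spanned. It must therefore be
blank in this slot at the start. -/
theorem build_spec (hσ : Env D T σ) {M : ℕ} (hM : T.slots = M) {e : ℕ} {X : Set (Fin n)}
    (hrank : 2 ^ cutRank D.graph X ≤ n * f) (heM : e < M) (he : σ.nat 26 0 = e)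
    (hX : σ.nat 27 0 = maskOf X) (hfresh : ∀ y, σ.nat 11 (y * M + e) = 0) :
    Ex n f build σ fun τ => Slot D.graph M τ e X X ∧
      ∀ e' < M, e' ≠ e → SameList M e' σ τ := by
  refine Ex.assume fun hn hf _ => ?_
  have hM' : T.size * T.size * 2 = M := hM
  have hM0 : M ≠ 0 := by omega
  refine Ex.seq (Ex.set e 0 (by simp [he]) (by simp) (by simp) ?_)
  refine Ex.seq (Ex.set e 0 (by simp [he]) (by simp) (by simp) ?_)
  refine Ex.seq (Ex.set e 0 (by simp [he]) (by simp) (by simp) ?_)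
  refine Ex.seq (Ex.set e 1 (by simp [he]) (by simp) (two_lt_small hn (by norm_num)) ?_)
  have hno : ∀ e' < M, e' ≠ e → ∀ j, j * M + e' ≠ e := by
    intro e' he' hne j h
    have : j * M + e' = 0 * M + e := by simpa using h
    exact hne ((addr_inj he' heM).1 this).2
  have hz : ∀ j, j * M + e = e ↔ j = 0 := by
    intro j
    have := addr_inj (j := j) (j' := 0) heM heM
    simpa using this
  refine Ex.forLt (f₁ := f) (N := n) (fun k τ =>
    Slot D.graph M τ e {v | v ∈ X ∧ v.1 < k} X ∧
      ∀ e' < M, e' ≠ e → SameList M e' σ τ) hf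
    (loop_bound hn (k := 1) (by norm_num) (by simp)) (small_of_lt Nat.lt_two_pow_self)
    ?_ ?_ ?_ ?_
  · intro k τ _ hfr
    simp [hfr.nat 0 (by decide), hσ.n_eq]
  · refine ⟨⟨?_, ?_, ?_, ?_, ?_⟩, ?_⟩
    · have h0 : {v : Fin n | v ∈ X ∧ v.1 < 0} = ∅ := by ext; simp
      rw [h0]
      simp
      exact Enum.base (by simp [vec_zero]) (by simp [vec_zero])
    · intro j hj
      simp at hj ⊢
      simp [hj]
    · intro j hj
      simp at hj ⊢
      simp [hj]
    · intro j hj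
      simp at hj ⊢
      simp [hj]
    · intro y hy
      simp [hM0] at hy ⊢
      by_contra h
      rw [if_neg (by simpa [eq_comm] using h)] at hy
      exact hy (hfresh y)
    · intro e' he' hne
      refine ⟨?_, ?_, ?_, ?_⟩
      · simp [hne]
      all_goals intro j; simp [hno e' he' hne j]
  · rintro k τ hk ⟨hslot, hsame⟩ hik hfr
    have hτ : Env D T τ :=
      ((((hσ.setNat (by norm_num) _ _).setNat (by norm_num) _ _).setNat (by norm_num) _ _).setNat
        (by norm_num) _ _).frame hfr (by decide)
    have t26 : τ.nat 26 0 = e := by rw [hfr.nat 26 (by decide)]; simpa using he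
    have t27 : τ.nat 27 0 = maskOf X := by rw [hfr.nat 27 (by decide)]; simpa using hX
    have hbit := testBit_maskOf X ⟨k, hk⟩
    rw [Nat.testBit_eq_decide_div_mod_eq] at hbit
    refine Ex.cond (maskOf X / 2 ^ k % 2) (by simp [t27, hik, hτ.pow k hk.le]) ?_ ?_
    · intro hc
      have hkX : (⟨k, hk⟩ : Fin n) ∈ X := by
        rw [← hbit]; simp; omega
      have hins : {v : Fin n | v ∈ X ∧ v.1 < k + 1} =
          insert ⟨k, hk⟩ {v : Fin n | v ∈ X ∧ v.1 < k} := by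
        ext v
        simp only [Set.mem_ofPred_eq, Set.mem_insert_iff, Fin.ext_iff, Nat.lt_succ_iff_lt_or_eq]
        constructor
        · tauto
        · rintro (h | h)
          · have : v = ⟨k, hk⟩ := Fin.ext h
            exact ⟨this ▸ hkX, Or.inr h⟩
          · exact ⟨h.1, Or.inl h.2⟩
      set y := maskOf (D.graph.neighborSet ⟨k, hk⟩) &&& maskOf Xᶜ with hy
      have hrow := hτ.row ⟨k, hk⟩
      have hyn : y < 2 ^ n := Nat.and_le_left.trans_lt (maskOf_lt _)
      have hyv : vec n y = bd D.graph X (Pi.single ⟨k, hk⟩ 1) := by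
        rw [hy, vec_and_maskOf_compl, vec_maskOf_neighborSet, bd]
      refine Ex.seq (Ex.set 0 y rfl ?_ (small_of_lt hyn) ?_)
      · simp only at hrow
        simp [hik, hτ.n_eq, t27, hτ.pow n le_rfl, maskOf_compl, hrow, hy]
      have hsl := hslot.congr (SameList.setNat M e τ (a := 29) 0 y (by decide))
      refine Ex.cond (τ.nat 11 (y * M + e)) (by simp [t26, hτ.m_eq, hM']) ?_ ?_
      · intro hne
        refine Ex.skip ⟨?_, fun e' he' hne => ((hsame e' he' hne).trans
          (SameList.setNat _ _ _ _ _ (by decide))).trans (SameList.setNat _ _ _ _ _ (by decide))⟩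
        refine Slot.congr ?_ (SameList.setNat _ _ _ _ _ (by decide))
        rw [hins]
        -- A nonzero index entry names a listed copy of the boundary, so the list is already
        -- complete for the larger set.
        obtain ⟨j, hj, hjy⟩ := hslot.idx_ne y hne
        refine ⟨hsl.enum.insert_old ⟨j, by simpa using hj, ?_⟩, hsl.y_lt, hsl.x_lt, hsl.idx,
          hsl.idx_ne⟩
        simp [hjy, hyv]
      · intro h0
        refine (double_spec (X := X) (v := ⟨k, hk⟩) (hτ.setNat (by norm_num) _ _) hM
          (fun v hv => hv.1) hrank heM
          (by simpa using t26) (by simpa using hik) (by simp) hyn hyv hsl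
          (by simpa using h0)).mono fun υ _ hυ => ⟨?_, fun e' he' hne => ?_⟩
        · rw [hins]
          exact hυ.1.congr (SameList.setNat _ _ _ _ _ (by decide))
        · exact (((hsame e' he' hne).trans (SameList.setNat _ _ _ _ _ (by decide))).trans
            (hυ.2 e' he' hne)).trans (SameList.setNat _ _ _ _ _ (by decide))
    · intro hc
      have hkX : (⟨k, hk⟩ : Fin n) ∉ X := by
        rw [← hbit]; simp; omega
      have hins : {v : Fin n | v ∈ X ∧ v.1 < k + 1} = {v : Fin n | v ∈ X ∧ v.1 < k} := by
        ext v
        simp only [Set.mem_ofPred_eq]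
        refine and_congr_right fun hv => ?_
        have : v.1 ≠ k := fun h => hkX (by rwa [← Fin.ext (a := v) (b := ⟨k, hk⟩) h])
        omega
      refine Ex.skip ⟨?_, fun e' he' hne => (hsame e' he' hne).trans
        (SameList.setNat _ _ _ _ _ (by decide))⟩
      rw [hins]
      exact hslot.congr (SameList.setNat _ _ _ _ _ (by decide))
  · rintro τ ⟨h1, h2⟩ _
    have h0 : {v : Fin n | v ∈ X ∧ v.1 < n} = X := by ext v; simp
    rw [h0] at h1
    exact ⟨h1, h2⟩

end Specs

/-! ## The fast Walsh–Hadamard transform of a slot -/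

/-- The number of entries of the slot `e`. -/
abbrev len (e : NatExpr) : NatExpr := .load 4 (.load 7 e)

/-- Computes the layers of the Walsh–Hadamard transform in the slot in variable 26. -/
def walshProgram : Program :=
  .forLt 31 (.load 7 (var 26) * len (var 26))
    (.setNat 32 0 (.load 4 (var 31 / len (var 26))) ;;
      .ite (var 31 / var 32 % 2)
        (.setCpx 3 (adr (var 26) (var 31 + len (var 26)))
          (.sub (.load 3 (adr (var 26) (var 31 - var 32))) (.load 3 (adr (var 26) (var 31)))))
        (.setCpx 3 (adr (var 26) (var 31 + len (var 26)))
          (.add (.load 3 (adr (var 26) (var 31))) (.load 3 (adr (var 26) (var 31 + var 32))))))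

/-- Copies the first layer to the array `a` and a multiple of the last layer to the array `b`. -/
def copyLayers (a b : ℕ) : Program :=
  .forLt 33 (len (var 26))
    (.setCpx a (adr (var 26) (var 33)) (.load 3 (adr (var 26) (var 33))) ;;
      .setCpx b (adr (var 26) (var 33))
        (.mul (.load 4 (.const 0))
          (.load 3 (adr (var 26) (.load 7 (var 26) * len (var 26) + var 33)))))

/-- Computes the normalization of the inverse transform. -/
def scaleProgram : Program :=
  .setCpx 4 0 .one ;;
  .forLt 34 (.load 7 (var 26))
    (.setCpx 4 0 (.mul (.load 4 (.const 0)) (.mul .invSqrtTwo .invSqrtTwo)))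

section Specs

variable {n f : ℕ} {D : Diagram n} {T : BranchDecomposition n} {σ : State}

theorem add_two_pow_lt {i r j : ℕ} (hi : i < r) (hj : j < 2 ^ r) (h : j.testBit i = false) :
    j + 2 ^ i < 2 ^ r := by
  have hpos : 0 < 2 ^ i := by positivity
  rw [Nat.testBit_eq_decide_div_mod_eq] at h
  have h1 : j / 2 ^ i % 2 = 0 := by simpa using h
  obtain ⟨s, rfl⟩ : ∃ s, r = i + 1 + s := ⟨r - (i + 1), by omega⟩
  have h2 : j / 2 ^ i < 2 * 2 ^ s := by
    rw [Nat.div_lt_iff_lt_mul hpos]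
    calc j < 2 ^ (i + 1 + s) := hj
      _ = _ := by ring
  have h3 : j / 2 ^ i + 1 < 2 * 2 ^ s := by omega
  rw [← Nat.add_div_right _ hpos, Nat.div_lt_iff_lt_mul hpos] at h3
  calc j + 2 ^ i < 2 * 2 ^ s * 2 ^ i := h3
    _ = _ := by ring

theorem two_pow_le_of_testBit {i j : ℕ} (h : j.testBit i = true) : 2 ^ i ≤ j :=
  Nat.ge_two_pow_of_testBit h

/-- All layers are kept one after another: entry `l` holds layer `l / 2 ^ r` at index `l % 2 ^ r`.
The iteration `k` reads layer `k / 2 ^ r` and writes entry `k + 2 ^ r`, the same index one layer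
further, so nothing still needed is lost. -/
theorem walsh_spec (hσ : Env D T σ) {M : ℕ} (hM : T.slots = M) {e r : ℕ} (heM : e < M)
    (he : σ.nat 26 0 = e) (hr : σ.nat 7 e = r) (hrn : r ≤ n) (hRf : 2 ^ r ≤ n * f) :
    Ex n f walshProgram σ fun τ =>
      (∀ j < 2 ^ r, τ.cpx 3 (j * M + e) = σ.cpx 3 (j * M + e)) ∧
      (∀ j < 2 ^ r, τ.cpx 3 ((r * 2 ^ r + j) * M + e) =
        walsh (fun j => σ.cpx 3 (j * M + e)) r j) ∧
      ∀ e' < M, e' ≠ e → ∀ j, τ.cpx 3 (j * M + e') = σ.cpx 3 (j * M + e') := by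
  refine Ex.assume fun hn hf _ => ?_
  have hM' : T.size * T.size * 2 = M := hM
  have hM0 : M ≠ 0 := by omega
  have hRn : 2 ^ r ≤ 2 ^ n := Nat.pow_le_pow_right (by simp) hrn
  have hR0 : 0 < 2 ^ r := by positivity
  have hrR : r * 2 ^ r < 2 ^ (2 * n) := by
    rw [two_mul, pow_add]
    have : r < 2 ^ n := hrn.trans_lt Nat.lt_two_pow_self
    nlinarith
  refine Ex.forLt (f₁ := 1) (N := r * 2 ^ r) (fun k τ =>
    (∀ l < k + 2 ^ r, τ.cpx 3 (l * M + e) =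
      walsh (fun j => σ.cpx 3 (j * M + e)) (l / 2 ^ r) (l % 2 ^ r)) ∧
    ∀ e' < M, e' ≠ e → ∀ j, τ.cpx 3 (j * M + e') = σ.cpx 3 (j * M + e'))
    le_rfl ?_ (lt_small (by norm_num) hrR) ?_ ?_ ?_ ?_
  · calc r * 2 ^ r * 1 ≤ n * (n * f) := by rw [mul_one]; exact Nat.mul_le_mul hrn hRf
      _ = n ^ 2 * f := by ring
      _ ≤ n ^ 12 * f := Nat.mul_le_mul_right _ (Nat.pow_le_pow_right (by omega) (by norm_num))
  · intro k τ _ hfr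
    simp [hfr.nat 4 (by decide), hfr.nat 7 (by decide), hfr.nat 26 (by decide), he, hr,
      hσ.pow r hrn]
  · refine ⟨fun l hl => ?_, fun _ _ _ _ => rfl⟩
    rw [zero_add] at hl
    simp [Nat.div_eq_of_lt hl, Nat.mod_eq_of_lt hl, walsh]
  · rintro k τ hk ⟨h1, h2⟩ hik hfr
    have hτ : Env D T τ := hσ.frame hfr (by decide)
    have t26 : τ.nat 26 0 = e := by rw [hfr.nat 26 (by decide), he]
    have t7 : τ.nat 7 e = r := by rw [hfr.nat 7 (by decide), hr]
    have t4 := hτ.pow r hrn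
    have hi : k / 2 ^ r < r := by rwa [Nat.div_lt_iff_lt_mul hR0]
    have hdm := Nat.div_add_mod k (2 ^ r)
    have hmod := Nat.mod_lt k hR0
    generalize hieq : k / 2 ^ r = i at *
    generalize hjeq : k % 2 ^ r = j at *
    -- The layer number occupies only digits from `r` on, so for `i < r` digit `i` of `j` can be
    -- read directly from the counter `k`.
    have hbit : j.testBit i = decide (k / 2 ^ i % 2 = 1) := by
      rw [← Nat.testBit_eq_decide_div_mod_eq, ← hjeq, Nat.testBit_mod_two_pow]
      simp [hi]
    have hpi : (2 : ℕ) ^ i < 2 ^ n := Nat.pow_lt_pow_right (by simp) (by omega)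
    have hdiv : ∀ x, x < 2 ^ r → (2 ^ r * i + x) / 2 ^ r = i ∧ (2 ^ r * i + x) % 2 ^ r = x := by
      intro x hx
      rw [Nat.mul_add_div hR0, Nat.div_eq_of_lt hx, Nat.mul_add_mod, Nat.mod_eq_of_lt hx]
      simp
    have hpost : ∀ x : ℂ, x = walsh (fun j => σ.cpx 3 (j * M + e)) (i + 1) j →
        ∀ υ : State, υ.cpx = (τ.setCpx 3 ((k + 2 ^ r) * M + e) x).cpx →
        (∀ l < k + 1 + 2 ^ r, υ.cpx 3 (l * M + e) =
          walsh (fun j => σ.cpx 3 (j * M + e)) (l / 2 ^ r) (l % 2 ^ r)) ∧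
        ∀ e' < M, e' ≠ e → ∀ j, υ.cpx 3 (j * M + e') = σ.cpx 3 (j * M + e') := by
      intro x hx υ hυ
      rw [hυ]
      constructor
      · intro l hl
        by_cases hlk : l = k + 2 ^ r
        · have e1 : l = 2 ^ r * (i + 1) + j := by rw [hlk, ← hdm]; ring
          have e2 : l / 2 ^ r = i + 1 := by
            rw [e1, Nat.mul_add_div hR0, Nat.div_eq_of_lt hmod, add_zero]
          have e3 : l % 2 ^ r = j := by
            rw [e1, Nat.mul_add_mod, Nat.mod_eq_of_lt hmod]
          rw [e2, e3, hlk]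
          simp [hx]
        · simp [hM0, hlk]
          exact h1 l (by omega)
      · intro e' he' hne l
        have : l * M + e' ≠ (k + 2 ^ r) * M + e := fun h => hne ((addr_inj he' heM).1 h).2
        simp [this]
        exact h2 e' he' hne l
    refine Ex.seq (Ex.set 0 (2 ^ i) rfl ?_ (small_of_lt hpi) ?_)
    · simp [hik, t26, t7, t4, hieq, hτ.pow i (by omega)]
    refine Ex.cond (k / 2 ^ i % 2) (by simp [hik]) ?_ ?_
    · intro hc
      have hb : j.testBit i = true := by rw [hbit]; simp; omega
      have hge := two_pow_le_of_testBit hb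
      have hsub : k - 2 ^ i = 2 ^ r * i + (j - 2 ^ i) := by omega
      have hd := hdiv (j - 2 ^ i) ((Nat.sub_le _ _).trans_lt hmod)
      have r1 := h1 (k - 2 ^ i) (by omega)
      have r2 := h1 k (by omega)
      rw [hsub, hd.1, hd.2, ← hsub] at r1
      rw [hieq, hjeq] at r2
      refine Ex.setC ((k + 2 ^ r) * M + e) (walsh (fun j => σ.cpx 3 (j * M + e)) (i + 1) j) ?_ ?_
        (hpost _ rfl _ rfl)
      · simp [hik, t26, t7, t4, hτ.m_eq, hM']
      · simp [hik, t26, hτ.m_eq, hM', r1, r2, walsh, hb]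
    · intro hc
      have hb : j.testBit i = false := by rw [hbit]; simp; omega
      have hlt := add_two_pow_lt hi hmod hb
      have hadd : k + 2 ^ i = 2 ^ r * i + (j + 2 ^ i) := by omega
      have hd := hdiv (j + 2 ^ i) hlt
      have r1 := h1 (k + 2 ^ i) (by omega)
      have r2 := h1 k (by omega)
      rw [hadd, hd.1, hd.2, ← hadd] at r1
      rw [hieq, hjeq] at r2
      refine Ex.setC ((k + 2 ^ r) * M + e) (walsh (fun j => σ.cpx 3 (j * M + e)) (i + 1) j) ?_ ?_
        (hpost _ rfl _ rfl)
      · simp [hik, t26, t7, t4, hτ.m_eq, hM']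
      · simp [hik, t26, hτ.m_eq, hM', r1, r2, walsh, hb]
  · rintro τ ⟨h1, h2⟩ _
    refine ⟨fun j hj => ?_, fun j hj => ?_, h2⟩
    · rw [h1 j (by omega), Nat.div_eq_of_lt hj, Nat.mod_eq_of_lt hj, walsh]
    · rw [h1 _ (by omega), mul_comm r, Nat.mul_add_div hR0, Nat.div_eq_of_lt hj, Nat.mul_add_mod,
        Nat.mod_eq_of_lt hj, add_zero]

/-- The two orders of `a` and `b` serve the two directions: the first layer is the table and the
last its transform, or conversely with the scale of the inverse transform. -/
theorem copy_spec (hσ : Env D T σ) {M : ℕ} (hM : T.slots = M) {e r a b : ℕ}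
    (hab : a = 1 ∧ b = 2 ∨ a = 2 ∧ b = 1) (heM : e < M)
    (he : σ.nat 26 0 = e) (hr : σ.nat 7 e = r) (hrn : r ≤ n) (hRf : 2 ^ r ≤ n * f) :
    Ex n f (copyLayers a b) σ fun τ =>
      (∀ j < 2 ^ r, τ.cpx a (j * M + e) = σ.cpx 3 (j * M + e)) ∧
      (∀ j < 2 ^ r, τ.cpx b (j * M + e) = σ.cpx 4 0 * σ.cpx 3 ((r * 2 ^ r + j) * M + e)) ∧
      ∀ e' < M, e' ≠ e → ∀ c ∈ [1, 2], ∀ j, τ.cpx c (j * M + e') = σ.cpx c (j * M + e') := by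
  refine Ex.assume fun hn hf _ => ?_
  have hM' : T.size * T.size * 2 = M := hM
  have hM0 : M ≠ 0 := by omega
  have hRn : 2 ^ r ≤ 2 ^ n := Nat.pow_le_pow_right (by simp) hrn
  have h4 := four_mul_le_small hn
  have hpn : 0 < 2 ^ n := by positivity
  have hne : a ≠ b ∧ 3 ∉ [a, b] ∧ 4 ∉ [a, b] := by
    rcases hab with ⟨rfl, rfl⟩ | ⟨rfl, rfl⟩ <;> decide
  obtain ⟨hne, h3, h4'⟩ := hne
  simp only [List.mem_cons, List.not_mem_nil, or_false, not_or] at h3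
  refine Ex.forLt (f₁ := 1) (N := 2 ^ r) (fun k τ =>
      (∀ j < k, τ.cpx a (j * M + e) = σ.cpx 3 (j * M + e)) ∧
      (∀ j < k, τ.cpx b (j * M + e) = σ.cpx 4 0 * σ.cpx 3 ((r * 2 ^ r + j) * M + e)) ∧
      ∀ e' < M, e' ≠ e → ∀ c ∈ [1, 2], ∀ j, τ.cpx c (j * M + e') = σ.cpx c (j * M + e'))
    le_rfl ?_ (by omega) ?_ ?_ ?_ ?_ (hi := (by decide : 33 ∉ []))
  · rw [mul_one]
    exact hRf.trans (Nat.mul_le_mul_right _ (Nat.le_self_pow (by norm_num) n))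
  · intro k τ _ hfr
    replace hfr : Frame [33] [a, b] σ τ := hfr
    simp [hfr.nat 4 (by decide), hfr.nat 7 (by decide), hfr.nat 26 (by decide), he, hr,
      hσ.pow r hrn]
  · simp
  · rintro k τ hk ⟨h1, h2, h5⟩ hik hfr
    replace hfr : Frame [33] [a, b] σ τ := hfr
    have hτ : Env D T τ := hσ.frame hfr (by decide)
    have t26 : τ.nat 26 0 = e := by rw [hfr.nat 26 (by decide), he]
    have t7 : τ.nat 7 e = r := by rw [hfr.nat 7 (by decide), hr]
    have t4 := hτ.pow r hrn
    have c3 : τ.cpx 3 = σ.cpx 3 := hfr.cpx 3 (by simpa using h3)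
    have c4 : τ.cpx 4 = σ.cpx 4 := hfr.cpx 4 h4'
    refine Ex.seq (Ex.setC (k * M + e) (σ.cpx 3 (k * M + e)) ?_ ?_ ?_)
    · simp [hik, t26, hτ.m_eq, hM']
    · simp [hik, t26, hτ.m_eq, hM', c3]
    refine Ex.setC (k * M + e) (σ.cpx 4 0 * σ.cpx 3 ((r * 2 ^ r + k) * M + e)) ?_ ?_ ?_
    · simp [hik, t26, hτ.m_eq, hM']
    · simp only [List.mem_cons, List.not_mem_nil, or_false, not_or] at h4'
      simp [hik, t26, t7, t4, hτ.m_eq, hM', c3, c4, h3.1, h4'.1]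
    refine ⟨fun j hj => ?_, fun j hj => ?_, fun e' he' hee c hc j => ?_⟩
    · rcases Nat.lt_succ_iff_lt_or_eq.1 hj with hj | rfl
      · simp [hM0, hj.ne, h1 j hj]
      · simp [hne]
    · rcases Nat.lt_succ_iff_lt_or_eq.1 hj with hj | rfl
      · simp [hM0, hj.ne, h2 j hj]
      · simp
    · have : j * M + e' ≠ k * M + e := fun h => hee ((addr_inj he' heM).1 h).2
      simp [this]
      exact h5 e' he' hee c hc j
  · rintro τ h _
    exact h

/-- Complex division is not available; the inverse power of two is a power of the square of the
constant `1/√2`. -/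
theorem scale_spec {σ : State} {e r : ℕ}
    (he : σ.nat 26 0 = e) (hr : σ.nat 7 e = r) (hrn : r ≤ n) :
    Ex n f scaleProgram σ fun τ => τ.cpx 4 0 * 2 ^ r = 1 := by
  refine Ex.assume fun hn hf _ => ?_
  refine Ex.seq (Ex.setC 0 1 rfl rfl ?_)
  refine Ex.forLt (f₁ := f) (N := r) (fun k τ => τ.cpx 4 0 * 2 ^ k = 1) hf
    (loop_bound hn (k := 1) (by norm_num) (by simpa using hrn))
    (small_of_lt (hrn.trans_lt Nat.lt_two_pow_self)) ?_ (by simp) ?_ ?_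
  · intro k τ _ hfr
    simp [hfr.nat 7 (by decide), hfr.nat 26 (by decide), he, hr]
  · intro k τ hk hI hik hfr
    refine Ex.setC 0 _ rfl rfl ?_
    simp
    have h2 : ((Real.sqrt 2 : ℂ))⁻¹ * ((Real.sqrt 2 : ℂ))⁻¹ = 2⁻¹ := by
      rw [← mul_inv, ← Complex.ofReal_mul, Real.mul_self_sqrt (by norm_num)]
      norm_num
    rw [h2, pow_succ, ← hI]
    ring
  · intro τ hI _
    exact hI

end Specs

/-! ## Combining the data of two tree edges -/

/-- Adds a number, with the sign given by variable 21, to an entry of the working array. -/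
def accumulate (j : NatExpr) (x : CpxExpr) : Program :=
  .ite (var 21)
    (.setCpx 3 (adr (var 26) j) (.sub (.load 3 (adr (var 26) j)) x))
    (.setCpx 3 (adr (var 26) j) (.add (.load 3 (adr (var 26) j)) x))

/-- Computes the partial sums for the edge in variable 26 from those of the edges in variables
35 and 36. -/
def combinePart : Program :=
  .forLt 37 (len (var 35) * len (var 36))
    (.setNat 38 0 (var 37 % len (var 35)) ;;
      .setNat 39 0 (var 37 / len (var 35)) ;;
      .setNat 20 0
        (.load 9 (adr (var 35) (var 38)) &&& .load 10 (adr (var 36) (var 39))) ;;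
      parity ;;
      .setNat 40 0 (.load 11 (adr (var 26)
        ((.load 9 (adr (var 35) (var 38)) ^^^ .load 9 (adr (var 36) (var 39))) &&&
          (.load 4 nn - 1 - .load 6 (var 26)))) - 1) ;;
      accumulate (var 40)
        (.mul (.load 1 (adr (var 35) (var 38))) (.load 1 (adr (var 36) (var 39)))))

/-- Computes the transformed partial sums for the edge in variable 26 from the partial sums of the
edge in variable 35 and the transformed partial sums of the edge in variable 36. -/
def combineDual : Program :=
  .forLt 37 (len (var 35) * len (var 26))
    (.setNat 38 0 (var 37 % len (var 35)) ;;
      .setNat 39 0 (.load 10 (adr (var 26 + mm * mm) (var 37 / len (var 35)))) ;;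
      .setNat 23 0 (.load 10 (adr (var 35) (var 38)) ^^^ var 39) ;;
      coords 36 ;;
      .setNat 41 0 (var 24) ;;
      .setNat 23 0 (var 39) ;;
      coords 26 ;;
      .setNat 20 0 (.load 9 (adr (var 35) (var 38)) &&& var 39) ;;
      parity ;;
      accumulate (var 24)
        (.mul (.load 1 (adr (var 35) (var 38))) (.load 2 (adr (var 36) (var 41)))))

theorem Frame.setNat {ln lc : List ℕ} {σ τ : State} (h : Frame ln lc σ τ) {a : ℕ} (ha : a ∈ ln)
    (i x : ℕ) : Frame ln lc σ (τ.setNat a i x) where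
  nat b hb := by
    rw [State.setNat_nat_ne τ i x (ne_of_mem_of_not_mem ha hb).symm, h.nat b hb]
  cpx b hb := h.cpx b hb
  angle := h.angle

theorem Frame.setCpx {ln lc : List ℕ} {σ τ : State} (h : Frame ln lc σ τ) {a : ℕ} (ha : a ∈ lc)
    (i : ℕ) (x : ℂ) : Frame ln lc σ (τ.setCpx a i x) where
  nat b hb := h.nat b hb
  cpx b hb := by
    rw [State.setCpx_cpx_ne τ i x (ne_of_mem_of_not_mem ha hb).symm, h.cpx b hb]
  angle := h.angle

theorem Frame.andThen {ln lc ln' lc' : List ℕ} {σ τ υ : State} (h : Frame ln lc σ τ)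
    (h' : Frame ln' lc' τ υ) (hn : ln' ⊆ ln) (hc : lc' ⊆ lc) : Frame ln lc σ υ :=
  h.trans (h'.mono hn hc)

section Specs

variable {n f : ℕ} {D : Diagram n} {T : BranchDecomposition n} {σ τ υ : State} {M : ℕ}

/-- The slot `e` holds the complete data of a tree edge that cuts off `X`. -/
structure EdgeData (D : Diagram n) (M : ℕ) (σ : State) (e : ℕ) (X : Set (Fin n)) : Prop where
  mask : σ.nat 6 e = maskOf X
  slot : Slot D.graph M σ e X X
  part_eq : ∀ j < 2 ^ σ.nat 7 e,
    σ.cpx 1 (j * M + e) = part D.graph D.phase X (vec n (σ.nat 9 (j * M + e)))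
  trans_eq : ∀ t < 2 ^ σ.nat 7 e, σ.cpx 2 (t * M + e) = ∑ s ∈ Finset.range (2 ^ σ.nat 7 e),
    part D.graph D.phase X (vec n (σ.nat 9 (s * M + e))) * sgn (bitDot (σ.nat 7 e) s t)

theorem EdgeData.congr {e : ℕ} {X : Set (Fin n)} (h : EdgeData D M σ e X)
    (hs : SameList M e σ τ) (h6 : τ.nat 6 e = σ.nat 6 e)
    (hc : ∀ c ∈ [1, 2], ∀ j, τ.cpx c (j * M + e) = σ.cpx c (j * M + e)) : EdgeData D M τ e X where
  mask := h6.trans h.mask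
  slot := h.slot.congr hs
  part_eq := by simpa only [hs.rk, hs.y, hc 1 (by simp)] using h.part_eq
  trans_eq := by simpa only [hs.rk, hs.y, hc 2 (by simp)] using h.trans_eq

/-- The transform is stored by frequency, so the `dual` sum at any outside assignment is found by
computing its coordinates. -/
theorem EdgeData.dual_eq {e : ℕ} {X : Set (Fin n)} (h : EdgeData D M σ e X) {c : Fin n → ZMod 2}
    (hc : c ∈ supp Xᶜ) :
    σ.cpx 2 (coord (σ.nat 7 e) (fun j => vec n (σ.nat 9 (j * M + e))) c * M + e) =
      dual D.graph D.phase X c := by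
  rw [h.trans_eq _ (coord_lt _ _ _), Enum.dual_eq D.phase h.slot.enum hc]
  refine Finset.sum_congr rfl fun s hs => ?_
  rw [h.slot.enum.dot_eq (by simpa using hs)]

theorem accumulate_spec (hσ : Env D T σ) (hM : T.slots = M) {e d : ℕ} {z : ZMod 2} {j : NatExpr}
    {x : CpxExpr} {xv : ℂ} {Q : State → Prop} (he : σ.nat 26 0 = e) (hz : σ.nat 21 0 = z.val)
    (hj : j.eval σ = d) (hx : x.eval σ = xv)
    (hQ : Q (σ.setCpx 3 (d * M + e) (σ.cpx 3 (d * M + e) + xv * sgn z)))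
    (hjo : (adr (var 26) j).ok = true := by rfl)
    (hso : (CpxExpr.sub (.load 3 (adr (var 26) j)) x).ok = true := by rfl)
    (hao : (CpxExpr.add (.load 3 (adr (var 26) j)) x).ok = true := by rfl) :
    Ex n f (accumulate j x) σ Q := by
  have hM' : T.size * T.size * 2 = M := hM
  refine Ex.cond z.val (by simp [hz]) ?_ ?_
  · intro h
    have hz1 : z = 1 := by
      rcases zmod_two_cases z with rfl | rfl
      · simp at h
      · rfl
    refine Ex.setC (d * M + e) (σ.cpx 3 (d * M + e) + xv * sgn z) ?_ ?_ hQ hjo hso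
    · simp [hj, he, hσ.m_eq, hM']
    · simp [hj, he, hσ.m_eq, hM', hz1, hx, sub_eq_add_neg]
  · intro h
    have hz0 : z = 0 := by rwa [ZMod.val_eq_zero] at h
    refine Ex.setC (d * M + e) (σ.cpx 3 (d * M + e) + xv * sgn z) ?_ ?_ hQ hjo hao
    · simp [hj, he, hσ.m_eq, hM']
    · simp [hj, he, hσ.m_eq, hM', hz0, hx]

/-- The first `R` working entries of the slot `e` have been increased by the first `k` terms. -/
structure Sums (M e R : ℕ) (F : ℕ → ℕ → ℂ) (σ : State) (k : ℕ) (τ : State) : Prop where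
  sum : ∀ t < R, τ.cpx 3 (t * M + e) = σ.cpx 3 (t * M + e) + ∑ i ∈ Finset.range k, F i t
  other : ∀ e' < M, e' ≠ e → ∀ j, τ.cpx 3 (j * M + e') = σ.cpx 3 (j * M + e')

theorem Sums.zero (M e R : ℕ) (F : ℕ → ℕ → ℂ) (h : τ.cpx 3 = σ.cpx 3) : Sums M e R F σ 0 τ :=
  ⟨by simp [h], by simp [h]⟩

theorem Sums.step {e R k d : ℕ} {F : ℕ → ℕ → ℂ} {x : ℂ} (h : Sums M e R F σ k τ) (he : e < M)
    (hc : υ.cpx 3 = (τ.setCpx 3 (d * M + e) (τ.cpx 3 (d * M + e) + x)).cpx 3)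
    (hF : ∀ t < R, F k t = if d = t then x else 0) : Sums M e R F σ (k + 1) υ := by
  have hM0 : M ≠ 0 := by omega
  refine ⟨fun t ht => ?_, fun e' he' hne j => ?_⟩
  · rw [hc, Finset.sum_range_succ, hF t ht, ← add_assoc, ← h.sum t ht]
    by_cases hdt : d = t
    · simp [hdt]
    · simp [hM0, hdt, Ne.symm hdt]
  · have : j * M + e' ≠ d * M + e := fun h => hne ((addr_inj he' he).1 h).2
    rw [hc]
    simp [this]
    exact h.other e' he' hne j

/-- The double sum of `Enum.part_union` is evaluated by scattering: each pair `(i, j)` is added to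
the one entry whose boundary it produces, so the loop has only `2 ^ (rA + rB)` iterations. -/
theorem combinePart_spec (hσ : Env D T σ) (hM : T.slots = M) {a b e : ℕ} {A B : Set (Fin n)}
    (hA : EdgeData D M σ a A) (hB : EdgeData D M σ b B) (hAB : Disjoint A B)
    (hmask : σ.nat 6 e = maskOf (A ∪ B)) (hE : Slot D.graph M σ e (A ∪ B) (A ∪ B))
    (heM : e < M) (h35 : σ.nat 35 0 = a) (h36 : σ.nat 36 0 = b) (h26 : σ.nat 26 0 = e)
    (hW : ∀ j, σ.cpx 3 (j * M + e) = 0) (hf : 2 ^ σ.nat 7 a * 2 ^ σ.nat 7 b ≤ f) :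
    Ex n f combinePart σ fun τ =>
      (∀ j < 2 ^ σ.nat 7 e, τ.cpx 3 (j * M + e) =
        part D.graph D.phase (A ∪ B) (vec n (σ.nat 9 (j * M + e)))) ∧
      ∀ e' < M, e' ≠ e → ∀ j, τ.cpx 3 (j * M + e') = σ.cpx 3 (j * M + e') := by
  refine Ex.assume fun hn _ _ => ?_
  have hM' : T.size * T.size * 2 = M := hM
  obtain ⟨rA, hrA⟩ : ∃ r, σ.nat 7 a = r := ⟨_, rfl⟩
  obtain ⟨rB, hrB⟩ : ∃ r, σ.nat 7 b = r := ⟨_, rfl⟩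
  have hrAn : rA ≤ n := hrA ▸ hA.slot.rk_le
  have hrBn : rB ≤ n := hrB ▸ hB.slot.rk_le
  have hRA : 0 < 2 ^ rA := by positivity
  have hRAn : 2 ^ rA ≤ 2 ^ n := Nat.pow_le_pow_right (by simp) hrAn
  have hRBn : 2 ^ rB ≤ 2 ^ n := Nat.pow_le_pow_right (by simp) hrBn
  have eA := hA.slot.enum
  have eB := hB.slot.enum
  have yA := hA.slot.y_lt
  have yB := hB.slot.y_lt
  have xB := hB.slot.x_lt
  have pA := hA.part_eq
  have pB := hB.part_eq
  rw [hrA] at eA yA pA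
  rw [hrB] at eB yB xB pB
  rw [hrA, hrB] at hf
  set F : ℕ → ℕ → ℕ → ℂ := fun i j t =>
    if off (A ∪ B) (vec n (σ.nat 9 (i * M + a)) + vec n (σ.nat 9 (j * M + b))) =
        vec n (σ.nat 9 (t * M + e)) then
      part D.graph D.phase A (vec n (σ.nat 9 (i * M + a))) *
        part D.graph D.phase B (vec n (σ.nat 9 (j * M + b))) *
        sgn (dot (vec n (σ.nat 9 (i * M + a))) (vec n (σ.nat 10 (j * M + b)))) else 0 with hF
  refine Ex.forLt (f₁ := 1) (N := 2 ^ rA * 2 ^ rB)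
    (Sums M e (2 ^ σ.nat 7 e) (fun k t => F (k % 2 ^ rA) (k / 2 ^ rA) t) σ) le_rfl
    ?_ ?_ ?_ (Sums.zero _ _ _ _ rfl) ?_ ?_
  · rw [mul_one]
    exact hf.trans (Nat.le_mul_of_pos_left _ (by positivity))
  · refine lt_small (k := 3) (by norm_num) ?_
    calc 2 ^ rA * 2 ^ rB ≤ 2 ^ n * 2 ^ n := Nat.mul_le_mul hRAn hRBn
      _ = 2 ^ (2 * n) := by ring
      _ < 2 ^ (3 * n) := Nat.pow_lt_pow_right (by simp) (by omega)
  · intro k τ _ hfr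
    simp [hfr.nat 4 (by decide), hfr.nat 7 (by decide), hfr.nat 35 (by decide),
      hfr.nat 36 (by decide), h35, h36, hrA, hrB, hσ.pow rA hrAn, hσ.pow rB hrBn]
  · intro k τ hk hS hik hfr
    have hτ : Env D T τ := hσ.frame hfr (by decide)
    have hi := Nat.mod_lt k hRA
    have hj : k / 2 ^ rA < 2 ^ rB := Nat.div_lt_of_lt_mul hk
    obtain ⟨i, hii⟩ : ∃ i, k % 2 ^ rA = i := ⟨_, rfl⟩
    obtain ⟨j, hjj⟩ : ∃ j, k / 2 ^ rA = j := ⟨_, rfl⟩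
    rw [hii] at hi
    rw [hjj] at hj
    -- The target index `d` belongs to the boundary of the sum of the two representatives; the
    -- program finds it through array 11.
    obtain ⟨d, hd, hdy⟩ := hE.enum.surj _ (add_mem_supp
      (supp_mono Set.subset_union_left (eA.mem i hi)) (supp_mono Set.subset_union_right (eB.mem j hj)))
    have hoff : off (A ∪ B) (vec n (σ.nat 9 (i * M + a)) + vec n (σ.nat 9 (j * M + b))) =
        vec n (σ.nat 9 (d * M + e)) := by
      rw [hdy, eA.eq i hi, eB.eq j hj, bd_add, off_add, bd, bd, bd, bd,
        off_off Set.subset_union_left, off_off Set.subset_union_right]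
    set p := (σ.nat 9 (i * M + a) ^^^ σ.nat 9 (j * M + b)) &&& maskOf (A ∪ B)ᶜ with hp
    have hpd : p = σ.nat 9 (d * M + e) := by
      refine vec_inj (n := n) (Nat.and_le_right.trans_lt (maskOf_lt _)) (hE.y_lt d hd) ?_
      rw [hp, vec_and_maskOf_compl, vec_xor, hoff]
    have hidx : σ.nat 11 (p * M + e) = d + 1 := by rw [hpd]; exact hE.idx d hd
    have hdn : d < 2 ^ n := hd.trans_le (Nat.pow_le_pow_right (by simp) hE.rk_le)
    have t4 : τ.nat 4 = σ.nat 4 := hfr.nat 4 (by decide)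
    have t6 : τ.nat 6 = σ.nat 6 := hfr.nat 6 (by decide)
    have t7 : τ.nat 7 = σ.nat 7 := hfr.nat 7 (by decide)
    have t9 : τ.nat 9 = σ.nat 9 := hfr.nat 9 (by decide)
    have t10 : τ.nat 10 = σ.nat 10 := hfr.nat 10 (by decide)
    have t11 : τ.nat 11 = σ.nat 11 := hfr.nat 11 (by decide)
    have t26 : τ.nat 26 0 = e := by rw [hfr.nat 26 (by decide), h26]
    have t35 : τ.nat 35 0 = a := by rw [hfr.nat 35 (by decide), h35]
    have t36 : τ.nat 36 0 = b := by rw [hfr.nat 36 (by decide), h36]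
    have c1 : τ.cpx 1 = σ.cpx 1 := hfr.cpx 1 (by decide)
    have s4 := hσ.pow rA hrAn
    refine Ex.seq (Ex.set 0 i rfl ?_ ?_ ?_)
    · simp [hik, t35, t7, t4, s4, hrA, hii]
    · exact small_of_lt (hi.trans_le hRAn)
    refine Ex.seq (Ex.set 0 j rfl ?_ ?_ ?_)
    · simp [hik, t35, t7, t4, s4, hrA, hjj]
    · exact small_of_lt (hj.trans_le hRBn)
    refine Ex.seq (Ex.set 0 (σ.nat 9 (i * M + a) &&& σ.nat 10 (j * M + b)) rfl ?_ ?_ ?_)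
    · simp [t35, t36, t9, t10, hτ.m_eq, hM']
    · exact small_of_lt (Nat.and_le_right.trans_lt (xB j hj))
    have hτ1 := ((hτ.setNat (a := 38) (by norm_num) 0 i).setNat (a := 39) (by norm_num) 0 j).setNat
      (a := 20) (by norm_num) 0 (σ.nat 9 (i * M + a) &&& σ.nat 10 (j * M + b))
    refine Ex.seq ((parity_spec hτ1 (by simp; rfl)).mono fun υ hfr' hυ => ?_)
    have hυe : Env D T υ := hτ1.frame hfr' (by decide)
    have u4 : υ.nat 4 n = 2 ^ n := hυe.pow n le_rfl
    have u6 : υ.nat 6 e = maskOf (A ∪ B) := by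
      rw [hfr'.nat 6 (by decide)]; simpa [t6] using hmask
    have u9 : υ.nat 9 = σ.nat 9 := by
      rw [hfr'.nat 9 (by decide), ← t9]; rfl
    have u11 : υ.nat 11 = σ.nat 11 := by
      rw [hfr'.nat 11 (by decide), ← t11]; rfl
    have u26 : υ.nat 26 0 = e := by rw [hfr'.nat 26 (by decide)]; simpa using t26
    have u35 : υ.nat 35 0 = a := by rw [hfr'.nat 35 (by decide)]; simpa using t35
    have u36 : υ.nat 36 0 = b := by rw [hfr'.nat 36 (by decide)]; simpa using t36
    have u38 : υ.nat 38 0 = i := by rw [hfr'.nat 38 (by decide)]; simp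
    have u39 : υ.nat 39 0 = j := by rw [hfr'.nat 39 (by decide)]; simp
    have v1 : υ.cpx 1 = σ.cpx 1 := by rw [hfr'.cpx 1 (by decide), ← c1]; rfl
    have v3 : υ.cpx 3 = τ.cpx 3 := hfr'.cpx 3 (by decide)
    refine Ex.seq (Ex.set 0 d rfl ?_ (small_of_lt hdn) ?_)
    · simp [-Set.compl_union, u26, u35, u36, u38, u39, u9, u6, u4, u11, hυe.n_eq, hυe.m_eq, hM', maskOf_compl,
        ← hp, hidx]
    refine accumulate_spec (hυe.setNat (by norm_num) _ _) hM (e := e) (d := d)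
      (xv := σ.cpx 1 (i * M + a) * σ.cpx 1 (j * M + b)) (by simpa using u26) (by simpa using hυ)
      (by simp) ?_ ?_
    · simp [u35, u36, u38, u39, v1, hυe.m_eq, hM']
    · refine hS.step (d := d) heM
        (x := σ.cpx 1 (i * M + a) * σ.cpx 1 (j * M + b) *
          sgn (dot (vec n (σ.nat 9 (i * M + a))) (vec n (σ.nat 10 (j * M + b))))) ?_ ?_
      · funext l
        simp [v3]
      · intro t ht
        simp only [hF, hii, hjj, hoff, pA i hi, pB j hj]
        refine if_congr ⟨fun h => hE.enum.inj d hd t ht h, fun h => by rw [h]⟩ rfl rfl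
  · intro τ hS _
    refine ⟨fun t ht => ?_, hS.other⟩
    rw [hS.sum t ht, hW, zero_add, sum_range_mul_eq (2 ^ rA) (2 ^ rB) fun i j => F i j t,
      Enum.part_union D.phase eA eB hAB]

/-- In `Enum.dual_union` the outside assignment `c` runs through the representatives stored for the
complement, and each term goes to the frequency of its `c`. The loop has `2 ^ (rA + r)` iterations,
without any reference to the number of boundaries of `B`. -/
theorem combineDual_spec (hσ : Env D T σ) (hM : T.slots = M) {a b e : ℕ} {A B : Set (Fin n)}
    (hA : EdgeData D M σ a A) (hB : EdgeData D M σ b B) (hAB : Disjoint A B)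
    (hE : Slot D.graph M σ e (A ∪ B) (A ∪ B))
    (hE' : Slot D.graph M σ (e + T.size * T.size) (A ∪ B)ᶜ (A ∪ B)ᶜ)
    (heM : e < M) (h35 : σ.nat 35 0 = a) (h36 : σ.nat 36 0 = b) (h26 : σ.nat 26 0 = e)
    (hW : ∀ j, σ.cpx 3 (j * M + e) = 0) (hf : 2 ^ σ.nat 7 a * 2 ^ σ.nat 7 e ≤ f) :
    Ex n f combineDual σ fun τ =>
      (∀ t < 2 ^ σ.nat 7 e, τ.cpx 3 (t * M + e) = ∑ s ∈ Finset.range (2 ^ σ.nat 7 e),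
        part D.graph D.phase (A ∪ B) (vec n (σ.nat 9 (s * M + e))) *
          sgn (bitDot (σ.nat 7 e) s t)) ∧
      ∀ e' < M, e' ≠ e → ∀ j, τ.cpx 3 (j * M + e') = σ.cpx 3 (j * M + e') := by
  refine Ex.assume fun hn _ _ => ?_
  have hM' : T.size * T.size * 2 = M := hM
  obtain ⟨rA, hrA⟩ : ∃ r, σ.nat 7 a = r := ⟨_, rfl⟩
  obtain ⟨rB, hrB⟩ : ∃ r, σ.nat 7 b = r := ⟨_, rfl⟩
  obtain ⟨r, hr⟩ : ∃ r, σ.nat 7 e = r := ⟨_, rfl⟩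
  -- Cut-rank is symmetric, so the lists for the set and its complement have the same length.
  have hr' : σ.nat 7 (e + T.size * T.size) = r := by
    rw [hE'.enum.rank_eq, cutRank_compl, ← hE.enum.rank_eq, hr]
  have hrAn : rA ≤ n := hrA ▸ hA.slot.rk_le
  have hrBn : rB ≤ n := hrB ▸ hB.slot.rk_le
  have hrn : r ≤ n := hr ▸ hE.rk_le
  have hRA : 0 < 2 ^ rA := by positivity
  have hRAn : 2 ^ rA ≤ 2 ^ n := Nat.pow_le_pow_right (by simp) hrAn
  have hRBn : 2 ^ rB ≤ 2 ^ n := Nat.pow_le_pow_right (by simp) hrBn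
  have hRn : 2 ^ r ≤ 2 ^ n := Nat.pow_le_pow_right (by simp) hrn
  have eA := hA.slot.enum
  have eE := hE.enum
  have eE' := hE'.enum
  have yA := hA.slot.y_lt
  have xA := hA.slot.x_lt
  have xE := hE'.x_lt
  have pA := hA.part_eq
  have dB : ∀ c ∈ supp Bᶜ, _ := fun c hc => hB.dual_eq hc
  rw [hrA] at eA yA xA pA
  rw [hr'] at eE' xE
  rw [hr] at eE
  rw [hrB] at dB
  rw [hrA, hr] at hf
  set F : ℕ → ℕ → ℕ → ℂ := fun i j t =>
    if coord r (fun s => vec n (σ.nat 9 (s * M + e)))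
        (vec n (σ.nat 10 (j * M + (e + T.size * T.size)))) = t then
      part D.graph D.phase A (vec n (σ.nat 9 (i * M + a))) *
        dual D.graph D.phase B (vec n (σ.nat 10 (i * M + a)) +
          vec n (σ.nat 10 (j * M + (e + T.size * T.size)))) *
        sgn (dot (vec n (σ.nat 9 (i * M + a)))
          (vec n (σ.nat 10 (j * M + (e + T.size * T.size))))) else 0 with hF
  refine Ex.forLt (f₁ := 1) (N := 2 ^ rA * 2 ^ r)
    (Sums M e (2 ^ r) (fun k t => F (k % 2 ^ rA) (k / 2 ^ rA) t) σ) le_rfl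
    ?_ ?_ ?_ (Sums.zero _ _ _ _ rfl) ?_ ?_
  · rw [mul_one]
    exact hf.trans (Nat.le_mul_of_pos_left _ (by positivity))
  · refine lt_small (k := 3) (by norm_num) ?_
    calc 2 ^ rA * 2 ^ r ≤ 2 ^ n * 2 ^ n := Nat.mul_le_mul hRAn hRn
      _ = 2 ^ (2 * n) := by ring
      _ < 2 ^ (3 * n) := Nat.pow_lt_pow_right (by simp) (by omega)
  · intro k τ _ hfr
    simp [hfr.nat 4 (by decide), hfr.nat 7 (by decide), hfr.nat 35 (by decide),
      hfr.nat 26 (by decide), h35, h26, hrA, hr, hσ.pow rA hrAn, hσ.pow r hrn]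
  · intro k τ hk hS hik hfr
    have hτ : Env D T τ := hσ.frame hfr (by decide)
    have hi := Nat.mod_lt k hRA
    have hj : k / 2 ^ rA < 2 ^ r := Nat.div_lt_of_lt_mul hk
    obtain ⟨i, hii⟩ : ∃ i, k % 2 ^ rA = i := ⟨_, rfl⟩
    obtain ⟨j, hjj⟩ : ∃ j, k / 2 ^ rA = j := ⟨_, rfl⟩
    rw [hii] at hi
    rw [hjj] at hj
    obtain ⟨c, hc⟩ : ∃ c, σ.nat 10 (j * M + (e + T.size * T.size)) = c := ⟨_, rfl⟩
    obtain ⟨x, hx⟩ : ∃ x, σ.nat 10 (i * M + a) = x := ⟨_, rfl⟩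
    obtain ⟨y, hy⟩ : ∃ y, σ.nat 9 (i * M + a) = y := ⟨_, rfl⟩
    have hcn : c < 2 ^ n := hc ▸ xE j hj
    have hxn : x < 2 ^ n := hx ▸ xA i hi
    have hcs : vec n c ∈ supp (A ∪ B)ᶜ := hc ▸ eE'.mem j hj
    have hxs : vec n x ∈ supp A := hx ▸ eA.mem i hi
    have hsum : vec n (x ^^^ c) ∈ supp Bᶜ := by
      rw [vec_xor]
      exact add_mem_supp (supp_mono hAB.subset_compl_right hxs)
        (supp_mono (Set.compl_subset_compl.2 Set.subset_union_right) hcs)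
    have hlook := dB _ hsum
    have hs_lt := coord_lt rB (fun j => vec n (σ.nat 9 (j * M + b))) (vec n (x ^^^ c))
    set s := coord rB (fun j => vec n (σ.nat 9 (j * M + b))) (vec n (x ^^^ c)) with hs
    have ht_lt := coord_lt r (fun j => vec n (σ.nat 9 (j * M + e))) (vec n c)
    set d := coord r (fun j => vec n (σ.nat 9 (j * M + e))) (vec n c) with hd
    have t4 : τ.nat 4 = σ.nat 4 := hfr.nat 4 (by decide)
    have t7 : τ.nat 7 = σ.nat 7 := hfr.nat 7 (by decide)
    have t9 : τ.nat 9 = σ.nat 9 := hfr.nat 9 (by decide)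
    have t10 : τ.nat 10 = σ.nat 10 := hfr.nat 10 (by decide)
    have t26 : τ.nat 26 0 = e := by rw [hfr.nat 26 (by decide), h26]
    have t35 : τ.nat 35 0 = a := by rw [hfr.nat 35 (by decide), h35]
    have t36 : τ.nat 36 0 = b := by rw [hfr.nat 36 (by decide), h36]
    have c1 : τ.cpx 1 = σ.cpx 1 := hfr.cpx 1 (by decide)
    have c2 : τ.cpx 2 = σ.cpx 2 := hfr.cpx 2 (by decide)
    have s4 := hσ.pow rA hrAn
    refine Ex.seq (Ex.set 0 i rfl ?_ (small_of_lt (hi.trans_le hRAn)) ?_)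
    · simp [hik, t35, t7, t4, s4, hrA, hii]
    refine Ex.seq (Ex.set 0 c rfl ?_ (small_of_lt hcn) ?_)
    · simp [hik, t35, t26, t7, t10, t4, s4, hrA, hjj, hτ.m_eq, hM', hc]
    refine Ex.seq (Ex.set 0 (x ^^^ c) rfl ?_ (small_of_lt (Nat.xor_lt_two_pow hxn hcn)) ?_)
    · simp [t35, t10, hτ.m_eq, hM', hx]
    have hτ1 := ((hτ.setNat (a := 38) (by norm_num) 0 i).setNat (a := 39) (by norm_num) 0 c).setNat
      (a := 23) (by norm_num) 0 (x ^^^ c)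
    refine Ex.seq ((coords_spec hτ1 (s := 36) (e := b) (r := rB) (c := x ^^^ c) (Or.inr rfl)
      (by simpa using t36) (by simpa [t7] using hrB) hrBn (by simp)
      (Nat.xor_lt_two_pow hxn hcn)).mono fun υ hfu hu => ?_)
    have hu24 : υ.nat 24 0 = s := by
      rw [hu, hM, hs, ← t9]; rfl
    have hυf := (((hfr.setNat (a := 38) (by decide) 0 i).setNat (a := 39) (by decide) 0 c).setNat
      (a := 23) (by decide) 0 (x ^^^ c)).andThen hfu (by decide) (by decide)
    have hυe : Env D T υ := hσ.frame hυf (by decide)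
    have hu38 : υ.nat 38 0 = i := by rw [hfu.nat 38 (by decide)]; simp
    have hu39 : υ.nat 39 0 = c := by rw [hfu.nat 39 (by decide)]; simp
    have hu3 : υ.cpx 3 = τ.cpx 3 := hfu.cpx 3 (by decide)
    refine Ex.seq (Ex.set 0 s rfl (by simp [hu24]) (small_of_lt (hs_lt.trans_le hRBn)) ?_)
    refine Ex.seq (Ex.set 0 c rfl (by simp [hu39]) (small_of_lt hcn) ?_)
    have hυe1 := (hυe.setNat (a := 41) (by norm_num) 0 s).setNat (a := 23) (by norm_num) 0 c
    have u7 : υ.nat 7 = σ.nat 7 := hυf.nat 7 (by decide)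
    have u9 : υ.nat 9 = σ.nat 9 := hυf.nat 9 (by decide)
    have u26 : υ.nat 26 0 = e := by rw [hυf.nat 26 (by decide), h26]
    refine Ex.seq ((coords_spec hυe1 (s := 26) (e := e) (r := r) (c := c) (Or.inl rfl)
      (by simpa using u26) (by simpa [u7] using hr) hrn (by simp) hcn).mono fun φ hfp hp => ?_)
    have hp24 : φ.nat 24 0 = d := by
      rw [hp, hM, hd, ← u9]; rfl
    have hφf := ((hυf.setNat (a := 41) (by decide) 0 s).setNat (a := 23) (by decide) 0 c).andThen
      hfp (by decide) (by decide)
    have hφe : Env D T φ := hσ.frame hφf (by decide)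
    have p9 : φ.nat 9 = σ.nat 9 := hφf.nat 9 (by decide)
    have p35 : φ.nat 35 0 = a := by rw [hφf.nat 35 (by decide), h35]
    have p38 : φ.nat 38 0 = i := by rw [hfp.nat 38 (by decide)]; simpa using hu38
    have p39 : φ.nat 39 0 = c := by rw [hfp.nat 39 (by decide)]; simpa using hu39
    have p41 : φ.nat 41 0 = s := by rw [hfp.nat 41 (by decide)]; simp
    have p3 : φ.cpx 3 = τ.cpx 3 := by rw [hfp.cpx 3 (by decide), ← hu3]; rfl
    refine Ex.seq (Ex.set 0 (y &&& c) rfl ?_ (small_of_lt (Nat.and_le_right.trans_lt hcn)) ?_)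
    · simp [p35, p38, p39, p9, hφe.m_eq, hM', hy]
    have hφe1 := hφe.setNat (a := 20) (by norm_num) 0 (y &&& c)
    refine Ex.seq ((parity_spec hφe1 (a := y) (c := c) (by simp)).mono fun ψ hfs hψ => ?_)
    have hψf := (hφf.setNat (a := 20) (by decide) 0 (y &&& c)).andThen hfs (by decide) (by decide)
    have hψe : Env D T ψ := hσ.frame hψf (by decide)
    have s24 : ψ.nat 24 0 = d := by rw [hfs.nat 24 (by decide)]; simpa using hp24
    have s26 : ψ.nat 26 0 = e := by rw [hψf.nat 26 (by decide), h26]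
    have s35 : ψ.nat 35 0 = a := by rw [hψf.nat 35 (by decide), h35]
    have s36 : ψ.nat 36 0 = b := by rw [hψf.nat 36 (by decide), h36]
    have s38 : ψ.nat 38 0 = i := by rw [hfs.nat 38 (by decide)]; simpa using p38
    have s41 : ψ.nat 41 0 = s := by rw [hfs.nat 41 (by decide)]; simpa using p41
    have k1 : ψ.cpx 1 = σ.cpx 1 := hψf.cpx 1 (by decide)
    have k2 : ψ.cpx 2 = σ.cpx 2 := hψf.cpx 2 (by decide)
    have k3 : ψ.cpx 3 = τ.cpx 3 := by rw [hfs.cpx 3 (by decide), ← p3]; rfl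
    refine accumulate_spec hψe hM (e := e) (d := d)
      (xv := σ.cpx 1 (i * M + a) * σ.cpx 2 (s * M + b)) s26 hψ (by simpa using s24) ?_ ?_
    · simp [s35, s36, s38, s41, k1, k2, hψe.m_eq, hM']
    · refine hS.step (d := d) heM
        (x := σ.cpx 1 (i * M + a) * σ.cpx 2 (s * M + b) * sgn (dot (vec n y) (vec n c))) ?_ ?_
      · funext l
        simp [k3]
      · intro t ht
        simp only [hF, hii, hjj, pA i hi, hc, hx, hy, ← vec_xor, hlook, ← hd]
  · intro τ hS _
    refine ⟨fun t ht => ?_, hS.other⟩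
    rw [hr] at ht ⊢
    -- Exactly one representative has frequency `t`, so of the accumulated double sum only its row
    -- remains.
    obtain ⟨j, hj, hjt⟩ := Enum.coord_surj eE eE' ht
    rw [hS.sum t ht, hW, zero_add, sum_range_mul_eq (2 ^ rA) (2 ^ r) fun i j => F i j t,
      Finset.sum_eq_single j]
    · simp only [hF, hjt, if_true]
      have hc := eE'.mem j hj
      rw [← Enum.dual_union D.phase eA hAB hc, Enum.dual_eq D.phase eE hc]
      refine Finset.sum_congr rfl fun s hs => ?_
      rw [eE.dot_eq (by simpa using hs), hjt]
    · intro k hk hkj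
      refine Finset.sum_eq_zero fun i _ => ?_
      rw [hF]
      exact if_neg fun h => hkj (Enum.coord_inj eE eE' (by simpa using hk) hj (h.trans hjt.symm))
    · intro h
      exact absurd (Finset.mem_range.2 hj) h

end Specs

/-! ## Computing the data of a tree edge -/

/-- Turns the working entries of the slot in variable 26, which are partial sums, into the data. -/
def finishPart : Program := .setCpx 4 0 .one ;; walshProgram ;; copyLayers 1 2

/-- Turns the working entries of the slot in variable 26, which are transformed partial sums, into
the data. -/
def finishDual : Program := scaleProgram ;; walshProgram ;; copyLayers 2 1

/-- Lists the boundaries for the set in variable 27 and for its complement. -/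
def buildBoth : Program :=
  .setNat 6 (var 26) (var 27) ;; build ;;
  .setNat 26 0 (var 26 + mm * mm) ;;
  .setNat 27 0 (.load 4 nn - 1 - var 27) ;;
  build ;;
  .setNat 26 0 (var 26 - mm * mm)

/-- Computes the data of the edge in variable 26 from those in variables 35 and 36. -/
def edgeStep : Program :=
  .setNat 27 0 (.load 6 (var 35) ^^^ .load 6 (var 36)) ;;
  buildBoth ;;
  .ite (.op .lt (.load 7 (var 26)) (.load 7 (var 36)))
    (combineDual ;; finishDual) (combinePart ;; finishPart) ;;
  .setNat 8 (var 26) 1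

/-- Adds a number to the working entry of the boundary `y`. -/
abbrev addAt (y : NatExpr) (x : CpxExpr) : Program :=
  .setCpx 3 (adr (var 26) (.load 11 (adr (var 26) y) - 1))
    (.add (.load 3 (adr (var 26) (.load 11 (adr (var 26) y) - 1))) x)

/-- Computes the data of the edge in variable 26 that cuts off the leaf of the spider in
variable 42. -/
def leafStep : Program :=
  .setNat 27 0 (.load 4 (var 42)) ;;
  buildBoth ;;
  addAt 0 .one ;;
  addAt (.load 5 (var 42) &&& (.load 4 nn - 1 - .load 6 (var 26))) (.expAngle (var 42)) ;;
  finishPart ;;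
  .setNat 8 (var 26) 1

section Specs

variable {n f : ℕ} {D : Diagram n} {T : BranchDecomposition n} {σ τ υ : State} {M : ℕ}

/-- Both states agree on the slot `e`. -/
structure SameSlot (M e : ℕ) (σ τ : State) : Prop where
  list : SameList M e σ τ
  mask : τ.nat 6 e = σ.nat 6 e
  done : τ.nat 8 e = σ.nat 8 e
  cpx : ∀ c ∈ [1, 2, 3], ∀ j, τ.cpx c (j * M + e) = σ.cpx c (j * M + e)

theorem SameSlot.trans {e : ℕ} (h₁ : SameSlot M e σ τ) (h₂ : SameSlot M e τ υ) :
    SameSlot M e σ υ :=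
  ⟨h₁.list.trans h₂.list, h₂.mask.trans h₁.mask, h₂.done.trans h₁.done,
    fun c hc j => (h₂.cpx c hc j).trans (h₁.cpx c hc j)⟩

theorem SameSlot.of_frame {ln lc : List ℕ} (h : Frame ln lc σ τ) {e : ℕ}
    (hl : ∀ a ∈ [6, 7, 8, 9, 10, 11], a ∉ ln)
    (hc : ∀ c ∈ [1, 2, 3], c ∈ lc → ∀ j, τ.cpx c (j * M + e) = σ.cpx c (j * M + e)) :
    SameSlot M e σ τ where
  list := .of_frame h fun a ha => hl a (by simp at ha ⊢; omega)
  mask := by rw [h.nat 6 (hl 6 (by simp))]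
  done := by rw [h.nat 8 (hl 8 (by simp))]
  cpx c hc' j := by
    by_cases hm : c ∈ lc
    · exact hc c hc' hm j
    · rw [h.cpx c hm]

theorem EdgeData.congr' {e : ℕ} {X : Set (Fin n)} (h : EdgeData D M σ e X)
    (hs : SameSlot M e σ τ) : EdgeData D M τ e X :=
  h.congr hs.list hs.mask fun c hc => hs.cpx c (by simp at hc ⊢; omega)

/-- The slots `e` and `e'` have not been used. -/
structure Fresh (M e e' : ℕ) (σ : State) : Prop where
  idx : ∀ y, σ.nat 11 (y * M + e) = 0
  idx' : ∀ y, σ.nat 11 (y * M + e') = 0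
  work : ∀ j, σ.cpx 3 (j * M + e) = 0

theorem Fresh.congr {e e' : ℕ} (h : Fresh M e e' σ) (hs : SameSlot M e σ τ)
    (hs' : SameSlot M e' σ τ) : Fresh M e e' τ where
  idx y := (hs.list.idx y).trans (h.idx y)
  idx' y := (hs'.list.idx y).trans (h.idx' y)
  work j := (hs.cpx 3 (by simp) j).trans (h.work j)

theorem finishPart_spec (hσ : Env D T σ) (hM : T.slots = M) {e : ℕ} {X : Set (Fin n)}
    (heM : e < M) (h26 : σ.nat 26 0 = e) (hmask : σ.nat 6 e = maskOf X)
    (hslot : Slot D.graph M σ e X X) (hf : 2 ^ cutRank D.graph X ≤ n * f)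
    (hW : ∀ j < 2 ^ σ.nat 7 e,
      σ.cpx 3 (j * M + e) = part D.graph D.phase X (vec n (σ.nat 9 (j * M + e)))) :
    Ex n f finishPart σ fun τ => EdgeData D M τ e X ∧
      ∀ e' < M, e' ≠ e → SameSlot M e' σ τ := by
  obtain ⟨r, hr⟩ : ∃ r, σ.nat 7 e = r := ⟨_, rfl⟩
  have hrn : r ≤ n := hr ▸ hslot.rk_le
  rw [← hslot.enum.rank_eq, hr] at hf
  refine Ex.seq (Ex.setC 0 1 rfl rfl ?_)
  have h0 := (Frame.refl [31, 32, 33] [4, 3, 1, 2] σ).setCpx (a := 4) (by decide) 0 1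
  refine Ex.seq ((walsh_spec (hσ.setCpx _ _ _) hM heM (by simpa using h26) (by simpa using hr) hrn
    hf).mono fun τ hft ht => ?_)
  have hτf := h0.andThen hft (by decide) (by decide)
  have hτ : Env D T τ := hσ.frame hτf (by decide)
  refine (copy_spec hτ hM (Or.inl ⟨rfl, rfl⟩) heM (by rw [hτf.nat 26 (by decide), h26])
    (by rw [hτf.nat 7 (by decide), hr]) hrn hf).mono fun υ hfu hu => ?_
  have hfu' : Frame [33, 33] [1, 2] τ υ := hfu
  have hυf := hτf.andThen hfu' (by decide) (by decide)
  have hz : τ.cpx 4 0 = 1 := by rw [hft.cpx 4 (by decide)]; simp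
  have w0 : ∀ j < 2 ^ r, τ.cpx 3 (j * M + e) = σ.cpx 3 (j * M + e) := fun j hj => by
    rw [ht.1 j hj]; simp
  refine ⟨⟨?_, ?_, ?_, ?_⟩, fun e' he' hne => ?_⟩
  · rw [hυf.nat 6 (by decide), hmask]
  · exact hslot.congr (.of_frame hυf (by decide))
  · rw [hυf.nat 7 (by decide), hυf.nat 9 (by decide), hr]
    intro j hj
    rw [hu.1 j hj, w0 j hj, hW j (hr ▸ hj)]
  · rw [hυf.nat 7 (by decide), hυf.nat 9 (by decide), hr]
    intro t htr
    rw [hu.2.1 t htr, ht.2.1 t htr, hz, one_mul, walsh_eq _ htr]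
    refine Finset.sum_congr rfl fun s hs => ?_
    have := hW s (by rw [hr]; simpa using hs)
    simp [this]
  · refine .of_frame hυf (by decide) fun c hc _ j => ?_
    simp only [List.mem_cons, List.not_mem_nil, or_false] at hc
    rcases hc with rfl | rfl | rfl
    · rw [hu.2.2 e' he' hne 1 (by simp), hft.cpx 1 (by decide)]; simp
    · rw [hu.2.2 e' he' hne 2 (by simp), hft.cpx 2 (by decide)]; simp
    · rw [hfu'.cpx 3 (by decide), ht.2.2 e' he' hne]; simp

/-- The working entries are a transform; transforming once more gives `2 ^ r` times the table, and
the scale removes that factor. -/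
theorem finishDual_spec (hσ : Env D T σ) (hM : T.slots = M) {e : ℕ} {X : Set (Fin n)}
    (heM : e < M) (h26 : σ.nat 26 0 = e) (hmask : σ.nat 6 e = maskOf X)
    (hslot : Slot D.graph M σ e X X) (hf : 2 ^ cutRank D.graph X ≤ n * f)
    (hW : ∀ t < 2 ^ σ.nat 7 e, σ.cpx 3 (t * M + e) = ∑ s ∈ Finset.range (2 ^ σ.nat 7 e),
      part D.graph D.phase X (vec n (σ.nat 9 (s * M + e))) * sgn (bitDot (σ.nat 7 e) s t)) :
    Ex n f finishDual σ fun τ => EdgeData D M τ e X ∧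
      ∀ e' < M, e' ≠ e → SameSlot M e' σ τ := by
  obtain ⟨r, hr⟩ : ∃ r, σ.nat 7 e = r := ⟨_, rfl⟩
  have hrn : r ≤ n := hr ▸ hslot.rk_le
  rw [← hslot.enum.rank_eq, hr] at hf
  rw [hr] at hW
  refine Ex.seq ((scale_spec h26 hr hrn).mono fun φ hfp hp => ?_)
  have hφf := (Frame.refl [34, 31, 32, 33] [4, 3, 1, 2] σ).andThen hfp (by decide) (by decide)
  have hφ : Env D T φ := hσ.frame hφf (by decide)
  refine Ex.seq ((walsh_spec hφ hM heM (by rw [hφf.nat 26 (by decide), h26])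
    (by rw [hφf.nat 7 (by decide), hr]) hrn hf).mono fun τ hft ht => ?_)
  have hτf := hφf.andThen hft (by decide) (by decide)
  have hτ : Env D T τ := hσ.frame hτf (by decide)
  refine (copy_spec hτ hM (Or.inr ⟨rfl, rfl⟩) heM (by rw [hτf.nat 26 (by decide), h26])
    (by rw [hτf.nat 7 (by decide), hr]) hrn hf).mono fun υ hfu hu => ?_
  have hfu' : Frame [33, 33] [2, 1] τ υ := hfu
  have hυf := hτf.andThen hfu' (by decide) (by decide)
  have hz : τ.cpx 4 0 * 2 ^ r = 1 := by rw [hft.cpx 4 (by decide), hp]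
  have w0 : ∀ j < 2 ^ r, τ.cpx 3 (j * M + e) = σ.cpx 3 (j * M + e) := fun j hj => by
    rw [ht.1 j hj, hfp.cpx 3 (by decide)]
  refine ⟨⟨?_, ?_, ?_, ?_⟩, fun e' he' hne => ?_⟩
  · rw [hυf.nat 6 (by decide), hmask]
  · exact hslot.congr (.of_frame hυf (by decide))
  · rw [hυf.nat 7 (by decide), hυf.nat 9 (by decide), hr]
    intro j hj
    rw [hu.2.1 j hj, ht.2.1 j hj,
      walsh_walsh (fun s => part D.graph D.phase X (vec n (σ.nat 9 (s * M + e)))) _ hj,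
      ← mul_assoc, hz, one_mul]
    intro t ht'
    simp only [hfp.cpx 3 (by decide)]
    exact hW t ht'
  · rw [hυf.nat 7 (by decide), hυf.nat 9 (by decide), hr]
    intro t htr
    rw [hu.1 t htr, w0 t htr, hW t htr]
  · refine .of_frame hυf (by decide) fun c hc _ j => ?_
    simp only [List.mem_cons, List.not_mem_nil, or_false] at hc
    rcases hc with rfl | rfl | rfl
    · rw [hu.2.2 e' he' hne 1 (by simp), hft.cpx 1 (by decide), hfp.cpx 1 (by decide)]
    · rw [hu.2.2 e' he' hne 2 (by simp), hft.cpx 2 (by decide), hfp.cpx 2 (by decide)]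
    · rw [hfu'.cpx 3 (by decide), ht.2.2 e' he' hne, hfp.cpx 3 (by decide)]

/-- The complement gets the companion slot `e + T.size * T.size`, which explains the two slots per
pair of nodes. Its representatives are the outside assignments needed by `combineDual`. -/
theorem buildBoth_spec (hσ : Env D T σ) (hM : T.slots = M) {e : ℕ} {X : Set (Fin n)}
    (heM : e < T.size * T.size) (h26 : σ.nat 26 0 = e) (h27 : σ.nat 27 0 = maskOf X)
    (hfresh : Fresh M e (e + T.size * T.size) σ) (hf : 2 ^ cutRank D.graph X ≤ n * f) :
    Ex n f buildBoth σ fun τ => τ.nat 26 0 = e ∧ τ.nat 6 e = maskOf X ∧ Slot D.graph M τ e X X ∧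
      Slot D.graph M τ (e + T.size * T.size) Xᶜ Xᶜ ∧
      ∀ e' < M, e' ≠ e → e' ≠ e + T.size * T.size → SameSlot M e' σ τ := by
  refine Ex.assume fun hn _ _ => ?_
  have hM' : T.size * T.size * 2 = M := hM
  have hmn : T.size * T.size < 2 ^ (4 * n) := by
    have h1 : T.size < 2 ^ (2 * n) := by
      have := T.size_eq
      exact lt_of_lt_of_le (by omega : T.size < 2 * n) (Nat.lt_two_pow_self).le
    calc T.size * T.size < 2 ^ (2 * n) * 2 ^ (2 * n) := Nat.mul_lt_mul'' h1 h1
      _ = 2 ^ (4 * n) := by ring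
  have hes : e + T.size * T.size < 2 ^ (10 * n) := by
    refine lt_small (k := 5) (by norm_num) ?_
    calc e + T.size * T.size < 2 ^ (4 * n) * 2 := by omega
      _ ≤ 2 ^ (4 * n) * 2 ^ n := Nat.mul_le_mul_left _ (Nat.le_self_pow (by omega) 2)
      _ = 2 ^ (5 * n) := by ring
  have hms := small_of_lt (maskOf_lt X)
  refine Ex.seq (Ex.set e (maskOf X) (by simpa using h26) (by simpa using h27) hms ?_)
  have hσ1 := hσ.setNat (a := 6) (by norm_num) e (maskOf X)
  have f1 := (Frame.refl (6 :: 26 :: 27 :: build.writesNat) [] σ).setNat (a := 6) (by decide) e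
    (maskOf X)
  refine Ex.seq ((build_spec hσ1 hM hf (e := e) (by omega) (by simpa using h26)
    (by simpa using h27) (by simpa using hfresh.idx)).mono fun τ hft ht => ?_)
  have hτf := f1.andThen hft (by decide) (by decide)
  have hτ : Env D T τ := hσ.frame hτf (by decide)
  have t26 : τ.nat 26 0 = e := by rw [hft.nat 26 (by decide)]; simpa using h26
  have t27 : τ.nat 27 0 = maskOf X := by rw [hft.nat 27 (by decide)]; simpa using h27
  have t6 : τ.nat 6 = (σ.setNat 6 e (maskOf X)).nat 6 := hft.nat 6 (by decide)
  refine Ex.seq (Ex.set 0 (e + T.size * T.size) rfl (by simp [t26, hτ.m_eq]) hes ?_)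
  refine Ex.seq (Ex.set 0 (maskOf Xᶜ) rfl ?_ (small_of_lt (maskOf_lt _)) ?_)
  · simp [t27, hτ.n_eq, hτ.pow n le_rfl, maskOf_compl]
  have hτ1 := (hτ.setNat (a := 26) (by norm_num) 0 (e + T.size * T.size)).setNat (a := 27)
    (by norm_num) 0 (maskOf Xᶜ)
  have f2 := (hτf.setNat (a := 26) (by decide) 0 (e + T.size * T.size)).setNat (a := 27)
    (by decide) 0 (maskOf Xᶜ)
  have hl1 : ∀ e', SameList M e' τ ((τ.setNat 26 0 (e + T.size * T.size)).setNat 27 0 (maskOf Xᶜ)) :=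
    fun e' => (SameList.setNat _ _ _ _ _ (by decide)).trans (SameList.setNat _ _ _ _ _ (by decide))
  refine Ex.seq ((build_spec hτ1 hM (X := Xᶜ) (by rwa [cutRank_compl])
    (e := e + T.size * T.size) (by omega) (by simp) (by simp) ?_).mono fun υ hfu hu => ?_)
  · intro y
    rw [(hl1 _).idx, (ht.2 (e + T.size * T.size) (by omega) (by omega)).idx]
    simpa using hfresh.idx' y
  have hυf := f2.andThen hfu (by decide) (by decide)
  have hυ : Env D T υ := hσ.frame hυf (by decide)
  have u26 : υ.nat 26 0 = e + T.size * T.size := by rw [hfu.nat 26 (by decide)]; simp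
  have u6 : υ.nat 6 = (σ.setNat 6 e (maskOf X)).nat 6 := by
    rw [hfu.nat 6 (by decide), ← t6]; rfl
  refine Ex.set 0 e rfl (by simp [u26, hυ.m_eq]) (by omega) ⟨by simp, ?_, ?_, ?_, ?_⟩
  · simp [u6]
  · exact ht.1.congr (((hl1 e).trans (hu.2 e (by omega) (by omega))).trans
      (SameList.setNat _ _ _ _ _ (by decide)))
  · exact hu.1.congr (SameList.setNat _ _ _ _ _ (by decide))
  · intro e' he' hne hne'
    refine ⟨((((SameList.setNat _ _ _ _ _ (by decide)).trans (ht.2 e' he' hne)).trans (hl1 e')).trans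
      (hu.2 e' he' hne')).trans (SameList.setNat _ _ _ _ _ (by decide)), ?_, ?_, ?_⟩
    · simp [u6, hne]
    · simp [hυf.nat 8 (by decide)]
    · intro c _ j
      simp [hυf.cpx c (by simp)]

end Specs

/-! ### The data of a tree edge at an inner node and at a leaf -/

section Specs

variable {n f : ℕ} {D : Diagram n} {T : BranchDecomposition n} {σ τ υ : State} {M : ℕ}

theorem SameSlot.setNat {e : ℕ} (σ : State) {a : ℕ} (i x : ℕ) (ha : a ∉ [6, 7, 8, 9, 10, 11]) :
    SameSlot M e σ (σ.setNat a i x) :=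
  .of_frame ((Frame.refl [a] [] σ).setNat (by simp) i x)
    (fun b hb h => ha (by simp at h; exact h ▸ hb)) (by simp)

theorem SameSlot.setDone {e e' : ℕ} (σ : State) (x : ℕ) (h : e' ≠ e) :
    SameSlot M e' σ (σ.setNat 8 e x) :=
  ⟨SameList.setNat _ _ _ _ _ (by decide), by simp, by simp [h], by simp⟩

theorem EdgeData.setDone {e : ℕ} {X : Set (Fin n)} (h : EdgeData D M σ e X) (i x : ℕ) :
    EdgeData D M (σ.setNat 8 i x) e X :=
  h.congr (SameList.setNat _ _ _ _ _ (by decide)) (by simp) (by simp)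

/-- Since `A` has the smaller cut-rank, the least of the three sums is that of `A` with the smaller
of `B` and `A ∪ B`, and the test selects the corresponding combination. In `hf` the bound is stated
for every `k` below all three sums, so that it covers the selected sum and also the cut-rank of the
union. -/
theorem edgeStep_spec (hσ : Env D T σ) (hM : T.slots = M) {a b e : ℕ} {A B : Set (Fin n)}
    (hA : EdgeData D M σ a A) (hB : EdgeData D M σ b B) (hAB : Disjoint A B)
    (ha : a < T.size * T.size) (hb : b < T.size * T.size) (he : e < T.size * T.size)
    (hae : a ≠ e) (hbe : b ≠ e) (h35 : σ.nat 35 0 = a) (h36 : σ.nat 36 0 = b)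
    (h26 : σ.nat 26 0 = e) (hfresh : Fresh M e (e + T.size * T.size) σ)
    (hle : cutRank D.graph A ≤ cutRank D.graph B)
    (hf : ∀ k, k ≤ cutRank D.graph A + cutRank D.graph B →
      k ≤ cutRank D.graph A + cutRank D.graph (A ∪ B) →
      k ≤ cutRank D.graph B + cutRank D.graph (A ∪ B) → 2 ^ k ≤ f) :
    Ex n f edgeStep σ fun τ => EdgeData D M τ e (A ∪ B) ∧ τ.nat 8 e = 1 ∧
      ∀ e' < M, e' ≠ e → e' ≠ e + T.size * T.size → SameSlot M e' σ τ := by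
  refine Ex.assume fun hn _ _ => ?_
  have hM' : T.size * T.size * 2 = M := hM
  -- Subadditivity is needed only for the first of the three comparisons; the other two sums contain
  -- this cut-rank as a summand.
  have hfX : 2 ^ cutRank D.graph (A ∪ B) ≤ f :=
    hf _ (cutRank_union_le D.graph A B) (by omega) (by omega)
  have hfX' : 2 ^ cutRank D.graph (A ∪ B) ≤ n * f :=
    hfX.trans (Nat.le_mul_of_pos_left _ (by omega))
  have hmX := maskOf_lt (A ∪ B)
  refine Ex.seq (Ex.set 0 (maskOf (A ∪ B)) rfl ?_ (small_of_lt hmX) ?_)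
  · simp [h35, h36, hA.mask, hB.mask, maskOf_union hAB]
  have hs1 : ∀ e', SameSlot M e' σ (σ.setNat 27 0 (maskOf (A ∪ B))) := fun e' =>
    SameSlot.setNat σ _ _ (by decide)
  have f1 := (Frame.refl (27 :: buildBoth.writesNat) [] σ).setNat (a := 27) (by decide) 0
    (maskOf (A ∪ B))
  refine Ex.seq ((buildBoth_spec (hσ.setNat (a := 27) (by norm_num) _ _) hM he (by simpa using h26)
    (by simp) (hfresh.congr (hs1 _) (hs1 _)) hfX').mono fun τ hft ht => ?_)
  have hτf := f1.andThen hft (by decide) (by decide)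
  have hτ : Env D T τ := hσ.frame hτf (by decide)
  obtain ⟨t26, t6, tX, tX', tsame⟩ := ht
  have t35 : τ.nat 35 0 = a := by rw [hτf.nat 35 (by decide), h35]
  have t36 : τ.nat 36 0 = b := by rw [hτf.nat 36 (by decide), h36]
  have hs2 : ∀ e' < M, e' ≠ e → e' ≠ e + T.size * T.size → SameSlot M e' σ τ :=
    fun e' he' h h' => (hs1 e').trans (tsame e' he' h h')
  have tA := hA.congr' (hs2 a (by omega) hae (by omega))
  have tB := hB.congr' (hs2 b (by omega) hbe (by omega))
  have tW : ∀ j, τ.cpx 3 (j * M + e) = 0 := fun j => by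
    rw [hτf.cpx 3 (by decide), hfresh.work]
  have rA := tA.slot.enum.rank_eq
  have rB := tB.slot.enum.rank_eq
  have rX := tX.enum.rank_eq
  have hsum : 2 ^ cutRank D.graph A * 2 ^ cutRank D.graph (A ∪ B) =
    2 ^ (cutRank D.graph A + cutRank D.graph (A ∪ B)) := by rw [pow_add]
  have hsum' : 2 ^ cutRank D.graph A * 2 ^ cutRank D.graph B =
    2 ^ (cutRank D.graph A + cutRank D.graph B) := by rw [pow_add]
  have hlast : ∀ υ : State, (EdgeData D M υ e (A ∪ B) ∧
      ∀ e' < M, e' ≠ e → e' ≠ e + T.size * T.size → SameSlot M e' σ υ) → υ.nat 26 0 = e →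
      Ex n f (.setNat 8 (var 26) 1) υ fun τ => EdgeData D M τ e (A ∪ B) ∧ τ.nat 8 e = 1 ∧
        ∀ e' < M, e' ≠ e → e' ≠ e + T.size * T.size → SameSlot M e' σ τ := by
    rintro υ ⟨u1, u2⟩ u3
    refine Ex.set e 1 (by simpa using u3) rfl (two_lt_small hn (by norm_num))
      ⟨u1.setDone _ _, by simp, fun e' he' h h' => (u2 e' he' h h').trans (.setDone _ _ h)⟩
  refine Ex.seq (Ex.cond (if cutRank D.graph (A ∪ B) < cutRank D.graph B then 1 else 0)
    (by simp [t26, t36, rX, rB]) ?_ ?_)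
  · intro h
    have hlt : cutRank D.graph (A ∪ B) < cutRank D.graph B := by
      by_contra h'
      exact h (if_neg h')
    refine Ex.seq ((combineDual_spec hτ hM tA tB hAB tX tX' (by omega) t35 t36 t26 tW
      (by rw [rA, rX, hsum]; exact hf _ (by omega) le_rfl (by omega))).mono fun υ hfu hu => ?_)
    have u26 : υ.nat 26 0 = e := by rw [hfu.nat 26 (by decide), t26]
    have u7 : υ.nat 7 = τ.nat 7 := hfu.nat 7 (by decide)
    have u9 : υ.nat 9 = τ.nat 9 := hfu.nat 9 (by decide)
    refine (finishDual_spec (hτ.frame hfu (by decide)) hM (by omega) u26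
      (by rw [hfu.nat 6 (by decide), t6]) (tX.congr (.of_frame hfu (by decide))) hfX'
      (by rw [u7, u9]; exact hu.1)).mono fun φ hfp hp => ?_
    refine hlast φ ⟨hp.1, fun e' he' h1 h2 => ((hs2 e' he' h1 h2).trans ?_).trans (hp.2 e' he' h1)⟩
      (by rw [hfp.nat 26 (by decide), u26])
    refine .of_frame hfu (by decide) fun c _ hc j => ?_
    obtain rfl : c = 3 := by simpa [combineDual, coords, parity, accumulate, Program.forLt,
      Program.writesCpx] using hc
    exact hu.2 e' he' h1 j
  · intro h
    have hge : ¬ cutRank D.graph (A ∪ B) < cutRank D.graph B := fun h' => by simp [h'] at h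
    refine Ex.seq ((combinePart_spec hτ hM tA tB hAB t6 tX (by omega) t35 t36 t26 tW
      (by rw [rA, rB, hsum']; exact hf _ le_rfl (by omega) (by omega))).mono fun υ hfu hu => ?_)
    have u26 : υ.nat 26 0 = e := by rw [hfu.nat 26 (by decide), t26]
    have u7 : υ.nat 7 = τ.nat 7 := hfu.nat 7 (by decide)
    have u9 : υ.nat 9 = τ.nat 9 := hfu.nat 9 (by decide)
    refine (finishPart_spec (hτ.frame hfu (by decide)) hM (by omega) u26
      (by rw [hfu.nat 6 (by decide), t6]) (tX.congr (.of_frame hfu (by decide))) hfX'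
      (by rw [u7, u9]; exact hu.1)).mono fun φ hfp hp => ?_
    refine hlast φ ⟨hp.1, fun e' he' h1 h2 => ((hs2 e' he' h1 h2).trans ?_).trans (hp.2 e' he' h1)⟩
      (by rw [hfp.nat 26 (by decide), u26])
    refine .of_frame hfu (by decide) fun c _ hc j => ?_
    obtain rfl : c = 3 := by simpa [combinePart, parity, accumulate, Program.forLt,
      Program.writesCpx] using hc
    exact hu.2 e' he' h1 j

theorem Slot.exists_index {e : ℕ} {S X : Set (Fin n)} {G : SimpleGraph (Fin n)}
    (h : Slot G M σ e S X) {p : ℕ} (hp : p < 2 ^ n) {z : Fin n → ZMod 2} (hz : z ∈ supp S)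
    (hpz : vec n p = bd G X z) :
    ∃ d < 2 ^ σ.nat 7 e, σ.nat 11 (p * M + e) = d + 1 ∧ ∀ j < 2 ^ σ.nat 7 e,
      vec n p = vec n (σ.nat 9 (j * M + e)) ↔ d = j := by
  obtain ⟨d, hd, hdz⟩ := h.enum.surj z hz
  have hdp : σ.nat 9 (d * M + e) = p := vec_inj (h.y_lt d hd) hp (by rw [hdz, hpz])
  refine ⟨d, hd, by rw [← hdp]; exact h.idx d hd, fun j hj => ⟨fun hj' => ?_, ?_⟩⟩
  · exact h.enum.inj d hd j hj (by rw [← hj', hdz, hpz])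
  · rintro rfl
    rw [hdp]

/-- A single spider has two assignments, contributing `1` at the boundary `0` and its phase at the
boundary given by its neighbours. Its cut-rank is at most `1`, so no assumption on `f` is needed. -/
theorem leafStep_spec (hσ : Env D T σ) (hM : T.slots = M) {e : ℕ} {x : Fin n}
    (he : e < T.size * T.size) (h42 : σ.nat 42 0 = x) (h26 : σ.nat 26 0 = e)
    (hfresh : Fresh M e (e + T.size * T.size) σ) :
    Ex n f leafStep σ fun τ => EdgeData D M τ e {x} ∧ τ.nat 8 e = 1 ∧
      ∀ e' < M, e' ≠ e → e' ≠ e + T.size * T.size → SameSlot M e' σ τ := by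
  refine Ex.assume fun hn hf _ => ?_
  have hM' : T.size * T.size * 2 = M := hM
  have hM0 : M ≠ 0 := by omega
  have hfX : 2 ^ cutRank D.graph {x} ≤ n * f := by
    have := two_pow_cutRank_singleton_le D.graph x
    nlinarith
  have hmX := maskOf_lt ({x} : Set (Fin n))
  refine Ex.seq (Ex.set 0 (maskOf {x}) rfl ?_ (small_of_lt hmX) ?_)
  · simp [h42, hσ.pow x x.2.le, maskOf_singleton]
  have hs1 : ∀ e', SameSlot M e' σ (σ.setNat 27 0 (maskOf {x})) := fun e' =>
    SameSlot.setNat σ _ _ (by decide)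
  have f1 := (Frame.refl (27 :: buildBoth.writesNat) [3] σ).setNat (a := 27) (by decide) 0
    (maskOf {x})
  refine Ex.seq ((buildBoth_spec (hσ.setNat (a := 27) (by norm_num) _ _) hM he (by simpa using h26)
    (by simp) (hfresh.congr (hs1 _) (hs1 _)) hfX).mono fun τ hft ht => ?_)
  have hτf := f1.andThen hft (by decide) (by decide)
  have hτ : Env D T τ := hσ.frame hτf (by decide)
  obtain ⟨t26, t6, tX, tX', tsame⟩ := ht
  have hs2 : ∀ e' < M, e' ≠ e → e' ≠ e + T.size * T.size → SameSlot M e' σ τ :=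
    fun e' he' h h' => (hs1 e').trans (tsame e' he' h h')
  have tW : ∀ j, τ.cpx 3 (j * M + e) = 0 := fun j => by
    rw [hft.cpx 3 (by decide)]
    simpa using hfresh.work j
  have t42 : τ.nat 42 0 = x := by rw [hτf.nat 42 (by decide), h42]
  obtain ⟨d₀, hd₀, hi₀, hy₀⟩ := tX.exists_index (p := 0) (by positivity) zero_mem_supp
    (by rw [vec_zero, bd_zero])
  rw [zero_mul, zero_add] at hi₀
  set p := maskOf (D.graph.neighborSet x) &&& maskOf ({x} : Set (Fin n))ᶜ with hp
  have hpn : p < 2 ^ n := Nat.and_le_left.trans_lt (maskOf_lt _)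
  have hpv : vec n p = bd D.graph {x} (Pi.single x 1) := by
    rw [hp, vec_and_maskOf_compl, vec_maskOf_neighborSet, bd]
  obtain ⟨d₁, hd₁, hi₁, hy₁⟩ := tX.exists_index hpn (Enum.single_mem_supp (Set.mem_singleton x)) hpv
  refine Ex.seq (Ex.setC (d₀ * M + e) 1 ?_ ?_ ?_)
  · simp [t26, hi₀, hτ.m_eq, hM']
  · simp [t26, hi₀, hτ.m_eq, hM', tW]
  -- For an isolated spider both boundaries are `0` and both contributions fall on the same entry,
  -- hence the case `d₀ = d₁`.
  refine Ex.seq (Ex.setC (d₁ * M + e) ((if d₀ = d₁ then 1 else 0) +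
    Complex.exp (D.phase x * Complex.I)) ?_ ?_ ?_)
  · simp [t26, t42, t6, hτ.row, hτ.n_eq, hτ.m_eq, hτ.pow n le_rfl,
      maskOf_compl, ← hp, hi₁, hM']
  · simp [t26, t42, t6, hτ.row, hτ.n_eq, hτ.m_eq, hτ.pow n le_rfl,
      maskOf_compl, ← hp, hi₁, hM', hτ.angle, tW, hM0, eq_comm]
  set φ := (τ.setCpx 3 (d₀ * M + e) 1).setCpx 3 (d₁ * M + e) ((if d₀ = d₁ then 1 else 0) +
    Complex.exp (D.phase x * Complex.I)) with hφ
  have hφe : Env D T φ := (hτ.setCpx _ _ _).setCpx _ _ _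
  have hl : ∀ e', SameList M e' τ φ := fun e' => .of_eq fun _ _ => rfl
  refine Ex.seq ((finishPart_spec hφe hM (e := e) (X := {x}) (by omega) t26 t6 (tX.congr (hl e)) hfX
    ?_).mono fun υ hfu hu => ?_)
  · intro j hj
    have e0 := hy₀ j hj
    have e1 := hy₁ j hj
    rw [vec_zero] at e0
    rw [part_singleton]
    simp only [hφ, State.setCpx_nat, ← hpv, e0, e1]
    simp [hM0, tW]
    by_cases h0 : j = d₁
    · subst h0
      simp
    · simp [h0, Ne.symm h0, eq_comm]
  · have u26 : υ.nat 26 0 = e := by rw [hfu.nat 26 (by decide)]; exact t26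
    refine Ex.set e 1 (by simpa using u26) rfl (two_lt_small hn (by norm_num))
      ⟨hu.1.setDone _ _, by simp, fun e' he' h h' => (((hs2 e' he' h h').trans ?_).trans
        (hu.2 e' he' h)).trans (.setDone _ _ h)⟩
    refine ⟨hl e', rfl, rfl, fun c _ j => ?_⟩
    have n1 : ∀ d, j * M + e' ≠ d * M + e := fun d h' => h ((addr_inj he' (by omega)).1 h').2
    simp [hφ, n1]

end Specs

/-! ## The complete program -/

/-- Tabulates the powers of two and the rows of the adjacency matrix. -/
def initProgram : Program :=
  .setNat 4 (.const 0) 1 ;;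
  .forLt 43 nn (.setNat 4 (var 43 + 1) (.load 4 (var 43) * 2)) ;;
  .forLt 44 (nn * nn)
    (.setNat 5 (var 44 / nn)
      (.load 5 (var 44 / nn) ^^^ (.load 1 (var 44) * .load 4 (var 44 % nn))))

/-- Processes the tree edges at the leaves. -/
def leafLoop : Program :=
  .forLt 44 (nn * mm)
    (.setNat 42 0 (var 44 / mm) ;;
      .setNat 26 0 (.load 3 (var 42) * mm + var 44 % mm) ;;
      .ite (.load 2 (var 26) * (1 - .load 8 (var 26))) leafStep .skip)

/-- The last condition for an edge to be processed. -/
abbrev ready : NatExpr :=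
  .load 8 (var 35) * .load 8 (var 36) * (1 - .load 8 (var 26)) *
    (1 - .op .lt (.load 7 (var 36)) (.load 7 (var 35)))

/-- Processes the other tree edges, from the leaves towards the interior. -/
def edgeLoop : Program :=
  .forLt 44 (mm * mm * mm * mm * mm)
    (.setNat 45 0 (var 44 / (mm * mm * mm) % mm) ;;
      .setNat 46 0 (var 44 / (mm * mm) % mm) ;;
      .setNat 47 0 (var 44 / mm % mm) ;;
      .setNat 48 0 (var 44 % mm) ;;
      .setNat 26 0 (var 45 * mm + var 46) ;;
      .setNat 35 0 (var 47 * mm + var 45) ;;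
      .setNat 36 0 (var 48 * mm + var 45) ;;
      .ite (.load 2 (var 26) * .load 2 (var 35) * .load 2 (var 36) *
          (1 - .op .eq (var 46) (var 47)) * (1 - .op .eq (var 46) (var 48)) *
          (1 - .op .eq (var 47) (var 48)))
        (.ite ready edgeStep .skip) .skip)

/-- Computes the sum over all assignments from the data of the edge at the first leaf. -/
def sumProgram : Program :=
  .forLt 44 mm
    (.setNat 26 0 (var 44 * mm + .load 3 (.const 0)) ;;
      .ite (.load 2 (var 26))
        (.setNat 23 0 1 ;;
          coords 26 ;;
          .setCpx 0 (.const 0) (.add (.load 2 (adr (var 26) 0))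
            (.mul (.expAngle (.const 0)) (.load 2 (adr (var 26) (var 24))))))
        .skip)

/-- Multiplies the output with the normalization of the Hadamard gates. -/
def normalizeProgram : Program :=
  .forLt 44 (nn * nn)
    (.ite (.load 1 (var 44) * .op .lt (var 44 / nn) (var 44 % nn))
      (.setCpx 0 (.const 0) (.mul (.load 0 (.const 0)) .invSqrtTwo)) .skip)

/-- The program that contracts a diagram along a rank-decomposition. -/
def contract : Program :=
  initProgram ;; leafLoop ;; edgeLoop ;; sumProgram ;; normalizeProgram

section Specs

variable {n f : ℕ} {D : Diagram n} {T : BranchDecomposition n} {σ τ υ : State} {M : ℕ}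

theorem adjacencyTable_apply {m : ℕ} (G : SimpleGraph (Fin m)) [DecidableRel G.Adj] (u v : Fin m) :
    adjacencyTable G (u * m + v) = if G.Adj u v then 1 else 0 := by
  have h : (∃ u' v' : Fin m, u.1 * m + v = u' * m + v' ∧ G.Adj u' v') ↔ G.Adj u v := by
    refine ⟨?_, fun h => ⟨u, v, rfl, h⟩⟩
    rintro ⟨u', v', h, ha⟩
    obtain ⟨h1, h2⟩ := (addr_inj v.2 v'.2).1 h
    rwa [Fin.ext h1, Fin.ext h2]
  simp only [adjacencyTable, h]

theorem adjacencyTable_ne_zero {m : ℕ} (G : SimpleGraph (Fin m)) (u v : Fin m) :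
    adjacencyTable G (u * m + v) ≠ 0 ↔ G.Adj u v := by
  classical
  rw [adjacencyTable_apply]
  simp

theorem size_le (T : BranchDecomposition n) (hn : 2 ≤ n) : T.size ≤ n ^ 2 := by
  have := T.size_eq
  nlinarith

theorem size_lt (T : BranchDecomposition n) : T.size < 2 ^ (2 * n) := by
  have := T.size_eq
  exact lt_of_lt_of_le (by omega : T.size < 2 * n) (Nat.lt_two_pow_self).le

theorem initProgram_spec (D : Diagram n) (T : BranchDecomposition n) :
    Ex n f initProgram (inputState D T) fun τ => Env D T τ := by
  refine Ex.assume fun hn hf _ => ?_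
  have hn0 : 0 < n := by omega
  have hnn : n < 2 ^ n := Nat.lt_two_pow_self
  refine Ex.seq (Ex.set 0 1 rfl rfl (two_lt_small hn (by norm_num)) ?_)
  set σ := (inputState D T).setNat 4 0 1 with hσ
  have s0 : σ.nat 0 0 = n := by simp [hσ, inputState]
  refine Ex.seq (Ex.forLt (f₁ := 1) (N := n) (fun k τ => ∀ i ≤ k, τ.nat 4 i = 2 ^ i) le_rfl
    (by nlinarith [Nat.le_self_pow (n := 12) (by norm_num) n]) (small_of_lt hnn) ?_ ?_ ?_ ?_)
  · intro k τ _ hfr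
    simp [hfr.nat 0 (by decide), s0]
  · intro i hi
    obtain rfl : i = 0 := by omega
    simp [hσ]
  · intro k τ hk hI hik hfr
    refine Ex.set (k + 1) (2 ^ (k + 1)) (by simp [hik]) (by simp [hik, hI k le_rfl, pow_succ])
      (Nat.pow_lt_pow_right (by simp) (by omega)) ?_
    · intro i hi
      rcases Nat.le_succ_iff.1 hi with hi | rfl
      · have : i ≠ k + 1 := by omega
        simp [this, hI i hi]
      · simp
  · intro τ hτ4 hτf
    have t0 : τ.nat 0 0 = n := by rw [hτf.nat 0 (by decide), s0]
    -- Digit `v` of row `u` is affected only by the iteration `u * n + v`, so there the exclusive or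
    -- simply sets the digit.
    refine Ex.forLt (f₁ := 1) (N := n * n) (fun k υ => ∀ u : Fin n, υ.nat 5 u < 2 ^ n ∧
      ∀ v : Fin n, (υ.nat 5 u).testBit v = true ↔ D.graph.Adj u v ∧ u.1 * n + v < k) le_rfl
      ?_ ?_ ?_ ?_ ?_ ?_
    · rw [mul_one, ← pow_two]
      exact (Nat.pow_le_pow_right (by omega) (by norm_num)).trans (Nat.le_mul_of_pos_right _ hf)
    · refine lt_small (k := 2) (by norm_num) ?_
      calc n * n < 2 ^ n * 2 ^ n := Nat.mul_lt_mul'' hnn hnn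
        _ = 2 ^ (2 * n) := by ring
    · intro k υ _ hfr
      simp [hfr.nat 0 (by decide), t0]
    · intro u
      have t5 : τ.nat 5 u = 0 := by rw [hτf.nat 5 (by decide)]; rfl
      simp [t5]
    · intro k υ hk hI hik hfr
      have u0 : υ.nat 0 0 = n := by rw [hfr.nat 0 (by decide), t0]
      have u1 : υ.nat 1 = adjacencyTable D.graph := by
        rw [hfr.nat 1 (by decide), hτf.nat 1 (by decide)]; rfl
      obtain ⟨u, hu⟩ : ∃ u : Fin n, k / n = u := ⟨⟨k / n, Nat.div_lt_of_lt_mul hk⟩, rfl⟩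
      obtain ⟨v, hv⟩ : ∃ v : Fin n, k % n = v := ⟨⟨k % n, Nat.mod_lt _ hn0⟩, rfl⟩
      have hkuv : u * n + v = k := by rw [← hu, ← hv, Nat.div_add_mod']
      have u4 : υ.nat 4 v = 2 ^ v.1 := by rw [hfr.nat 4 (by decide)]; exact hτ4 v v.2.le
      classical
      have hent : adjacencyTable D.graph k = if D.graph.Adj u v then 1 else 0 := by
        rw [← hkuv, adjacencyTable_apply]
      set x := υ.nat 5 u ^^^ (if D.graph.Adj u v then 1 else 0) * 2 ^ v.1 with hx
      have hxn : x < 2 ^ n := by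
        refine Nat.xor_lt_two_pow (hI u).1 ?_
        have := Nat.pow_lt_pow_right (a := 2) (by simp) v.2
        split_ifs <;> simp [this]
      refine Ex.set u x (by simp [hik, u0, hu]) (by simp [hik, u0, u1, u4, hu, hv, hent, hx])
        (small_of_lt hxn) fun w => ?_
      by_cases hwu : w = u
      · subst hwu
        refine ⟨by simpa using hxn, fun z => ?_⟩
        have hz := (hI w).2 z
        have hzv : w.1 * n + z < k + 1 ↔ w.1 * n + z < k ∨ z = v := by
          rw [← hkuv, Fin.ext_iff]; omega
        have hnot : z = v → ¬ w.1 * n + z < k := by rintro rfl; omega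
        simp only [State.setNat_nat, and_self, if_true, show (5 : ℕ) ≠ 44 by decide, false_and,
          if_false, hzv, hx, Nat.testBit_xor]
        have hvz : (2 ^ v.1).testBit z = decide (z = v) := by
          rw [Nat.testBit_two_pow]
          simp [Fin.ext_iff, eq_comm]
        by_cases ha : D.graph.Adj w v
        · simp only [ha, if_true, one_mul, hvz]
          by_cases hzv' : z = v
          · subst hzv'
            have : (υ.nat 5 w).testBit z = false := by
              rw [← Bool.not_eq_true, hz]
              exact fun h => hnot rfl h.2
            simp [this, ha]
          · simp [hzv', hz]
        · simp only [ha, if_false, zero_mul, Nat.zero_testBit, Bool.xor_false, hz]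
          constructor
          · exact fun h => ⟨h.1, Or.inl h.2⟩
          · rintro ⟨h1, h2 | rfl⟩
            · exact ⟨h1, h2⟩
            · exact absurd h1 ha
      · have hne : w.1 ≠ u := fun h => hwu (Fin.ext h)
        have hlt : ∀ z : Fin n, w.1 * n + z < k + 1 ↔ w.1 * n + z < k := by
          intro z
          have : w.1 * n + z ≠ k := by
            rw [← hkuv]
            exact fun h => hne ((addr_inj z.2 v.2).1 h).1
          omega
        simpa [hne, hlt] using hI w
    · intro υ hI hυf
      have hf : ∀ a < 4, υ.nat a = (inputState D T).nat a := by
        intro a ha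
        rw [hυf.nat a (by simp [Program.writesNat]; omega),
          hτf.nat a (by simp [Program.writesNat]; omega)]
        exact State.setNat_nat_ne _ _ _ (by omega)
      refine ⟨?_, ?_, ?_, ?_, ?_, ?_, ?_, ?_⟩
      · simp [hf 0 (by norm_num), inputState]
      · simp [hf 0 (by norm_num), inputState]
      · simp [hf 1 (by norm_num), inputState]
      · simp [hf 2 (by norm_num), inputState]
      · intro x
        simp [hf 3 (by norm_num), inputState]
      · intro i hi
        rw [hυf.nat 4 (by decide), hτ4 i hi]
      · intro v
        refine eq_maskOf (hI v).1 fun w => ?_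
        rw [(hI v).2 w, SimpleGraph.mem_neighborSet, and_iff_left]
        nlinarith [v.2, w.2]
      · intro v
        rw [hυf.angle, hτf.angle]
        simp [hσ, inputState]

end Specs

/-! ### Bookkeeping of the processed tree edges -/

section Specs

variable {n f : ℕ} {D : Diagram n} {T : BranchDecomposition n} {σ τ υ : State} {M : ℕ}

/-- The slot of a tree edge. -/
def BranchDecomposition.slot (T : BranchDecomposition n) (u v : Fin T.size) : ℕ := u * T.size + v

theorem slot_lt (u v : Fin T.size) : T.slot u v < T.size * T.size := by
  have h1 := u.2
  have h2 := v.2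
  rw [BranchDecomposition.slot]
  nlinarith

theorem slot_inj {u v u' v' : Fin T.size} (h : T.slot u v = T.slot u' v') : u = u' ∧ v = v' := by
  obtain ⟨h1, h2⟩ := (addr_inj v.2 v'.2).1 h
  exact ⟨Fin.ext h1, Fin.ext h2⟩

/-- Every tree edge has either been processed or not been touched. -/
structure Table (D : Diagram n) (T : BranchDecomposition n) (M : ℕ) (σ : State) : Prop where
  env : Env D T σ
  edge : ∀ u v, T.tree.Adj u v →
    σ.nat 8 (T.slot u v) = 1 ∧ EdgeData D M σ (T.slot u v) (T.side u v) ∨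
    σ.nat 8 (T.slot u v) = 0 ∧ Fresh M (T.slot u v) (T.slot u v + T.size * T.size) σ

theorem Table.congr (h : Table D T M σ) (hM : T.slots = M) (hτ : Env D T τ)
    (hs : ∀ e < M, SameSlot M e σ τ) : Table D T M τ where
  env := hτ
  edge u v huv := by
    have hM' : T.size * T.size * 2 = M := hM
    have hlt := slot_lt u v
    have h1 := hs (T.slot u v) (by omega)
    have h2 := hs (T.slot u v + T.size * T.size) (by omega)
    rw [h1.done]
    exact (h.edge u v huv).imp (fun h => ⟨h.1, h.2.congr' h1⟩) (fun h => ⟨h.1, h.2.congr h1 h2⟩)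

theorem Table.setNat (h : Table D T M σ) (hM : T.slots = M) {a : ℕ} (ha : 12 ≤ a) (i x : ℕ) :
    Table D T M (σ.setNat a i x) :=
  h.congr hM (h.env.setNat (by omega) i x) fun _ _ =>
    .setNat σ i x (by simp; omega)

theorem Table.data (h : Table D T M σ) {u v : Fin T.size} (huv : T.tree.Adj u v)
    (hd : σ.nat 8 (T.slot u v) ≠ 0) : EdgeData D M σ (T.slot u v) (T.side u v) := by
  rcases h.edge u v huv with h | h
  · exact h.2
  · exact absurd h.1 hd

theorem Table.fresh (h : Table D T M σ) {u v : Fin T.size} (huv : T.tree.Adj u v)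
    (hd : σ.nat 8 (T.slot u v) ≠ 1) :
    Fresh M (T.slot u v) (T.slot u v + T.size * T.size) σ := by
  rcases h.edge u v huv with h | h
  · exact absurd h.1 hd
  · exact h.2

theorem Table.update (h : Table D T M σ) (hM : T.slots = M) (hτ : Env D T τ) {u v : Fin T.size}
    (hdata : EdgeData D M τ (T.slot u v) (T.side u v)) (hdone : τ.nat 8 (T.slot u v) = 1)
    (hs : ∀ e' < M, e' ≠ T.slot u v → e' ≠ T.slot u v + T.size * T.size → SameSlot M e' σ τ) :
    Table D T M τ ∧ ∀ u' v', σ.nat 8 (T.slot u' v') = 1 → τ.nat 8 (T.slot u' v') = 1 := by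
  have hM' : T.size * T.size * 2 = M := hM
  refine ⟨⟨hτ, fun u' v' huv' => ?_⟩, fun u' v' hd => ?_⟩
  · have hlt := slot_lt u' v'
    have hlt' := slot_lt u v
    by_cases he : T.slot u' v' = T.slot u v
    · obtain ⟨rfl, rfl⟩ := slot_inj he
      exact Or.inl ⟨hdone, hdata⟩
    · have h1 := hs (T.slot u' v') (by omega) he (by omega)
      have h2 := hs (T.slot u' v' + T.size * T.size) (by omega) (by omega) (by omega)
      rw [h1.done]
      exact (h.edge u' v' huv').imp (fun h => ⟨h.1, h.2.congr' h1⟩)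
        (fun h => ⟨h.1, h.2.congr h1 h2⟩)
  · have hlt := slot_lt u' v'
    have hlt' := slot_lt u v
    by_cases he : T.slot u' v' = T.slot u v
    · rw [he, hdone]
    · rw [(hs (T.slot u' v') (by omega) he (by omega)).done, hd]

theorem initProgram_table (D : Diagram n) (T : BranchDecomposition n) :
    Ex n f initProgram (inputState D T) fun τ => Table D T M τ := by
  refine (initProgram_spec D T).mono fun τ hfr hτ => ⟨hτ, fun u v _ => Or.inr ⟨?_, ?_, ?_, ?_⟩⟩
  · rw [hfr.nat 8 (by decide)]; rfl
  · intro y; rw [hfr.nat 11 (by decide)]; rfl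
  · intro y; rw [hfr.nat 11 (by decide)]; rfl
  · intro y; rw [hfr.cpx 3 (by decide)]; rfl

theorem slot_small (u v : Fin T.size) : T.slot u v < 2 ^ (10 * n) := by
  refine lt_small (k := 4) (by norm_num) ((slot_lt u v).trans ?_)
  calc T.size * T.size < 2 ^ (2 * n) * 2 ^ (2 * n) := Nat.mul_lt_mul'' (size_lt T) (size_lt T)
    _ = 2 ^ (4 * n) := by ring

/-- The counter runs over all pairs of a spider and a tree node; adjacency is tested, so the
neighbour of a leaf need not be known. -/
theorem leafLoop_spec (hσ : Table D T M σ) (hM : T.slots = M) :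
    Ex n f leafLoop σ fun τ => Table D T M τ ∧
      ∀ x v, T.tree.Adj (T.leaf x).1 v → τ.nat 8 (T.slot (T.leaf x).1 v) = 1 := by
  refine Ex.assume fun hn hf _ => ?_
  have hm0 : 0 < T.size := T.size_pos
  refine Ex.forLt (f₁ := f) (N := n * T.size) (fun k τ => Table D T M τ ∧
    ∀ x v, T.tree.Adj (T.leaf x).1 v → x.1 * T.size + v < k →
      τ.nat 8 (T.slot (T.leaf x).1 v) = 1) hf ?_ ?_ ?_ ?_ ?_ ?_
  · refine loop_bound hn (k := 3) (by norm_num) ?_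
    calc n * T.size ≤ n * n ^ 2 := Nat.mul_le_mul_left _ (size_le T hn)
      _ = n ^ 3 := by ring
  · refine lt_small (k := 3) (by norm_num) ?_
    calc n * T.size < 2 ^ n * 2 ^ (2 * n) := Nat.mul_lt_mul'' Nat.lt_two_pow_self (size_lt T)
      _ = 2 ^ (3 * n) := by ring
  · intro k τ hI _
    simp [hI.1.env.n_eq, hI.1.env.m_eq]
  · exact ⟨hσ.setNat hM (by norm_num) _ _, by simp⟩
  · rintro k τ hk ⟨hτ, hdone⟩ hik -
    obtain ⟨x, hx⟩ : ∃ x : Fin n, k / T.size = x :=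
      ⟨⟨k / T.size, Nat.div_lt_of_lt_mul (by rwa [mul_comm])⟩, rfl⟩
    obtain ⟨v, hv⟩ : ∃ v : Fin T.size, k % T.size = v := ⟨⟨k % T.size, Nat.mod_lt _ hm0⟩, rfl⟩
    have hkxv : x * T.size + v = k := by rw [← hx, ← hv, Nat.div_add_mod']
    have hnext : ∀ υ : State, Table D T M υ →
        (∀ u' v', τ.nat 8 (T.slot u' v') = 1 → υ.nat 8 (T.slot u' v') = 1) →
        (T.tree.Adj (T.leaf x).1 v → υ.nat 8 (T.slot (T.leaf x).1 v) = 1) →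
        Table D T M (υ.setNat 44 0 (k + 1)) ∧
          ∀ x v, T.tree.Adj (T.leaf x).1 v → x.1 * T.size + v < k + 1 →
            (υ.setNat 44 0 (k + 1)).nat 8 (T.slot (T.leaf x).1 v) = 1 := by
      intro υ hυ hmono hnew
      refine ⟨hυ.setNat hM (by norm_num) _ _, fun x' v' hadj hlt => ?_⟩
      simp only [State.setNat_nat, show (8 : ℕ) ≠ 44 by decide, false_and, if_false]
      rcases Nat.lt_succ_iff_lt_or_eq.1 hlt with hlt | heq
      · exact hmono _ _ (hdone x' v' hadj hlt)
      · rw [← hkxv] at heq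
        obtain ⟨h1, h2⟩ := (addr_inj v'.2 v.2).1 heq
        rw [Fin.ext h1, Fin.ext h2] at hadj ⊢
        exact hnew hadj
    refine Ex.seq (Ex.set 0 x rfl (by simp [hik, hτ.env.m_eq, hx])
      (small_of_lt (x.2.trans Nat.lt_two_pow_self)) ?_)
    refine Ex.seq (Ex.set 0 (T.slot (T.leaf x).1 v) rfl ?_ (slot_small _ _) ?_)
    · simp [hik, hτ.env.m_eq, hτ.env.leaf, hv, BranchDecomposition.slot]
    have hτ1 := (hτ.setNat hM (a := 42) (by norm_num) 0 x).setNat hM (a := 26) (by norm_num) 0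
      (T.slot (T.leaf x).1 v)
    have hτ8 : ∀ e, ((τ.setNat 42 0 x).setNat 26 0 (T.slot (T.leaf x).1 v)).nat 8 e = τ.nat 8 e :=
      fun e => by simp
    set φ := (τ.setNat 42 0 x).setNat 26 0 (T.slot (T.leaf x).1 v) with hφ
    have hadj : adjacencyTable T.tree (T.slot (T.leaf x).1 v) ≠ 0 ↔ _ :=
      adjacencyTable_ne_zero T.tree (T.leaf x).1 v
    refine Ex.cond (adjacencyTable T.tree (T.slot (T.leaf x).1 v) *
      (1 - τ.nat 8 (T.slot (T.leaf x).1 v))) (by simp [hφ, hτ.env.adjT]) ?_ ?_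
    · intro hc
      have hxv := hadj.1 (left_ne_zero_of_mul hc)
      have h8 : φ.nat 8 (T.slot (T.leaf x).1 v) ≠ 1 := by
        rw [hτ8]
        intro h
        exact right_ne_zero_of_mul hc (by simp [h])
      refine (leafStep_spec (x := x) hτ1.env hM (slot_lt _ _) (by simp [hφ]) (by simp [hφ])
        (hτ1.fresh hxv h8)).mono fun υ hfu hu => ?_
      obtain ⟨h1, h2⟩ := hτ1.update hM (hτ1.env.frame hfu (by decide))
        (by rw [T.side_leaf x hxv]; exact hu.1) hu.2.1 hu.2.2
      exact hnext υ h1 (fun u' v' h => h2 u' v' (by rwa [hτ8])) fun _ => hu.2.1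
    · intro hc
      refine Ex.skip (hnext φ hτ1 (fun u' v' h => by rwa [hτ8]) fun hxv => ?_)
      rcases hτ1.edge _ _ hxv with h | h
      · exact h.1
      · rw [hτ8] at h
        rw [h.1] at hc
        exact absurd (by simpa using hc) (hadj.2 hxv)
  · rintro τ ⟨h1, h2⟩ _
    refine ⟨h1, fun x v hxv => h2 x v hxv ?_⟩
    have := x.2
    have := v.2
    nlinarith

end Specs

/-! ### The order of processing the inner tree edges -/

section Specs

variable {n f : ℕ} {D : Diagram n} {T : BranchDecomposition n} {σ τ υ : State} {M : ℕ}

/-- The edges from `u` to `v`, `w₁` and `w₂` are different, and their data can be combined. -/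
structure Joint (T : BranchDecomposition n) (u v w₁ w₂ : Fin T.size) : Prop where
  adj : T.tree.Adj u v
  adj₁ : T.tree.Adj u w₁
  adj₂ : T.tree.Adj u w₂
  ne₁ : v ≠ w₁
  ne₂ : v ≠ w₂
  ne : w₁ ≠ w₂

/-- The counter `k` stands for the nodes `u`, `v`, `w₁`, `w₂`. -/
structure Code (T : BranchDecomposition n) (k : ℕ) (u v w₁ w₂ : Fin T.size) : Prop where
  fst : k / (T.size * T.size * T.size) % T.size = u
  snd : k / (T.size * T.size) % T.size = v
  thd : k / T.size % T.size = w₁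
  fth : k % T.size = w₂

theorem Code.exists (T : BranchDecomposition n) (k : ℕ) : ∃ u v w₁ w₂, Code T k u v w₁ w₂ :=
  ⟨⟨_, Nat.mod_lt _ T.size_pos⟩, ⟨_, Nat.mod_lt _ T.size_pos⟩, ⟨_, Nat.mod_lt _ T.size_pos⟩,
    ⟨_, Nat.mod_lt _ T.size_pos⟩, rfl, rfl, rfl, rfl⟩

/-- The last four digits of the counter in base `T.size` are the nodes and the rest is the round:
every round meets every quadruple once more. -/
theorem exists_code (s : ℕ) (u v w₁ w₂ : Fin T.size) : ∃ k, Code T k u v w₁ w₂ ∧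
    k / (T.size * T.size * T.size * T.size) = s := by
  have hm0 : 0 < T.size := T.size_pos
  have h1 : ∀ a (b : Fin T.size), (a * T.size + b) / T.size = a := fun a b => by
    rw [mul_comm, Nat.mul_add_div hm0, Nat.div_eq_of_lt b.2, add_zero]
  have h2 : ∀ a (b : Fin T.size), (a * T.size + b) % T.size = b := fun a b => by
    rw [Nat.mul_add_mod', Nat.mod_eq_of_lt b.2]
  refine ⟨(((s * T.size + u) * T.size + v) * T.size + w₁) * T.size + w₂, ⟨?_, ?_, ?_, ?_⟩, ?_⟩ <;>
    simp only [← Nat.div_div_eq_div_mul, h1, h2]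

/-- All edges that the iterations before `k` should have processed have been processed. -/
def Progress (D : Diagram n) (T : BranchDecomposition n) (k : ℕ) (σ : State) : Prop :=
  ∀ j < k, ∀ u v w₁ w₂, Code T j u v w₁ w₂ → Joint T u v w₁ w₂ →
    cutRank D.graph (T.side w₁ u) ≤ cutRank D.graph (T.side w₂ u) →
    (nodeSide T.tree u v).ncard ≤ 2 + j / (T.size * T.size * T.size * T.size) →
    σ.nat 8 (T.slot u v) = 1

/-- All edges at leaves have been processed. -/
def LeavesDone (T : BranchDecomposition n) (σ : State) : Prop :=
  ∀ x v, T.tree.Adj (T.leaf x).1 v → σ.nat 8 (T.slot (T.leaf x).1 v) = 1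

theorem LeavesDone.done (h : LeavesDone T σ) {u v : Fin T.size} (huv : T.tree.Adj u v)
    (hu : (T.tree.neighborSet u).ncard = 1) : σ.nat 8 (T.slot u v) = 1 := by
  have := h (T.leaf.symm ⟨u, hu⟩) v
  simp only [Equiv.apply_symm_apply] at this
  exact this huv

theorem exists_joint {u v : Fin T.size} (huv : T.tree.Adj u v)
    (hu : (T.tree.neighborSet u).ncard ≠ 1) : ∃ w₁ w₂, Joint T u v w₁ w₂ ∧
      cutRank D.graph (T.side w₁ u) ≤ cutRank D.graph (T.side w₂ u) := by
  obtain ⟨w₁, w₂, h1, h2, h12, hN⟩ := T.exists_neighbors huv hu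
  have a1 : T.tree.Adj u w₁ := by
    rw [← SimpleGraph.mem_neighborSet, hN]; simp
  have a2 : T.tree.Adj u w₂ := by
    rw [← SimpleGraph.mem_neighborSet, hN]; simp
  rcases le_total (cutRank D.graph (T.side w₁ u)) (cutRank D.graph (T.side w₂ u)) with h | h
  · exact ⟨w₁, w₂, ⟨huv, a1, a2, h1.symm, h2.symm, h12⟩, h⟩
  · exact ⟨w₂, w₁, ⟨huv, a2, a1, h2.symm, h1.symm, h12.symm⟩, h⟩

/-- Once round `s` is over, it has met the edge together with its two other neighbours in the order
of their cut-ranks, and all edges with at most `2 + s` nodes on their side are finished. -/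
theorem Progress.done {k s : ℕ} (h : Progress D T k σ) (hl : LeavesDone T σ)
    (hk : (s + 1) * (T.size * T.size * T.size * T.size) ≤ k) {u v : Fin T.size}
    (huv : T.tree.Adj u v) (hs : (nodeSide T.tree u v).ncard ≤ 2 + s) :
    σ.nat 8 (T.slot u v) = 1 := by
  have hm0 : 0 < T.size := T.size_pos
  by_cases hu : (T.tree.neighborSet u).ncard = 1
  · exact hl.done huv hu
  · obtain ⟨w₁, w₂, hj, hle⟩ := exists_joint (D := D) huv hu
    obtain ⟨j, hjc, hjs⟩ := exists_code s u v w₁ w₂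
    refine h j ?_ u v w₁ w₂ hjc hj hle (by rwa [hjs])
    refine lt_of_lt_of_le ?_ hk
    rw [← Nat.div_lt_iff_lt_mul (by positivity)]
    omega

/-- The sides of the children are strictly smaller, so an earlier round has dealt with them; in
round `0` they must be leaves. -/
theorem Progress.child_done {k : ℕ} (h : Progress D T k σ) (hl : LeavesDone T σ)
    {u v w : Fin T.size} (huv : T.tree.Adj u v) (huw : T.tree.Adj u w) (hwv : v ≠ w)
    (hs : (nodeSide T.tree u v).ncard ≤ 2 + k / (T.size * T.size * T.size * T.size)) :
    σ.nat 8 (T.slot w u) = 1 := by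
  have hm0 : 0 < T.size := T.size_pos
  have hlt := ncard_nodeSide_lt T.isTree huv huw.symm hwv.symm
  obtain ⟨s, hsk⟩ : ∃ s, k / (T.size * T.size * T.size * T.size) = s := ⟨_, rfl⟩
  rw [hsk] at hs
  -- In round `0` the side of `w` consists of one node; if `w` were an inner node, the nonempty side
  -- of a further neighbour would be strictly smaller still.
  rcases s with - | s
  · by_cases hw : (T.tree.neighborSet w).ncard = 1
    · exact hl.done huw.symm hw
    · obtain ⟨w₁, w₂, hj, -⟩ := exists_joint (D := D) huw.symm hw
      have h1 := ncard_nodeSide_lt T.isTree huw.symm hj.adj₁.symm hj.ne₁.symm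
      have h2 : 0 < (nodeSide T.tree w₁ w).ncard :=
        (Set.ncard_pos (Set.toFinite _)).2 ⟨_, self_mem_nodeSide T.tree w₁ w⟩
      omega
  · refine h.done hl (s := s) ?_ huw.symm (by omega)
    rw [← hsk]
    exact Nat.div_mul_le_self _ _

/-- There are `T.size` rounds of `T.size ^ 4` quadruples. Each iteration is charged the full
`flops(T)` rather than the summand of its own node, which loses only a polynomial factor. -/
theorem edgeLoop_spec (hσ : Table D T M σ) (hM : T.slots = M) (hl : LeavesDone T σ) :
    Ex n (T.flops D.graph) edgeLoop σ fun τ => Table D T M τ ∧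
      ∀ u v, T.tree.Adj u v → τ.nat 8 (T.slot u v) = 1 := by
  refine Ex.assume fun hn hf _ => ?_
  have hm0 : 0 < T.size := T.size_pos
  have hM' : T.size * T.size * 2 = M := hM
  refine Ex.forLt (f₁ := T.flops D.graph) (N := T.size * T.size * T.size * T.size * T.size)
    (fun k τ => Table D T M τ ∧ LeavesDone T τ ∧ Progress D T k τ) hf ?_ ?_ ?_ ?_ ?_ ?_
  · refine loop_bound hn (k := 10) (by norm_num) ?_
    calc T.size * T.size * T.size * T.size * T.size = T.size ^ 5 := by ring
      _ ≤ (n ^ 2) ^ 5 := Nat.pow_le_pow_left (size_le T hn) 5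
      _ = n ^ 10 := by ring
  -- The counter of this loop reaches a fifth power of the tree size; the bound `10 * n` on the
  -- number of bits leaves room for it.
  · calc T.size * T.size * T.size * T.size * T.size = T.size ^ 5 := by ring
      _ < (2 ^ (2 * n)) ^ 5 := Nat.pow_lt_pow_left (size_lt T) (by norm_num)
      _ = 2 ^ (10 * n) := by ring
  · intro k τ hI _
    simp [hI.1.env.m_eq]
  · refine ⟨hσ.setNat hM (by norm_num) _ _, fun x v hxv => ?_, fun j hj => absurd hj (by omega)⟩
    simpa using hl x v hxv
  · rintro k τ hk ⟨hτ, hl, hP⟩ hik -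
    obtain ⟨u, v, w₁, w₂, hc⟩ := Code.exists T k
    have hsz : ∀ u : Fin T.size, u.1 < 2 ^ (10 * n) := fun u =>
      lt_small (k := 2) (by norm_num) (u.2.trans (size_lt T))
    have hnext : ∀ υ : State, Table D T M υ →
        (∀ u' v', τ.nat 8 (T.slot u' v') = 1 → υ.nat 8 (T.slot u' v') = 1) →
        (Joint T u v w₁ w₂ →
          cutRank D.graph (T.side w₁ u) ≤ cutRank D.graph (T.side w₂ u) →
          (nodeSide T.tree u v).ncard ≤ 2 + k / (T.size * T.size * T.size * T.size) →
          υ.nat 8 (T.slot u v) = 1) →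
        Table D T M (υ.setNat 44 0 (k + 1)) ∧ LeavesDone T (υ.setNat 44 0 (k + 1)) ∧
          Progress D T (k + 1) (υ.setNat 44 0 (k + 1)) := by
      intro υ hυ hmono hnew
      refine ⟨hυ.setNat hM (by norm_num) _ _, fun x' v' hadj => ?_, ?_⟩
      · simpa using hmono _ _ (hl x' v' hadj)
      · intro j hj u' v' w₁' w₂' hc' hj' hle hs
        suffices υ.nat 8 (T.slot u' v') = 1 by simpa
        rcases Nat.lt_succ_iff_lt_or_eq.1 hj with hj | rfl
        · exact hmono _ _ (hP j hj u' v' w₁' w₂' hc' hj' hle hs)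
        · obtain rfl : u' = u := Fin.ext (hc'.fst.symm.trans hc.fst)
          obtain rfl : v' = v := Fin.ext (hc'.snd.symm.trans hc.snd)
          obtain rfl : w₁' = w₁ := Fin.ext (hc'.thd.symm.trans hc.thd)
          obtain rfl : w₂' = w₂ := Fin.ext (hc'.fth.symm.trans hc.fth)
          exact hnew hj' hle hs
    refine Ex.seq (Ex.set 0 u rfl (by simp [hik, hτ.env.m_eq, hc.fst]) (hsz u) ?_)
    refine Ex.seq (Ex.set 0 v rfl (by simp [hik, hτ.env.m_eq, hc.snd]) (hsz v) ?_)
    refine Ex.seq (Ex.set 0 w₁ rfl (by simp [hik, hτ.env.m_eq, hc.thd]) (hsz w₁) ?_)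
    refine Ex.seq (Ex.set 0 w₂ rfl (by simp [hik, hτ.env.m_eq, hc.fth]) (hsz w₂) ?_)
    refine Ex.seq (Ex.set 0 (T.slot u v) rfl (by simp [hτ.env.m_eq, BranchDecomposition.slot])
      (slot_small _ _) ?_)
    refine Ex.seq (Ex.set 0 (T.slot w₁ u) rfl (by simp [hτ.env.m_eq, BranchDecomposition.slot])
      (slot_small _ _) ?_)
    refine Ex.seq (Ex.set 0 (T.slot w₂ u) rfl (by simp [hτ.env.m_eq, BranchDecomposition.slot])
      (slot_small _ _) ?_)
    have hφt := ((((((hτ.setNat hM (a := 45) (by norm_num) 0 u).setNat hM (a := 46) (by norm_num)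
      0 v).setNat hM (a := 47) (by norm_num) 0 w₁).setNat hM (a := 48) (by norm_num) 0 w₂).setNat
      hM (a := 26) (by norm_num) 0 (T.slot u v)).setNat hM (a := 35) (by norm_num) 0
      (T.slot w₁ u)).setNat hM (a := 36) (by norm_num) 0 (T.slot w₂ u)
    set φ := ((((((τ.setNat 45 0 u).setNat 46 0 v).setNat 47 0 w₁).setNat 48 0 w₂).setNat 26 0
      (T.slot u v)).setNat 35 0 (T.slot w₁ u)).setNat 36 0 (T.slot w₂ u) with hφ
    have hφ8 : φ.nat 8 = τ.nat 8 := by funext e; simp [hφ]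
    have p26 : φ.nat 26 0 = T.slot u v := by simp [hφ]
    have p35 : φ.nat 35 0 = T.slot w₁ u := by simp [hφ]
    have p36 : φ.nat 36 0 = T.slot w₂ u := by simp [hφ]
    have p46 : φ.nat 46 0 = v := by simp [hφ]
    have p47 : φ.nat 47 0 = w₁ := by simp [hφ]
    have p48 : φ.nat 48 0 = w₂ := by simp [hφ]
    clear_value φ
    have hadj : ∀ a b : Fin T.size, adjacencyTable T.tree (T.slot a b) ≠ 0 ↔ T.tree.Adj a b :=
      fun a b => adjacencyTable_ne_zero T.tree a b
    have hone : ∀ a b : Fin T.size, (1 - (if a.1 = b.1 then 1 else 0) ≠ 0) ↔ a ≠ b := by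
      intro a b
      rw [ne_eq a, Fin.ext_iff]
      split_ifs <;> simp_all
    refine Ex.cond (adjacencyTable T.tree (T.slot u v) * adjacencyTable T.tree (T.slot w₁ u) *
      adjacencyTable T.tree (T.slot w₂ u) * (1 - if v.1 = w₁ then 1 else 0) *
      (1 - if v.1 = w₂ then 1 else 0) * (1 - if w₁.1 = w₂ then 1 else 0))
      (by simp [p26, p35, p36, p46, p47, p48, hφt.env.adjT]) ?_ ?_
    · intro hc
      simp only [mul_ne_zero_iff, hadj, hone] at hc
      obtain ⟨⟨⟨⟨⟨h0, h1⟩, h2⟩, n1⟩, n2⟩, n12⟩ := hc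
      have hjoint : Joint T u v w₁ w₂ := ⟨h0, h1.symm, h2.symm, n1, n2, n12⟩
      refine Ex.cond (φ.nat 8 (T.slot w₁ u) * φ.nat 8 (T.slot w₂ u) * (1 - φ.nat 8 (T.slot u v)) *
        (1 - if φ.nat 7 (T.slot w₂ u) < φ.nat 7 (T.slot w₁ u) then 1 else 0))
        (by simp [p26, p35, p36]) ?_ ?_
      · intro hr
        simp only [mul_ne_zero_iff] at hr
        obtain ⟨⟨⟨d1, d2⟩, d0⟩, hle⟩ := hr
        have e1 := hφt.data h1 d1
        have e2 := hφt.data h2 d2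
        have hle' : cutRank D.graph (T.side w₁ u) ≤ cutRank D.graph (T.side w₂ u) := by
          rw [← e1.slot.enum.rank_eq, ← e2.slot.enum.rank_eq]
          by_contra hlt
          exact hle (by simp [not_le.1 hlt])
        have hX := T.side_union h0 h1.symm h2.symm n1.symm n2.symm n12
        refine (edgeStep_spec hφt.env hM e1 e2 (T.side_disjoint h1.symm h2.symm n12) (slot_lt _ _)
          (slot_lt _ _) (slot_lt u v) ?_ ?_ p35 p36 p26 (hφt.fresh h0 ?_) hle' ?_).mono
          fun υ hfu hu => ?_
        · exact fun h => h1.ne (slot_inj h).1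
        · exact fun h => h2.ne (slot_inj h).1
        · intro h
          rw [h] at d0
          simp at d0
        · intro k ha hb hc
          rw [← hX] at hb hc
          exact T.two_pow_le_flops D.graph h0 h1.symm h2.symm n1.symm n2.symm n12 ha hb hc
        · obtain ⟨g1, g2⟩ := hφt.update hM (hφt.env.frame hfu (by decide)) (by rw [hX]; exact hu.1)
            hu.2.1 hu.2.2
          exact hnext υ g1 (fun u' v' h => g2 u' v' (by rwa [hφ8])) fun _ _ _ => hu.2.1
      · intro hr
        -- If the round is late enough for this edge, both children are finished, and with the
        -- cut-ranks in the right order the test can fail only because the edge itself is finished.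
        refine Ex.skip (hnext φ hφt (fun u' v' h => by rwa [hφ8]) fun _ hle hs => ?_)
        have d1 := hP.child_done hl h0 h1.symm n1 hs
        have d2 := hP.child_done hl h0 h2.symm n2 hs
        rw [← hφ8] at d1 d2
        have e1 := (hφt.data h1 (by simp [d1])).slot.enum.rank_eq
        have e2 := (hφt.data h2 (by simp [d2])).slot.enum.rank_eq
        rcases hφt.edge u v h0 with h | h
        · exact h.1
        · rw [d1, d2, h.1, e1, e2, if_neg (not_lt.2 hle)] at hr
          simp at hr
    · intro hz
      refine Ex.skip (hnext φ hφt (fun u' v' h => by rwa [hφ8]) fun hj _ _ => absurd hz ?_)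
      simp only [mul_ne_zero_iff, hadj, hone]
      exact ⟨⟨⟨⟨⟨hj.adj, hj.adj₁.symm⟩, hj.adj₂.symm⟩, hj.ne₁⟩, hj.ne₂⟩, hj.ne⟩
  · rintro τ ⟨h1, h2, h3⟩ _
    -- After the last round the bound on the side is `T.size + 1`, which every side satisfies.
    refine ⟨h1, fun u v huv => h3.done h2 (s := T.size - 1) ?_ huv ?_⟩
    · rw [Nat.sub_add_cancel hm0, mul_comm]
    · have := Set.ncard_le_card (nodeSide T.tree u v)
      simp only [Nat.card_eq_fintype_card, Fintype.card_fin] at this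
      omega

end Specs

/-! ### The final sum, the normalization and the whole program -/

section Specs

variable {n f : ℕ} {D : Diagram n} {T : BranchDecomposition n} {σ τ υ : State} {M : ℕ}

/-- The directed edge from the only neighbour of the leaf of spider `0` to that leaf cuts off all
other spiders, so `sum_amp_eq` needs just two entries of its transform. The loop searches for that
neighbour. -/
theorem sumProgram_spec (hσ : Table D T M σ) (hM : T.slots = M)
    (hd : ∀ u v, T.tree.Adj u v → σ.nat 8 (T.slot u v) = 1) :
    Ex n f sumProgram σ fun τ => τ.cpx 0 0 = ∑ x, amp D.graph D.phase x := by
  refine Ex.assume fun hn hf _ => ?_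
  have hn0 : 0 < n := by omega
  have hM' : T.size * T.size * 2 = M := hM
  set l := (T.leaf ⟨0, hn0⟩).1 with hl
  have h3 : σ.nat 3 0 = l := hσ.env.leaf ⟨0, hn0⟩
  have hadj : ∀ a b : Fin T.size, adjacencyTable T.tree (T.slot a b) ≠ 0 ↔ T.tree.Adj a b :=
    fun a b => adjacencyTable_ne_zero T.tree a b
  refine Ex.forLt (f₁ := f) (N := T.size) (fun k τ => (∃ v, v.1 < k ∧ T.tree.Adj l v) →
    τ.cpx 0 0 = ∑ x, amp D.graph D.phase x) hf
    (loop_bound hn (k := 2) (by norm_num) (size_le T hn))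
    (lt_small (k := 2) (by norm_num) (size_lt T)) ?_ ?_ ?_ ?_
  · intro k τ _ hfr
    simp [hfr.nat 0 (by decide), hσ.env.m_eq]
  · rintro ⟨v, hv, -⟩
    omega
  · intro k τ hk hI hik hfr
    have hτ : Env D T τ := hσ.env.frame hfr (by decide)
    refine Ex.seq (Ex.set 0 (T.slot ⟨k, hk⟩ l) rfl ?_ (slot_small _ _) ?_)
    · simp [hik, hτ.m_eq, hfr.nat 3 (by decide), h3, BranchDecomposition.slot]
    have hφe := hτ.setNat (a := 26) (by norm_num) 0 (T.slot ⟨k, hk⟩ l)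
    refine Ex.cond (adjacencyTable T.tree (T.slot ⟨k, hk⟩ l)) (by simp [hτ.adjT]) ?_ ?_
    · intro hc
      rw [hadj] at hc
      have hE := hσ.data hc (by rw [hd _ _ hc]; exact one_ne_zero)
      have hside : T.side ⟨k, hk⟩ l = {(⟨0, hn0⟩ : Fin n)}ᶜ := by
        rw [T.side_compl hc.symm, T.side_leaf _ hc.symm]
      rw [hside] at hE
      have c0 := hE.dual_eq (c := 0) zero_mem_supp
      have c1 := hE.dual_eq (c := Pi.single ⟨0, hn0⟩ 1) (Enum.single_mem_supp (by simp))
      rw [coord_zero, zero_mul, zero_add] at c0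
      refine Ex.seq (Ex.set 0 1 rfl rfl (two_lt_small hn (by norm_num)) ?_)
      have hf1 := (hfr.setNat (a := 26) (by decide) 0 (T.slot ⟨k, hk⟩ l)).setNat (a := 23)
        (by decide) 0 1
      refine Ex.seq ((coords_spec (hφe.setNat (a := 23) (by norm_num) 0 1) (s := 26)
        (e := T.slot ⟨k, hk⟩ l) (r := σ.nat 7 (T.slot ⟨k, hk⟩ l)) (c := 1) (Or.inl rfl) (by simp)
        (by simp [hfr.nat 7 (by decide)]) hE.slot.rk_le (by simp)
        (Nat.one_lt_two_pow (by omega))).mono fun υ hfu hu => ?_)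
      have hυf := hf1.andThen hfu (by decide) (by decide)
      have hυe : Env D T υ := hσ.env.frame hυf (by decide)
      have u26 : υ.nat 26 0 = T.slot ⟨k, hk⟩ l := by rw [hfu.nat 26 (by decide)]; simp
      -- The number `1`, stored in variable 23, is the mask of spider `0` alone; its coordinates
      -- give the position of the second entry. The first belongs to the zero vector and has index
      -- `0`.
      have hv1 : vec n 1 = Pi.single ⟨0, hn0⟩ 1 := by
        rw [← vec_two_pow]
        rfl
      have u24 : υ.nat 24 0 * M + T.slot ⟨k, hk⟩ l =
          coord (σ.nat 7 (T.slot ⟨k, hk⟩ l)) (fun j => vec n (σ.nat 9 (j * M + T.slot ⟨k, hk⟩ l)))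
            (Pi.single ⟨0, hn0⟩ 1) * M + T.slot ⟨k, hk⟩ l := by
        rw [hu, hM, hv1]
        simp [hfr.nat 9 (by decide)]
      have k2 : υ.cpx 2 = σ.cpx 2 := hυf.cpx 2 (by decide)
      have ha : υ.angle 0 = D.phase ⟨0, hn0⟩ := hυe.angle ⟨0, hn0⟩
      refine Ex.setC 0 (∑ x, amp D.graph D.phase x) rfl ?_ fun _ => by simp
      rw [sum_amp_eq D.graph D.phase ⟨0, hn0⟩, ← c0, ← c1, ← u24]
      simp [u26, hυe.m_eq, hM', k2, ha]
    · intro hc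
      refine Ex.skip ?_
      rintro ⟨v, hv, hlv⟩
      have : v.1 ≠ k := by
        rintro rfl
        exact (hadj v l).2 hlv.symm hc
      exact hI ⟨v, by omega, hlv⟩
  · intro τ hI _
    obtain ⟨v, hv⟩ := Set.ncard_eq_one.1 (T.leaf ⟨0, hn0⟩).2
    exact hI ⟨v, v.2, by rw [← SimpleGraph.mem_neighborSet, hv]; rfl⟩

theorem prod_range_mul_eq (F : ℕ → ℕ → ℂ) (R S : ℕ) :
    ∏ k ∈ Finset.range (R * S), F (k / S) (k % S) = ∏ u : Fin R, ∏ v : Fin S, F u v := by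
  rw [← Fin.prod_univ_eq_prod_range (fun k => F (k / S) (k % S)), ← Fintype.prod_prod_type',
    ← finProdFinEquiv.prod_comp]
  refine Finset.prod_congr rfl fun p _ => ?_
  have h1 : (finProdFinEquiv p).1 = p.2 + S * p.1 := rfl
  have hS : 0 < S := p.2.pos
  rw [h1, Nat.add_mul_div_left _ _ hS, Nat.add_mul_mod_self_left, Nat.div_eq_of_lt p.2.2,
    Nat.mod_eq_of_lt p.2.2, zero_add]

theorem normalizeProgram_spec (hσ : Env D T σ) :
    Ex n f normalizeProgram σ fun τ => τ.cpx 0 0 = (∏ u, ∏ v,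
      open Classical in if D.graph.Adj u v ∧ u < v then 1 / (Real.sqrt 2 : ℂ) else 1) *
        σ.cpx 0 0 := by
  classical
  refine Ex.assume fun hn hf _ => ?_
  have hn0 : 0 < n := by omega
  set F : ℕ → ℕ → ℂ := fun u v =>
    if adjacencyTable D.graph (u * n + v) ≠ 0 ∧ u < v then 1 / (Real.sqrt 2 : ℂ) else 1 with hF
  refine Ex.forLt (f₁ := f) (N := n * n) (fun k τ =>
    τ.cpx 0 0 = (∏ j ∈ Finset.range k, F (j / n) (j % n)) * σ.cpx 0 0) hf
    (loop_bound (k := 2) hn (by norm_num) (by rw [pow_two])) ?_ ?_ (by simp) ?_ ?_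
  · refine lt_small (k := 2) (by norm_num) ?_
    calc n * n < 2 ^ n * 2 ^ n := Nat.mul_lt_mul'' Nat.lt_two_pow_self Nat.lt_two_pow_self
      _ = 2 ^ (2 * n) := by ring
  · intro k τ _ hfr
    simp [hfr.nat 0 (by decide), hσ.n_eq]
  · intro k τ hk hI hik hfr
    have hτ : Env D T τ := hσ.frame hfr (by decide)
    refine Ex.cond (adjacencyTable D.graph k * if k / n < k % n then 1 else 0)
      (by simp [hik, hτ.n_eq, hτ.adjG]) ?_ ?_
    · intro hc
      refine Ex.setC 0 _ rfl rfl ?_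
      have h : F (k / n) (k % n) = 1 / (Real.sqrt 2 : ℂ) := by
        rw [hF]
        simp only [Nat.div_add_mod']
        rw [if_pos]
        simpa [and_comm] using hc
      rw [Finset.prod_range_succ, h]
      simp [hI]
      ring
    · intro hc
      refine Ex.skip ?_
      have h : F (k / n) (k % n) = 1 := by
        rw [hF]
        simp only [Nat.div_add_mod']
        rw [if_neg]
        rintro ⟨h1, h2⟩
        simp [h1, h2] at hc
      rw [Finset.prod_range_succ, h, mul_one]
      simpa using hI
  · intro τ hI _
    rw [hI, prod_range_mul_eq]
    congr 1
    refine Finset.prod_congr rfl fun u _ => Finset.prod_congr rfl fun v _ => ?_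
    rw [hF]
    refine if_congr ?_ rfl rfl
    rw [adjacencyTable_ne_zero, Fin.lt_def]

/-- Only the loop over inner edges needs `f` to be `flops(T)`; the other parts run within their
bounds for every `f ≥ 1`. -/
theorem contract_spec (D : Diagram n) (T : BranchDecomposition n) :
    Ex n (T.flops D.graph) contract (inputState D T) fun τ => τ.output = D.scalar := by
  refine Ex.seq ((initProgram_table (M := T.slots) D T).mono fun σ _ h₁ => ?_)
  refine Ex.seq ((leafLoop_spec h₁ rfl).mono fun τ _ h₂ => ?_)
  refine Ex.seq ((edgeLoop_spec h₂.1 rfl h₂.2).mono fun υ _ h₃ => ?_)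
  refine Ex.seq ((sumProgram_spec h₃.1 rfl h₃.2).mono fun φ hfr h₄ => ?_)
  refine (normalizeProgram_spec (h₃.1.env.frame hfr (by decide))).mono fun ψ _ h₅ => ?_
  rw [State.output, h₅, h₄, D.scalar_eq]

theorem inputState_small (D : Diagram n) (T : BranchDecomposition n) (hn : 2 ≤ n) :
    (inputState D T).Small n := by
  intro a i
  have hnn : n < 2 ^ n := Nat.lt_two_pow_self
  have hm := lt_small (k := 2) (by norm_num) (size_lt T)
  have hpos : 0 < 2 ^ (10 * n) := by positivity
  have hadj : ∀ {m : ℕ} (G : SimpleGraph (Fin m)), adjacencyTable G i < 2 ^ (10 * n) := by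
    intro m G
    refine two_lt_small hn ?_
    unfold adjacencyTable
    split_ifs <;> norm_num
  match a with
  | 0 =>
    simp only [inputState]
    split_ifs
    · exact small_of_lt hnn
    · exact hm
    · exact hpos
  | 1 => exact hadj _
  | 2 => exact hadj _
  | 3 =>
    simp only [inputState]
    split_ifs
    · exact (Fin.is_lt _).trans hm
    · exact hpos
  | _ + 4 => exact hpos

end Specs

end ZXContraction

end

/-- One program contracts every closed graph-like ZX-diagram `D` along every rank-decomposition `T`
of its graph in time `flops(T)` times a fixed polynomial in the number `n` of spiders. -/
theorem proposition1 :
    ∃ (P : ZXContraction.Program) (c k : ℕ),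
      ∀ (n : ℕ) (D : ZXContraction.Diagram n) (T : ZXContraction.BranchDecomposition n),
        ∃ (t : ℕ) (τ : ZXContraction.State),
          ZXContraction.Runs P (ZXContraction.inputState D T) t τ ∧
          τ.output = D.scalar ∧
          t ≤ c * n ^ k * T.flops D.graph := by
  -- The exponent is the degree read off the program text, so it is independent of `n`, `D` and `T`;
  -- no constant is left over because `n ≥ 2` has absorbed them all.
  refine ⟨ZXContraction.contract, 1, ZXContraction.contract.deg, fun n D T => ?_⟩
  obtain ⟨t, τ, h1, h2, -, h3⟩ := ZXContraction.contract_spec D T T.two_le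
    (T.flops_pos D.graph) (ZXContraction.inputState_small D T T.two_le)
  exact ⟨t, τ, h1, h3, by rwa [one_mul]⟩
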